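/- **Setting.** There are $m$ identical items and $n$ players. Player $i$ has a domain $V_i$ of normalized, non-decreasing valuations $v:\{0,\dots,m\}\to\mathbb R$ ($v(0)=0$), totally ordered by $\succ_i$. The domain is *single-crossing*: $v'(s')-v'(s)\ge v(s')-v(s)$ whenever $v'\succ_i v$ and $s'>s$. It is *minded* with respect to a publicly known set $K_i\subseteq\{1,\dots,m\}$: $v(s)=v(s-1)$ for all $v\in V_i$ and all $s\ge 1$ with $s\notin K_i$. Let $k=\max_i|K_i|\ge 1$. An allocation is $s=(s_1,\dots,s_n)\in\mathbb Z_{\ge0}^n$ with $\sum_i s_i\le m$, and its welfare is $\sum_i v_i(s_i)$. **The allocation rule.** Fix $\varepsilon>0$. Given $(v_1,\dots,v_n)$: 1. Let $v_{\max}=\max_i v_i(m)$, and let $\delta$ be the largest power $(4kn)^p$, $p\in\mathbb Z$, with $(4kn)^p\le \frac{\varepsilon v_{\max}}{3n^2k^2}$ (if $v_{\max}=0$, put $\delta=0$). 2. Let $v_i^\delta(s)=\sum_{j=1}^{s}\lfloor v_i(j)-v_i(j-1)\rfloor_\delta$, where $\lfloor x\rfloor_\delta$ is $x$ rounded down to a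 multiple of $\delta$ (and $\lfloor x\rfloor_0=0$). 3. Let $TOP=\{i: v_i(m)\ge 3\delta n^2k^2/\varepsilon\}$. Let $u_i(s)=v_i^\delta(s)+|\{q\in K_i: q\le s\}|\cdot 2\delta kn$ for $i\in TOP$, and $u_i=v_i^\delta$ for $i\notin TOP$. 4. Output the allocation that maximizes $\sum_i u_i(s_i)$. Among several maximizers choose the largest in the order $\succ$ in which $s'\succ s$ if $\sum_i s_i'<\sum_i s_i$, or if the sums are equal and $s'_l>s_l$ for the largest index $l$ at which $s$ and $s'$ differ. Call the resulting function $f$. Its associated payments are as follows. Fix $i$ and $v_{-i}$, and let $a_0<a_1<\cdots$ be the numbers of items in the image of $f_i(\cdot,v_{-i})$. Then $a_0$ items cost player $i$ nothing, and the price of $a_j$ items exceeds that of $a_{j-1}$ items by $\inf\{v(a_j)-v(a_{j-1}) : v\in V_i,\ f_i(v,v_{-i})=a_j\}$. **Theorem.** (a) The rule $f$ is implementable: for every player $i$ and every $v_{-i}$ there is a payment function under which truth-telling is optimal for $i$. In particular, $f$ with its associated payments is incentive-compatible. The output of $f$ has welfare at least $(1-\varepsilon)$ times the maximal welfare. (b)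 Suppose that each domain is enumerated in increasing order as $v_i^0,v_i^1,\dots$ (finite or infinite), that $\varepsilon$ is rational, and that all values are rational and are given by an oracle which answers an extended value query $(i,t,s)$ with a representation (numerator and denominator) of $v_i^t(s)$, where a number $x$ never has a longer representation than a number $x'\ge x$. Then there is a single algorithm (a random access machine program with oracle access, with logarithmic cost) that, on input $n$, $m$, $\varepsilon$, $K_1,\dots,K_n$ and indices $t_1,\dots,t_n$, computes the allocation and all associated payments for $(v_1^{t_1},\dots,v_n^{t_n})$. Its running time and its number of queries are at most $\mathrm{poly}(k,n,\frac1\varepsilon,\log m,c,\log(\max_i t_i))$, where $c$ is the number of bits used to represent the numbers in the instance: the values $v_i^{t_i}(s)$, and $\varepsilon$. -/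

import Mathlib

open scoped BigOperators

universe u

/-! ### Valuations and domains

There are `n` players and `m` identical items.  A valuation is a function `v : ℕ → ℝ`, of which only
the values `v s` with `s ≤ m` are ever used.  A domain of valuations is a family `V : T → ℕ → ℝ`
indexed by a linear order `T`, which is the order of the domain. -/

/-- `v` is normalized and non-decreasing on `{0, …, m}`. -/
def IsValuation (m : ℕ) (v : ℕ → ℝ) : Prop :=
  v 0 = 0 ∧ ∀ s s' : ℕ, s ≤ s' → s' ≤ m → v s ≤ v s'

/-- `v` is minded with respect to the set `K ⊆ {1, …, m}` of quantities: its value can change only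
at the quantities in `K`. -/
def IsMinded (m : ℕ) (K : Finset ℕ) (v : ℕ → ℝ) : Prop :=
  K ⊆ Finset.Icc 1 m ∧ ∀ s : ℕ, 1 ≤ s → s ≤ m → s ∉ K → v s = v (s - 1)

/-- The single-crossing property of a multi-unit auction domain: a larger valuation has larger
marginals. -/
def SingleCrossing (m : ℕ) {T : Type u} [LinearOrder T] (V : T → ℕ → ℝ) : Prop :=
  ∀ t t' : T, t < t' → ∀ s s' : ℕ, s < s' → s' ≤ m → V t s' - V t s ≤ V t' s' - V t' s

/-- A single-crossing domain of valuations, all minded with respect to the same set `K`. -/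
def IsMindedSingleCrossing (m : ℕ) (K : Finset ℕ) {T : Type u} [LinearOrder T]
    (V : T → ℕ → ℝ) : Prop :=
  (∀ t, IsValuation m (V t)) ∧ (∀ t, IsMinded m K (V t)) ∧ SingleCrossing m V

/-- `k = maxᵢ |Kᵢ|`. -/
def maxSteps {n : ℕ} (K : Fin n → Finset ℕ) : ℕ := Finset.univ.sup fun i => (K i).card

/-! ### Implementability and payments -/

/-- A rule for one player, assigning a number of items to each of his valuations, is implementable
if some payment function makes truth-telling optimal. -/
def ImplementableFor {T : Type u} (V : T → ℕ → ℝ) (g : T → ℕ) : Prop :=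
  ∃ P : T → ℝ, ∀ t t' : T, V t (g t') - P t' ≤ V t (g t) - P t

/-- An allocation rule is implementable if it is implementable for every player, whatever the
valuations of the others. -/
def Implementable {n : ℕ} {T : Fin n → Type u} (V : ∀ i, T i → ℕ → ℝ)
    (f : (∀ i, T i) → Fin n → ℕ) : Prop :=
  ∀ (i : Fin n) (t : ∀ j, T j), ImplementableFor (V i) fun x => f (Function.update t i x) i

/-- The mechanism with allocation rule `f` and payments `P` is incentive-compatible. -/
def IncentiveCompatible {n : ℕ} {T : Fin n → Type u} (V : ∀ i, T i → ℕ → ℝ)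
    (f : (∀ i, T i) → Fin n → ℕ) (P : (∀ i, T i) → Fin n → ℝ) : Prop :=
  ∀ (i : Fin n) (t : ∀ j, T j) (x : T i),
    V i (t i) (f (Function.update t i x) i) - P (Function.update t i x) i
      ≤ V i (t i) (f t i) - P t i

open Classical in
/-- The price of `a` items for a player with the rule `g`.  If `a₀ < a₁ < ⋯` are the quantities in
the image of `g`, then `a₀` costs `0` and the price of `aⱼ` exceeds that of `aⱼ₋₁` by
`inf {V x aⱼ - V x aⱼ₋₁ | g x = aⱼ}`. -/
noncomputable def price {T : Type u} (V : T → ℕ → ℝ) (g : T → ℕ) (a : ℕ) : ℝ :=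
  ∑ b ∈ (Finset.range (a + 1)).filter (fun b => b ∈ Set.range g ∧ ∃ b' ∈ Set.range g, b' < b),
    sInf ((fun x => V x b - V x (sSup {b' | b' ∈ Set.range g ∧ b' < b})) '' {x | g x = b})

/-- The payments associated with the allocation rule `f`. -/
noncomputable def payment {n : ℕ} {T : Fin n → Type u} (V : ∀ i, T i → ℕ → ℝ)
    (f : (∀ i, T i) → Fin n → ℕ) (t : ∀ i, T i) (i : Fin n) : ℝ :=
  price (V i) (fun x => f (Function.update t i x) i) (f t i)

/-! ### The allocation rule -/

/-- `v_max = maxᵢ vᵢ(m)`. -/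
noncomputable def vMax {n : ℕ} (m : ℕ) (v : Fin n → ℕ → ℝ) : ℝ := ⨆ i, v i m

/-- The largest power of `4kn` with an integer exponent that is at most `ε v_max / (3n²k²)`.
There is none if `v_max = 0`; the supremum over the empty set is then `0`. -/
noncomputable def roundingUnit (n k : ℕ) (ε w : ℝ) : ℝ :=
  sSup {x : ℝ | ∃ p : ℤ, x = (4 * k * n : ℝ) ^ p ∧ x ≤ ε * w / (3 * (n : ℝ) ^ 2 * (k : ℝ) ^ 2)}

/-- `x` rounded down to a multiple of `δ` (and `0` if `δ = 0`). -/
noncomputable def roundDown (δ x : ℝ) : ℝ := ⌊x / δ⌋ * δ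

/-- The `δ`-marginal-rounded valuation of `v`. -/
noncomputable def marginalRounded (δ : ℝ) (v : ℕ → ℝ) (s : ℕ) : ℝ :=
  ∑ j ∈ Finset.Icc 1 s, roundDown δ (v j - v (j - 1))

open Classical in
/-- The rounded valuation of a player with steps `K`, with a reward of `2δkn` at each step if the
player is in `TOP`, that is, if `v(m) ≥ 3δn²k²/ε`. -/
noncomputable def rewarded (n m k : ℕ) (ε δ : ℝ) (K : Finset ℕ) (v : ℕ → ℝ) (s : ℕ) : ℝ :=
  if 3 * δ * (n : ℝ) ^ 2 * (k : ℝ) ^ 2 / ε ≤ v m then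
    marginalRounded δ v s + ((K.filter (· ≤ s)).card : ℝ) * (2 * δ * k * n)
  else marginalRounded δ v s

/-- An allocation gives away at most `m` items. -/
def IsAllocation {n : ℕ} (m : ℕ) (s : Fin n → ℕ) : Prop := ∑ i, s i ≤ m

/-- The welfare of an allocation. -/
def welfare {n : ℕ} (v : Fin n → ℕ → ℝ) (s : Fin n → ℕ) : ℝ := ∑ i, v i (s i)

/-- The tie-breaking order: `s'` is preferred to `s` if it allocates fewer items in total, or as
many and `s'ₗ > sₗ` for the largest index `l` at which the two differ. -/
def Preferred {n : ℕ} (s' s : Fin n → ℕ) : Prop :=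
  ∑ i, s' i < ∑ i, s i ∨
    (∑ i, s' i = ∑ i, s i ∧ ∃ l, s l < s' l ∧ ∀ j, l < j → s' j = s j)

/-- `s` is the most preferred among the welfare-maximizing allocations. -/
def IsSelected {n : ℕ} (m : ℕ) (u : Fin n → ℕ → ℝ) (s : Fin n → ℕ) : Prop :=
  IsAllocation m s ∧ (∀ s', IsAllocation m s' → welfare u s' ≤ welfare u s) ∧
    ∀ s', IsAllocation m s' → welfare u s' = welfare u s → s' ≠ s → Preferred s s'

theorem finite_isAllocation (n m : ℕ) : {s : Fin n → ℕ | IsAllocation m s}.Finite := by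
  refine (Set.finite_Iic (fun _ : Fin n => m)).subset fun s hs i => ?_
  exact (Finset.single_le_sum (fun _ _ => Nat.zero_le _) (Finset.mem_univ i)).trans hs

theorem preferred_or {n : ℕ} {s s' : Fin n → ℕ} (h : s' ≠ s) :
    Preferred s s' ∨ Preferred s' s := by
  rcases lt_trichotomy (∑ i, s i) (∑ i, s' i) with h1 | h1 | h1
  · exact Or.inl (Or.inl h1)
  · have hne : (Finset.univ.filter fun i => s' i ≠ s i).Nonempty := by
      obtain ⟨i, hi⟩ := Function.ne_iff.1 h
      exact ⟨i, by simpa using hi⟩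
    set l := (Finset.univ.filter fun i => s' i ≠ s i).max' hne with hl
    have hmem := Finset.max'_mem _ hne
    rw [← hl] at hmem
    have hmax : ∀ j, l < j → s' j = s j := by
      intro j hj
      by_contra hc
      exact absurd (Finset.le_max' _ j (by simpa using hc)) (not_le.2 hj)
    rcases lt_or_gt_of_ne (Finset.mem_filter.1 hmem).2 with h2 | h2
    · exact Or.inl (Or.inr ⟨h1, l, h2, fun j hj => (hmax j hj).symm⟩)
    · exact Or.inr (Or.inr ⟨h1.symm, l, h2, hmax⟩)
  · exact Or.inr (Or.inl h1)

theorem preferred_trans {n : ℕ} {a b c : Fin n → ℕ} (hab : Preferred a b) (hbc : Preferred b c) :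
    Preferred a c := by
  rcases hab with h | ⟨h, l, hl, hl'⟩
  · rcases hbc with h2 | ⟨h2, _⟩
    · exact Or.inl (h.trans h2)
    · exact Or.inl (h2 ▸ h)
  · rcases hbc with h2 | ⟨h2, r, hr, hr'⟩
    · exact Or.inl (h ▸ h2)
    · refine Or.inr ⟨h.trans h2, ?_⟩
      rcases lt_trichotomy l r with h3 | h3 | h3
      · exact ⟨r, by rw [hl' r h3]; exact hr,
          fun j hj => (hl' j (h3.trans hj)).trans (hr' j hj)⟩
      · subst h3
        exact ⟨l, hr.trans hl, fun j hj => (hl' j hj).trans (hr' j hj)⟩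
      · exact ⟨l, by rw [← hr' l h3]; exact hl,
          fun j hj => (hl' j hj).trans (hr' j (h3.trans hj))⟩

theorem preferred_irrefl {n : ℕ} (a : Fin n → ℕ) : ¬ Preferred a a := by
  rintro (h | ⟨_, l, hl, _⟩)
  · exact lt_irrefl _ h
  · exact lt_irrefl _ hl

theorem existsUnique_isSelected {n : ℕ} (m : ℕ) (u : Fin n → ℕ → ℝ) :
    ∃! s, IsSelected m u s := by
  obtain ⟨a, ha, hmax⟩ := Set.exists_max_image _ (welfare u) (finite_isAllocation n m)
    ⟨fun _ => 0, by simp [IsAllocation]⟩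
  let S : Set (Fin n → ℕ) := {s | IsAllocation m s ∧ welfare u s = welfare u a}
  have hS : S.Finite := (finite_isAllocation n m).subset fun s hs => hs.1
  have key : ∀ F : Finset (Fin n → ℕ), F.Nonempty →
      ∃ s ∈ F, ∀ s' ∈ F, s' ≠ s → Preferred s s' := by
    intro F hF
    induction hF using Finset.Nonempty.cons_induction with
    | singleton x => exact ⟨x, by simp, by simp⟩
    | cons x F hx hF ih =>
      obtain ⟨s, hs, h⟩ := ih
      have hxs : x ≠ s := fun e => hx (e ▸ hs)
      rcases preferred_or hxs with h1 | h1
      · refine ⟨s, by simp [hs], fun s' hs' hne => ?_⟩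
        rcases Finset.mem_cons.1 hs' with rfl | h2
        · exact h1
        · exact h s' h2 hne
      · refine ⟨x, by simp, fun s' hs' hne => ?_⟩
        rcases Finset.mem_cons.1 hs' with rfl | h2
        · exact absurd rfl hne
        · by_cases e : s' = s
          · exact e ▸ h1
          · exact preferred_trans h1 (h s' h2 e)
  obtain ⟨s, hs, h⟩ := key hS.toFinset ⟨a, by simpa [S] using ha⟩
  have hs' : s ∈ S := by simpa using hs
  have hsel : IsSelected m u s :=
    ⟨hs'.1, fun s' h' => hs'.2 ▸ hmax s' h', fun s' h' he hne =>
      h s' (by simpa [S] using ⟨h', he.trans hs'.2⟩) hne⟩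
  refine ⟨s, hsel, fun r hr => ?_⟩
  by_contra hne
  have he : welfare u r = welfare u s := le_antisymm (hsel.2.1 r hr.1) (hr.2.1 s hsel.1)
  exact preferred_irrefl _ (preferred_trans (hsel.2.2 r hr.1 he hne)
    (hr.2.2 s hsel.1 he.symm (Ne.symm hne)))

/-- The welfare-maximizing allocation chosen by the tie-breaking rule. -/
noncomputable def selected {n : ℕ} (m : ℕ) (u : Fin n → ℕ → ℝ) : Fin n → ℕ :=
  (existsUnique_isSelected m u).choose

/-- The allocation rule, on a profile `v` of valuations with step sets `K`. -/
noncomputable def allocRule {n : ℕ} (m : ℕ) (K : Fin n → Finset ℕ) (ε : ℝ)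
    (v : Fin n → ℕ → ℝ) : Fin n → ℕ :=
  selected m fun i =>
    rewarded n m (maxSteps K) ε (roundingUnit n (maxSteps K) ε (vMax m v)) (K i) (v i)

/-! ### Random access machines with an oracle and logarithmic cost

Programs are structured random access machine programs.  The memory consists of arrays of integer
registers: `σ a j` is the content of register `j` of array `a`.  Every operation costs at least
one and is charged for the binary length of the numbers it handles (addresses included). -/

/-- The memory of the machine. -/
abbrev Memory := ℕ → ℕ → ℤ

/-- An oracle for extended value queries: `q i t s` is the numerator and the denominator of the
value of `s` items in the `t`-th valuation of player `i`. -/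
abbrev ValueOracle := ℕ → ℕ → ℕ → ℕ × ℕ

/-- Binary length of an integer, with its sign. -/
def bits (z : ℤ) : ℕ := z.natAbs.size + 1

/-- The arithmetic operations of the machine; division rounds down. -/
inductive ArithOp
  | add | sub | mul | div

def ArithOp.eval : ArithOp → ℤ → ℤ → ℤ
  | .add, x, y => x + y
  | .sub, x, y => x - y
  | .mul, x, y => x * y
  | .div, x, y => Int.fdiv x y

/-- Arithmetic expressions: constants, (indirect) memory accesses and operations. -/
inductive RExpr
  | const (z : ℤ)
  | cell (a : ℕ) (idx : RExpr)
  | op (o : ArithOp) (e₁ e₂ : RExpr)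

def RExpr.eval (σ : Memory) : RExpr → ℤ
  | .const z => z
  | .cell a idx => σ a (idx.eval σ).toNat
  | .op o e₁ e₂ => o.eval (e₁.eval σ) (e₂.eval σ)

/-- The cost of evaluating an expression; an arithmetic operation costs the square of the length
of its operands. -/
def RExpr.cost (σ : Memory) : RExpr → ℕ
  | .const z => bits z
  | .cell a idx => idx.cost σ + bits (idx.eval σ) + bits (σ a (idx.eval σ).toNat)
  | .op _ e₁ e₂ => e₁.cost σ + e₂.cost σ + (bits (e₁.eval σ) + bits (e₂.eval σ)) ^ 2

/-- Programs. -/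
inductive Program
  | skip
  | assign (a : ℕ) (idx e : RExpr)
  | query (a b : ℕ) (i t s : RExpr)
  | seq (P Q : Program)
  | ifLe (e₁ e₂ : RExpr) (P Q : Program)
  | whileLe (e₁ e₂ : RExpr) (P : Program)

/-- Write `z` into register `j` of array `a`. -/
def Memory.write (σ : Memory) (a j : ℕ) (z : ℤ) : Memory :=
  Function.update σ a (Function.update (σ a) j z)

/-- `Exec q P σ σ' c r`: with the oracle `q`, the program `P` started in memory `σ` halts in memory
`σ'` after time `c` and `r` queries.  A query writes the numerator of the answer into register `0`
of array `a`, and its denominator into register `0` of array `b`. -/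
inductive Exec (q : ValueOracle) : Program → Memory → Memory → ℕ → ℕ → Prop
  | skip (σ : Memory) : Exec q .skip σ σ 1 0
  | assign (σ : Memory) (a : ℕ) (idx e : RExpr) :
      Exec q (.assign a idx e) σ (σ.write a (idx.eval σ).toNat (e.eval σ))
        (idx.cost σ + e.cost σ + bits (idx.eval σ) + bits (e.eval σ)) 0
  | query (σ : Memory) (a b : ℕ) (i t s : RExpr) (x y : ℕ)
      (h : q (i.eval σ).toNat (t.eval σ).toNat (s.eval σ).toNat = (x, y)) :
      Exec q (.query a b i t s) σ ((σ.write a 0 x).write b 0 y)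
        (i.cost σ + t.cost σ + s.cost σ + bits (i.eval σ) + bits (t.eval σ) + bits (s.eval σ)
          + bits x + bits y) 1
  | seq {P Q : Program} {σ σ' σ'' : Memory} {c c' r r' : ℕ}
      (hP : Exec q P σ σ' c r) (hQ : Exec q Q σ' σ'' c' r') :
      Exec q (.seq P Q) σ σ'' (c + c') (r + r')
  | ifTrue {e₁ e₂ : RExpr} {P Q : Program} {σ σ' : Memory} {c r : ℕ}
      (h : e₁.eval σ ≤ e₂.eval σ) (hP : Exec q P σ σ' c r) :
      Exec q (.ifLe e₁ e₂ P Q) σ σ'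
        (e₁.cost σ + e₂.cost σ + bits (e₁.eval σ) + bits (e₂.eval σ) + c) r
  | ifFalse {e₁ e₂ : RExpr} {P Q : Program} {σ σ' : Memory} {c r : ℕ}
      (h : ¬ e₁.eval σ ≤ e₂.eval σ) (hQ : Exec q Q σ σ' c r) :
      Exec q (.ifLe e₁ e₂ P Q) σ σ'
        (e₁.cost σ + e₂.cost σ + bits (e₁.eval σ) + bits (e₂.eval σ) + c) r
  | whileTrue {e₁ e₂ : RExpr} {P : Program} {σ σ' σ'' : Memory} {c c' r r' : ℕ}
      (h : e₁.eval σ ≤ e₂.eval σ) (hP : Exec q P σ σ' c r)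
      (hW : Exec q (.whileLe e₁ e₂ P) σ' σ'' c' r') :
      Exec q (.whileLe e₁ e₂ P) σ σ''
        (e₁.cost σ + e₂.cost σ + bits (e₁.eval σ) + bits (e₂.eval σ) + c + c') (r + r')
  | whileFalse {e₁ e₂ : RExpr} {P : Program} {σ : Memory} (h : ¬ e₁.eval σ ≤ e₂.eval σ) :
      Exec q (.whileLe e₁ e₂ P) σ σ
        (e₁.cost σ + e₂.cost σ + bits (e₁.eval σ) + bits (e₂.eval σ)) 0

/-! ### Input and output of the mechanism -/

/-- The value that an oracle answer stands for. -/
noncomputable def answerValue (x : ℕ × ℕ) : ℝ := (x.1 : ℝ) / (x.2 : ℝ)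

/-- The number of bits of an oracle answer. -/
def answerBits (x : ℕ × ℕ) : ℕ := x.1.size + x.2.size

/-- The indices of a domain with `N` valuations, `N` possibly infinite. -/
abbrev DomainIndex (N : ℕ∞) : Type := {t : ℕ // (t : ℕ∞) < N}

/-- The domain of player `i` that the oracle describes. -/
noncomputable def oracleDomain (q : ValueOracle) (i : ℕ) (N : ℕ∞) : DomainIndex N → ℕ → ℝ :=
  fun t s => answerValue (q i t s)

/-- The input of the machine: array `0` holds `n`, `m`, `k` and the numerator and denominator of
`ε`, array `1` the indices `tᵢ`, array `2` the numbers `|Kᵢ|`, and array `3` at `i * k + j` the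
`j`-th smallest element of `Kᵢ`.  All other registers are `0`. -/
def inputMemory {n : ℕ} (m : ℕ) (K : Fin n → Finset ℕ) (ε : ℚ) (t : Fin n → ℕ) : Memory
  | 0, j => [(n : ℤ), (m : ℤ), (maxSteps K : ℤ), ε.num, (ε.den : ℤ)].getD j 0
  | 1, j => if h : j < n then (t ⟨j, h⟩ : ℤ) else 0
  | 2, j => if h : j < n then ((K ⟨j, h⟩).card : ℤ) else 0
  | 3, j => if h : j / maxSteps K < n then
      ((((K ⟨j / maxSteps K, h⟩).sort (· ≤ ·)).getD (j % maxSteps K) 0 : ℕ) : ℤ) else 0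
  | _, _ => 0

/-- The machine outputs the allocation `s` and the payments `P`: array `4` holds the allocation,
arrays `5` and `6` the numerators and denominators of the payments. -/
def IsOutput {n : ℕ} (σ : Memory) (s : Fin n → ℕ) (P : Fin n → ℝ) : Prop :=
  ∀ i : Fin n, σ 4 i = s i ∧ σ 6 i ≠ 0 ∧ P i = (σ 5 i : ℝ) / (σ 6 i : ℝ)

/-! ### Cost of programs on bounded registers -/

/-! Incentives. In a single-crossing domain it suffices that each player's share is non-decreasing
in his own index (`allocRule_mono`). Then a player's marginal between consecutive quantities exceeds
the price increment exactly where he should buy, and telescoping gives truthfulness (`price_sub_le`,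
`price_incentive`).

For monotonicity, let player `i` rise from `v` to `v'`, and suppose his share drops, from the
allocation `s` to `s'`. It is enough that the change of valuations does not reduce the advantage of
`s` over `s'`: optimality then makes the two tie under both profiles, and the tie-breaking order,
being strict, makes them equal (`IsSelected.eq_of_le`). If the rounding unit `δ` stays the same,
only `i` contributes to the change, and he gains on every step between the two shares. If it jumps
to `δ'`, then `δ' ≥ 4knδ`, player `i` is in `TOP`, and nobody else is. Since `s i` is itself a step,
`i` would give up a reward of `2δ'kn`. Rounding and old rewards disturb each step by at most
`3δ'/2`, and there are at most `k` steps per player, so the reward dominates.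

Approximation. Rounding and rewards change the welfare by at most `nkδ + 2n²k²δ ≤ 3n²k²δ ≤ ε·v_max`,
and the optimum is at least `v_max`.

Computation. In units of `δ` the modified valuations are integers bounded polynomially in `k`, `n`
and `1/ε` (`rewardedUnits_le`). A dynamic program over players and total value stores the least
number of items needed. Backtracking from the last player, always taking the last optimal option,
realises the tie-breaking rule (`isSelected_of_isBacktrack`). By monotonicity, the least index at
which a player gets more than a given number of items is found by binary search. It yields the next
quantity in the image, and it attains the infimum that defines the price increment. At most `k`
increments are needed per player.

Running time. `Run` is a total-correctness triple that counts steps while every register stays below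
a fixed `B`. Each step costs a program constant times the square of the length of `B`, so a bound on
steps and one on registers suffice. The assumption on representations bounds the oracle answers at
all smaller indices, which the searches visit. -/

theorem bits_pos (z : ℤ) : 1 ≤ bits z := by simp [bits]

theorem bits_le_of_natAbs_le {z : ℤ} {B : ℕ} (h : z.natAbs ≤ B) : bits z ≤ B.size + 1 := by
  simpa [bits] using Nat.size_le_size h

/-- Every result stays below the product of the two powers of two bounding the operands, times two.
The two sign bits counted on the right pay for this extra bit and for the sign of the result. -/
theorem ArithOp.bits_eval_le (o : ArithOp) (x y : ℤ) : bits (o.eval x y) ≤ bits x + bits y := by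
  have key : ∀ z : ℤ, z.natAbs < 2 ^ (x.natAbs.size + y.natAbs.size + 1) →
      bits z ≤ bits x + bits y := by
    intro z hz
    have := Nat.size_le.2 hz
    simp only [bits]; omega
  apply key
  have hx : x.natAbs < 2 ^ x.natAbs.size := Nat.lt_size_self _
  have hy : y.natAbs < 2 ^ y.natAbs.size := Nat.lt_size_self _
  have hX : 1 ≤ 2 ^ x.natAbs.size := Nat.one_le_two_pow
  have hY : 1 ≤ 2 ^ y.natAbs.size := Nat.one_le_two_pow
  rw [pow_succ, pow_add]
  have hsum : x.natAbs + y.natAbs < 2 ^ x.natAbs.size * 2 ^ y.natAbs.size * 2 := by nlinarith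
  cases o with
  | add => exact lt_of_le_of_lt (Int.natAbs_add_le x y) hsum
  | sub => exact lt_of_le_of_lt (Int.natAbs_sub_le x y) hsum
  | mul =>
    simp only [ArithOp.eval, Int.natAbs_mul]
    nlinarith [Nat.mul_lt_mul'' hx hy]
  | div =>
    -- Floored division agrees with Euclidean division for a positive divisor; a negative divisor is
    -- reduced to that case by negating both arguments.
    have : (Int.fdiv x y).natAbs ≤ x.natAbs := by
      rcases eq_or_ne y 0 with rfl | h
      · simp
      · rcases lt_trichotomy y 0 with hy0 | hy0 | hy0
        · rw [← Int.neg_fdiv_neg, Int.fdiv_eq_ediv_of_nonneg _ (by omega)]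
          have := Int.natAbs_ediv_le_natAbs (-x) (-y)
          simpa using this
        · exact absurd hy0 h
        · rw [Int.fdiv_eq_ediv_of_nonneg _ hy0.le]
          exact Int.natAbs_ediv_le_natAbs x y
    simp only [ArithOp.eval]
    nlinarith

/-- Weight of an expression: with registers of at most `L` bits, its value has at most
`weight * L` bits. -/
def RExpr.weight : RExpr → ℕ
  | .const z => bits z
  | .cell _ _ => 1
  | .op _ e₁ e₂ => e₁.weight + e₂.weight

/-- With registers of at most `L` bits, evaluating costs at most `costFactor * L ^ 2`. -/
def RExpr.costFactor : RExpr → ℕ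
  | .const z => bits z
  | .cell _ idx => idx.costFactor + idx.weight + 1
  | .op _ e₁ e₂ => e₁.costFactor + e₂.costFactor + (e₁.weight + e₂.weight) ^ 2

/-- All registers are bounded by `B` in absolute value. -/
def Memory.Bounded (B : ℕ) (σ : Memory) : Prop := ∀ a j, (σ a j).natAbs ≤ B

theorem RExpr.bits_eval_le {B : ℕ} {σ : Memory} (h : σ.Bounded B) (e : RExpr) :
    bits (e.eval σ) ≤ e.weight * (B.size + 1) := by
  induction e with
  | const z => simpa [RExpr.eval, RExpr.weight] using Nat.le_mul_of_pos_right (bits z) (by omega)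
  | cell a idx _ => simpa [RExpr.eval, RExpr.weight] using bits_le_of_natAbs_le (h a _)
  | op o e₁ e₂ h₁ h₂ =>
    simp only [RExpr.eval, RExpr.weight, add_mul]
    exact (o.bits_eval_le _ _).trans (by omega)

theorem RExpr.cost_le {B : ℕ} {σ : Memory} (h : σ.Bounded B) (e : RExpr) :
    e.cost σ ≤ e.costFactor * (B.size + 1) ^ 2 := by
  have hL : B.size + 1 ≤ (B.size + 1) ^ 2 := by nlinarith
  have h1 : 1 ≤ (B.size + 1) ^ 2 := by nlinarith
  induction e with
  | const z => simpa [RExpr.cost, RExpr.costFactor] using Nat.le_mul_of_pos_right (bits z) h1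
  | cell a idx ih =>
    have h2 := idx.bits_eval_le h
    have h3 := bits_le_of_natAbs_le (h a (idx.eval σ).toNat)
    have h4 := Nat.mul_le_mul_left idx.weight hL
    simp only [RExpr.cost, RExpr.costFactor, add_mul, one_mul]
    omega
  | op o e₁ e₂ h₁ h₂ =>
    have h3 := e₁.bits_eval_le h
    have h4 := e₂.bits_eval_le h
    have h5 : (bits (e₁.eval σ) + bits (e₂.eval σ)) ^ 2
        ≤ ((e₁.weight + e₂.weight) * (B.size + 1)) ^ 2 :=
      Nat.pow_le_pow_left (by rw [add_mul]; omega) 2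
    rw [mul_pow] at h5
    simp only [RExpr.cost, RExpr.costFactor, add_mul]
    omega

/-- With registers of at most `L` bits, every step costs at most `costFactor * L ^ 2`. -/
def Program.costFactor : Program → ℕ
  | .skip => 1
  | .assign _ idx e => idx.costFactor + e.costFactor + idx.weight + 1
  | .query _ _ i t s => i.costFactor + t.costFactor + s.costFactor
      + i.weight + t.weight + s.weight + 2
  | .seq P Q => P.costFactor + Q.costFactor
  | .ifLe e₁ e₂ P Q => e₁.costFactor + e₂.costFactor + e₁.weight + e₂.weight
      + P.costFactor + Q.costFactor
  | .whileLe e₁ e₂ P => e₁.costFactor + e₂.costFactor + e₁.weight + e₂.weight + P.costFactor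

/-- Whether the program may write to array `b`. -/
def Program.writesTo (b : ℕ) : Program → Bool
  | .skip => false
  | .assign a _ _ => a == b
  | .query a a' _ _ _ => a == b || a' == b
  | .seq P Q => P.writesTo b || Q.writesTo b
  | .ifLe _ _ P Q => P.writesTo b || Q.writesTo b
  | .whileLe _ _ P => P.writesTo b

@[simp] theorem Memory.write_ne {σ : Memory} {a b j : ℕ} {z : ℤ} (h : b ≠ a) :
    σ.write a j z b = σ b := by
  simp [Memory.write, h]

@[simp] theorem Memory.write_same {σ : Memory} {a j : ℕ} {z : ℤ} : σ.write a j z a j = z := by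
  simp [Memory.write]

theorem Memory.write_apply {σ : Memory} {a j j' : ℕ} {z : ℤ} :
    σ.write a j z a j' = if j' = j then z else σ a j' := by
  simp [Memory.write, Function.update_apply]

theorem Memory.write_idx_ne {σ : Memory} {a j j' : ℕ} {z : ℤ} (h : j' ≠ j) :
    σ.write a j z a j' = σ a j' := by
  simp [Memory.write, h]

theorem Memory.Bounded.write {B : ℕ} {σ : Memory} (h : σ.Bounded B) (a j : ℕ) {z : ℤ}
    (hz : z.natAbs ≤ B) : (σ.write a j z).Bounded B := by
  intro b i
  by_cases hb : b = a
  · subst hb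
    rw [Memory.write_apply]
    split_ifs
    · exact hz
    · exact h _ _
  · rw [Memory.write_ne hb]; exact h _ _

/-- `writesTo` is syntactic and computes, so its hypothesis closes by `rfl` for concrete programs.
All later facts of the form "this array is unchanged" come from here. -/
theorem Exec.frame {q : ValueOracle} {P : Program} {σ σ' : Memory} {c r : ℕ}
    (h : Exec q P σ σ' c r) (b : ℕ) (hb : P.writesTo b = false) : σ' b = σ b := by
  induction h with
  | skip => rfl
  | assign σ a idx e =>
    simp only [Program.writesTo, beq_eq_false_iff_ne, ne_eq] at hb
    exact Memory.write_ne (Ne.symm hb)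
  | query σ a a' i t s x y _ =>
    simp only [Program.writesTo, Bool.or_eq_false_iff, beq_eq_false_iff_ne, ne_eq] at hb
    rw [Memory.write_ne (Ne.symm hb.2), Memory.write_ne (Ne.symm hb.1)]
  | seq _ _ h1 h2 =>
    simp only [Program.writesTo, Bool.or_eq_false_iff] at hb
    rw [h2 hb.2, h1 hb.1]
  | ifTrue _ _ h1 =>
    simp only [Program.writesTo, Bool.or_eq_false_iff] at hb
    exact h1 hb.1
  | ifFalse _ _ h1 =>
    simp only [Program.writesTo, Bool.or_eq_false_iff] at hb
    exact h1 hb.2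
  | whileTrue _ _ _ h1 h2 => rw [h2 hb, h1 hb]
  | whileFalse => rfl

/-- A query already pays at least one unit for writing its answer, so every time bound is also a
query bound. -/
theorem Exec.queries_le {q : ValueOracle} {P : Program} {σ σ' : Memory} {c r : ℕ}
    (h : Exec q P σ σ' c r) : r ≤ c := by
  induction h with
  | query σ a a' i t s x y _ => have := bits_pos x; omega
  | _ => omega

/-- Started in `σ` with registers bounded by `B`, the program `P` halts after at most `T` steps in
a memory that satisfies `Q`, and keeps all registers bounded by `B`. -/
def Run (q : ValueOracle) (B : ℕ) (P : Program) (σ : Memory) (T : ℕ) (Q : Memory → Prop) : Prop :=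
  σ.Bounded B → ∃ σ' c r, Exec q P σ σ' c r ∧ σ'.Bounded B ∧
    c ≤ T * (P.costFactor * (B.size + 1) ^ 2) ∧ Q σ'

/-! ### Hoare-style rules with step counts -/

namespace Run

variable {q : ValueOracle} {B : ℕ}

/-- The frame of `P` is available when the postcondition is weakened, so postconditions need not
list the untouched arrays. -/
theorem mono {P : Program} {σ : Memory} {T T' : ℕ} {Q Q' : Memory → Prop}
    (h : Run q B P σ T Q) (hT : T ≤ T')
    (hQ : ∀ σ', (∀ b, P.writesTo b = false → σ' b = σ b) → Q σ' → Q' σ') :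
    Run q B P σ T' Q' := by
  intro hB
  obtain ⟨σ', c, r, he, hB', hc, hq⟩ := h hB
  exact ⟨σ', c, r, he, hB', hc.trans (Nat.mul_le_mul_right _ hT), hQ σ' he.frame hq⟩

theorem skip {σ : Memory} {Q : Memory → Prop} (h : Q σ) : Run q B .skip σ 1 Q := fun hB =>
  ⟨σ, 1, 0, .skip σ, hB, by
    simpa [Program.costFactor] using Nat.one_le_pow 2 (B.size + 1) (by omega), h⟩

theorem assign {σ : Memory} {Q : Memory → Prop} {a : ℕ} {idx e : RExpr} (j : ℕ) (z : ℤ)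
    (hj : idx.eval σ = j) (hz : e.eval σ = z) (hb : z.natAbs ≤ B) (h : Q (σ.write a j z)) :
    Run q B (.assign a idx e) σ 1 Q := by
  intro hB
  refine ⟨_, _, _, .assign σ a idx e, ?_, ?_, ?_⟩
  · rw [hj, hz]; exact hB.write _ _ hb
  · have h1 := idx.cost_le hB
    have h2 := e.cost_le hB
    have h3 := idx.bits_eval_le hB
    have h4 : bits (e.eval σ) ≤ B.size + 1 := bits_le_of_natAbs_le (hz ▸ hb)
    have hL : B.size + 1 ≤ (B.size + 1) ^ 2 := by nlinarith
    have h5 := Nat.mul_le_mul_left idx.weight hL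
    simp only [Program.costFactor, add_mul, one_mul]
    omega
  · rw [hj, hz]; simpa using h

theorem query {σ : Memory} {Q : Memory → Prop} {a b : ℕ} {i t s : RExpr} (i' t' s' : ℕ)
    (hi : i.eval σ = i') (ht : t.eval σ = t') (hs : s.eval σ = s')
    (hx : (q i' t' s').1 ≤ B) (hy : (q i' t' s').2 ≤ B)
    (h : Q ((σ.write a 0 (q i' t' s').1).write b 0 (q i' t' s').2)) :
    Run q B (.query a b i t s) σ 1 Q := by
  intro hB
  refine ⟨_, _, _, .query σ a b i t s (q i' t' s').1 (q i' t' s').2 (by simp [hi, ht, hs]),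
    (hB.write _ _ (by simpa)).write _ _ (by simpa), ?_, h⟩
  have h1 := i.cost_le hB
  have h2 := t.cost_le hB
  have h3 := s.cost_le hB
  have h4 := i.bits_eval_le hB
  have h5 := t.bits_eval_le hB
  have h6 := s.bits_eval_le hB
  have hL : B.size + 1 ≤ (B.size + 1) ^ 2 := by nlinarith
  have h7 := Nat.mul_le_mul_left i.weight hL
  have h8 := Nat.mul_le_mul_left t.weight hL
  have h9 := Nat.mul_le_mul_left s.weight hL
  have h10 : bits ((q i' t' s').1 : ℤ) ≤ B.size + 1 := bits_le_of_natAbs_le (by simpa)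
  have h11 : bits ((q i' t' s').2 : ℤ) ≤ B.size + 1 := bits_le_of_natAbs_le (by simpa)
  simp only [Program.costFactor, add_mul, one_mul]
  omega

theorem seq {P P' : Program} {σ : Memory} {T T' : ℕ} {R Q : Memory → Prop}
    (h : Run q B P σ T R)
    (h' : ∀ σ', (∀ b, P.writesTo b = false → σ' b = σ b) → R σ' → Run q B P' σ' T' Q) :
    Run q B (.seq P P') σ (T + T') Q := by
  intro hB
  obtain ⟨σ₁, c₁, r₁, he₁, hB₁, hc₁, hq₁⟩ := h hB
  obtain ⟨σ₂, c₂, r₂, he₂, hB₂, hc₂, hq₂⟩ := h' σ₁ he₁.frame hq₁ hB₁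
  refine ⟨σ₂, _, _, .seq he₁ he₂, hB₂, ?_, hq₂⟩
  simp only [Program.costFactor]
  calc c₁ + c₂ ≤ T * (P.costFactor * (B.size + 1) ^ 2) + T' * (P'.costFactor * (B.size + 1) ^ 2) :=
        add_le_add hc₁ hc₂
    -- Both halves are charged at the rate of the composite program, which makes the step counts
    -- simply add.
    _ ≤ T * ((P.costFactor + P'.costFactor) * (B.size + 1) ^ 2)
        + T' * ((P.costFactor + P'.costFactor) * (B.size + 1) ^ 2) := by gcongr <;> omega
    _ = _ := by ring

theorem assign_seq {P : Program} {σ : Memory} {T : ℕ} {Q : Memory → Prop} {a : ℕ} {idx e : RExpr}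
    (j : ℕ) (z : ℤ) (hj : idx.eval σ = j) (hz : e.eval σ = z) (hb : z.natAbs ≤ B)
    (h : Run q B P (σ.write a j z) T Q) :
    Run q B (.seq (.assign a idx e) P) σ (T + 1) Q := by
  rw [add_comm]
  exact seq (assign (Q := fun σ' => σ' = σ.write a j z) j z hj hz hb rfl)
    fun σ' _ hσ => hσ ▸ h

theorem query_seq {P : Program} {σ : Memory} {T : ℕ} {Q : Memory → Prop} {a b : ℕ}
    {i t s : RExpr} (i' t' s' : ℕ)
    (hi : i.eval σ = i') (ht : t.eval σ = t') (hs : s.eval σ = s')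
    (hx : (q i' t' s').1 ≤ B) (hy : (q i' t' s').2 ≤ B)
    (h : Run q B P ((σ.write a 0 (q i' t' s').1).write b 0 (q i' t' s').2) T Q) :
    Run q B (.seq (.query a b i t s) P) σ (T + 1) Q := by
  rw [add_comm]
  exact seq (query (Q := fun σ' => σ' = _) i' t' s' hi ht hs hx hy rfl) fun σ' _ hσ => hσ ▸ h

theorem ifLe {P P' : Program} {σ : Memory} {T : ℕ} {Q : Memory → Prop} {e₁ e₂ : RExpr}
    (h : e₁.eval σ ≤ e₂.eval σ → Run q B P σ T Q)
    (h' : ¬ e₁.eval σ ≤ e₂.eval σ → Run q B P' σ T Q) :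
    Run q B (.ifLe e₁ e₂ P P') σ (T + 1) Q := by
  intro hB
  have h1 := e₁.cost_le hB
  have h2 := e₂.cost_le hB
  have h3 := e₁.bits_eval_le hB
  have h4 := e₂.bits_eval_le hB
  have hL : B.size + 1 ≤ (B.size + 1) ^ 2 := by nlinarith
  have h5 := Nat.mul_le_mul_left e₁.weight hL
  have h6 := Nat.mul_le_mul_left e₂.weight hL
  by_cases hg : e₁.eval σ ≤ e₂.eval σ
  · obtain ⟨σ', c, r, he, hB', hc, hq⟩ := h hg hB
    refine ⟨σ', _, _, .ifTrue hg he, hB', ?_, hq⟩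
    have h7 : T * (P.costFactor * (B.size + 1) ^ 2)
        ≤ T * ((Program.ifLe e₁ e₂ P P').costFactor * (B.size + 1) ^ 2) := by
      gcongr; simp only [Program.costFactor]; omega
    rw [add_mul T 1, one_mul]
    have h8 : (e₁.costFactor + e₂.costFactor + e₁.weight + e₂.weight) * (B.size + 1) ^ 2
        ≤ (Program.ifLe e₁ e₂ P P').costFactor * (B.size + 1) ^ 2 := by
      gcongr; simp only [Program.costFactor]; omega
    simp only [add_mul] at h8
    omega
  · obtain ⟨σ', c, r, he, hB', hc, hq⟩ := h' hg hB
    refine ⟨σ', _, _, .ifFalse hg he, hB', ?_, hq⟩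
    have h7 : T * (P'.costFactor * (B.size + 1) ^ 2)
        ≤ T * ((Program.ifLe e₁ e₂ P P').costFactor * (B.size + 1) ^ 2) := by
      gcongr; simp only [Program.costFactor]; omega
    rw [add_mul T 1, one_mul]
    have h8 : (e₁.costFactor + e₂.costFactor + e₁.weight + e₂.weight) * (B.size + 1) ^ 2
        ≤ (Program.ifLe e₁ e₂ P P').costFactor * (B.size + 1) ^ 2 := by
      gcongr; simp only [Program.costFactor]; omega
    simp only [add_mul] at h8
    omega

/-- Loop rule with an invariant `I` that bounds the number of remaining iterations. -/
theorem whileLe {P : Program} {σ₀ : Memory} {T : ℕ} {e₁ e₂ : RExpr} (I : ℕ → Memory → Prop)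
    (body : ∀ k σ, (∀ b, P.writesTo b = false → σ b = σ₀ b) → I k σ →
      e₁.eval σ ≤ e₂.eval σ → Run q B P σ T fun σ' => ∃ k' < k, I k' σ') (k : ℕ) (h : I k σ₀) :
    Run q B (.whileLe e₁ e₂ P) σ₀ (k * (T + 1) + 1)
      fun σ' => (∃ k', I k' σ') ∧ ¬ e₁.eval σ' ≤ e₂.eval σ' := by
  -- Strong induction, because one iteration may lower the bound `k` by more than one. The frame
  -- relative to `σ₀` is carried along so that the body may use it in every iteration.
  have key : ∀ k σ, (∀ b, P.writesTo b = false → σ b = σ₀ b) → I k σ →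
      Run q B (.whileLe e₁ e₂ P) σ (k * (T + 1) + 1)
        fun σ' => (∃ k', I k' σ') ∧ ¬ e₁.eval σ' ≤ e₂.eval σ' := by
    intro k
    induction k using Nat.strong_induction_on with
    | _ k ih =>
    intro σ hfr hI hB
    have h1 := e₁.cost_le hB
    have h2 := e₂.cost_le hB
    have h3 := e₁.bits_eval_le hB
    have h4 := e₂.bits_eval_le hB
    have hL : B.size + 1 ≤ (B.size + 1) ^ 2 := by nlinarith
    have h5 := Nat.mul_le_mul_left e₁.weight hL
    have h6 := Nat.mul_le_mul_left e₂.weight hL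
    set F := (Program.whileLe e₁ e₂ P).costFactor * (B.size + 1) ^ 2 with hF
    have h8 : (e₁.costFactor + e₂.costFactor + e₁.weight + e₂.weight) * (B.size + 1) ^ 2 ≤ F := by
      rw [hF]; gcongr; simp only [Program.costFactor]; omega
    simp only [add_mul] at h8
    by_cases hg : e₁.eval σ ≤ e₂.eval σ
    · obtain ⟨σ', c, r, he, hB', hc, k', hk', hI'⟩ := body k σ hfr hI hg hB
      obtain ⟨σ'', c', r', he', hB'', hc', hq⟩ := ih k' hk' σ'
        (fun b hb => (he.frame b hb).trans (hfr b hb)) hI' hB'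
      refine ⟨σ'', _, _, .whileTrue hg he he', hB'', ?_, hq⟩
      have h9 : T * (P.costFactor * (B.size + 1) ^ 2) ≤ T * F := by
        rw [hF]; gcongr; simp only [Program.costFactor]; omega
      -- An iteration spends `T` on the body and one on the guard; the final `+ 1` of the budget is
      -- the failing guard.
      have h10 : (k' * (T + 1) + 1) * F + (T + 1) * F ≤ (k * (T + 1) + 1) * F := by
        rw [← add_mul]
        exact Nat.mul_le_mul_right _ (by nlinarith)
      rw [← hF] at hc'
      rw [add_mul T 1, one_mul] at h10
      omega
    · refine ⟨σ, _, _, .whileFalse hg, hB, ?_, ⟨k, hI⟩, hg⟩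
      rw [add_mul, one_mul]
      omega
  exact key k σ₀ (fun _ _ => rfl) h

end Run

/-! ### Notation for expressions, scalar variables and counting loops -/

instance : Add RExpr := ⟨.op .add⟩
instance : Sub RExpr := ⟨.op .sub⟩
instance : Mul RExpr := ⟨.op .mul⟩
instance : Div RExpr := ⟨.op .div⟩
instance (n : ℕ) : OfNat RExpr n := ⟨.const n⟩

/-- The scalar variable stored in register `0` of array `a`. -/
def reg (a : ℕ) : RExpr := .cell a 0

@[simp] theorem RExpr.eval_add (σ : Memory) (e₁ e₂ : RExpr) :
    (e₁ + e₂).eval σ = e₁.eval σ + e₂.eval σ := rfl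
@[simp] theorem RExpr.eval_sub (σ : Memory) (e₁ e₂ : RExpr) :
    (e₁ - e₂).eval σ = e₁.eval σ - e₂.eval σ := rfl
@[simp] theorem RExpr.eval_mul (σ : Memory) (e₁ e₂ : RExpr) :
    (e₁ * e₂).eval σ = e₁.eval σ * e₂.eval σ := rfl
@[simp] theorem RExpr.eval_div (σ : Memory) (e₁ e₂ : RExpr) :
    (e₁ / e₂).eval σ = Int.fdiv (e₁.eval σ) (e₂.eval σ) := rfl
@[simp] theorem RExpr.eval_ofNat (σ : Memory) (n : ℕ) [n.AtLeastTwo] :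
    (ofNat(n) : RExpr).eval σ = (ofNat(n) : ℤ) := rfl
@[simp] theorem RExpr.eval_zero (σ : Memory) : (0 : RExpr).eval σ = 0 := rfl
@[simp] theorem RExpr.eval_one (σ : Memory) : (1 : RExpr).eval σ = 1 := rfl
@[simp] theorem eval_reg (σ : Memory) (a : ℕ) : (reg a).eval σ = σ a 0 := rfl

theorem RExpr.eval_cell {σ : Memory} {a : ℕ} {e : RExpr} (j : ℕ) (h : e.eval σ = j) :
    (RExpr.cell a e).eval σ = σ a j := by
  simp [RExpr.eval, h]

@[simp] theorem RExpr.eval_cell_zero (σ : Memory) (a : ℕ) :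
    (RExpr.cell a 0).eval σ = σ a 0 := rfl
@[simp] theorem RExpr.eval_cell_one (σ : Memory) (a : ℕ) :
    (RExpr.cell a 1).eval σ = σ a 1 := rfl
@[simp] theorem RExpr.eval_cell_ofNat (σ : Memory) (a n : ℕ) [n.AtLeastTwo] :
    (RExpr.cell a ofNat(n)).eval σ = σ a ofNat(n) := rfl

/-- Assignment to a scalar variable. -/
abbrev Program.set (a : ℕ) (e : RExpr) : Program := .assign a 0 e

/-- `for x = 0, …, e - 1 do P`, with the loop variable `x` stored in register `0` of array `x`. -/
def Program.forLt (x : ℕ) (e : RExpr) (P : Program) : Program :=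
  .seq (.set x 0) (.whileLe (reg x + 1) e (.seq P (.set x (reg x + 1))))

/-- Loop rule for `forLt`. -/
theorem Run.forLt {q : ValueOracle} {B : ℕ} {P : Program} {σ₀ : Memory} {T x : ℕ} {e : RExpr}
    (N : ℕ) (I : ℕ → Memory → Prop) (hNB : N ≤ B) (hx : P.writesTo x = false)
    (he : ∀ i σ, (∀ b, (Program.forLt x e P).writesTo b = false → σ b = σ₀ b) →
      I i σ → e.eval σ = N)
    (body : ∀ i < N, ∀ σ, (∀ b, (Program.forLt x e P).writesTo b = false → σ b = σ₀ b) →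
      σ x 0 = (i : ℤ) → I i σ → Run q B P σ T fun σ' => I (i + 1) (σ'.write x 0 (i + 1 : ℕ)))
    (h : I 0 (σ₀.write x 0 0)) :
    Run q B (Program.forLt x e P) σ₀ (N * (T + 2) + 2)
      fun σ' => σ' x 0 = (N : ℤ) ∧ I N σ' := by
  refine Run.assign_seq 0 0 rfl rfl (by simp) ?_
  -- The bound `k` counts the remaining iterations, so the loop variable holds `N - k`. The frame
  -- for `σ₀` is restated inside the invariant because the frame of `Run.whileLe` starts only after
  -- the initial write to `x`.
  have key := Run.whileLe (q := q) (B := B) (P := .seq P (.set x (reg x + 1)))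
    (σ₀ := σ₀.write x 0 0) (T := T + 1) (e₁ := reg x + 1) (e₂ := e)
    (fun k σ => k ≤ N ∧ σ x 0 = (N - k : ℕ) ∧ I (N - k) σ ∧
      ∀ b, (Program.forLt x e P).writesTo b = false → σ b = σ₀ b) ?_ N
      ⟨le_rfl, by simp, by simpa using h, ?_⟩
  · refine key.mono le_rfl ?_
    rintro σ' - ⟨⟨k, hk, hkx, hI, hfr⟩, hg⟩
    simp only [RExpr.eval_add, eval_reg, RExpr.eval_one, he _ _ hfr hI, hkx] at hg
    obtain rfl : k = 0 := by omega
    exact ⟨by simpa using hkx, by simpa using hI⟩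
  · rintro k σ - ⟨hk, hkx, hI, hfr⟩ hg
    simp only [RExpr.eval_add, eval_reg, RExpr.eval_one, he _ _ hfr hI, hkx] at hg
    refine Run.seq (body (N - k) (by omega) σ hfr hkx hI) ?_
    intro σ' hfr' hI'
    have hx' : σ' x 0 = (N - k : ℕ) := by rw [hfr' x hx, hkx]
    -- The loop variable climbs to `N` itself, which is what `N ≤ B` is for.
    refine Run.assign 0 (N - k + 1 : ℕ) rfl (by simp [hx']) (by omega) ?_
    refine ⟨k - 1, by omega, by omega, ?_, ?_, ?_⟩
    · rw [Memory.write_same]; congr 1; omega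
    · rw [show N - (k - 1) = N - k + 1 by omega]; exact hI'
    · intro b hb
      have hb' := hb
      simp only [Program.forLt, Program.writesTo, Bool.or_eq_false_iff, beq_eq_false_iff_ne] at hb'
      rw [Memory.write_ne (Ne.symm hb'.1), hfr' b hb'.2.1, hfr b hb]
  · intro b hb
    simp only [Program.forLt, Program.writesTo, Bool.or_eq_false_iff, beq_eq_false_iff_ne] at hb
    rw [Memory.write_ne (Ne.symm hb.1)]

/-! ### Polynomially bounded functions -/

/-- `f` is bounded by a polynomial on the positive integers. -/
def PolyBounded (f : ℕ → ℕ) : Prop := ∃ C d : ℕ, ∀ x, 1 ≤ x → f x ≤ C * x ^ d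

theorem PolyBounded.const (a : ℕ) : PolyBounded fun _ => a := ⟨a, 0, by simp⟩

theorem PolyBounded.id : PolyBounded fun x => x := ⟨1, 1, by simp⟩

theorem PolyBounded.mul {f g : ℕ → ℕ} (hf : PolyBounded f) (hg : PolyBounded g) :
    PolyBounded fun x => f x * g x := by
  obtain ⟨C, d, h⟩ := hf
  obtain ⟨C', d', h'⟩ := hg
  refine ⟨C * C', d + d', fun x hx => (Nat.mul_le_mul (h x hx) (h' x hx)).trans ?_⟩
  rw [pow_add]; exact le_of_eq (by ring)

theorem PolyBounded.add {f g : ℕ → ℕ} (hf : PolyBounded f) (hg : PolyBounded g) :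
    PolyBounded fun x => f x + g x := by
  obtain ⟨C, d, h⟩ := hf
  obtain ⟨C', d', h'⟩ := hg
  refine ⟨C + C', d + d', fun x hx => (add_le_add (h x hx) (h' x hx)).trans ?_⟩
  rw [add_mul]
  gcongr <;> omega

theorem PolyBounded.pow {f : ℕ → ℕ} (hf : PolyBounded f) (e : ℕ) :
    PolyBounded fun x => f x ^ e := by
  induction e with
  | zero => simpa using PolyBounded.const 1
  | succ e ih => simpa only [pow_succ] using ih.mul hf

/-! ### Rounding -/

theorem roundDown_mono {δ x y : ℝ} (hδ : 0 ≤ δ) (h : x ≤ y) : roundDown δ x ≤ roundDown δ y := by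
  unfold roundDown
  gcongr

theorem roundDown_zero (δ : ℝ) : roundDown δ 0 = 0 := by simp [roundDown]

/-- For `δ = 0` rounding returns `0` whatever `x` is, hence the side condition. In the rule it is
met because `δ = 0` only when all valuations vanish. -/
theorem roundDown_le {δ x : ℝ} (hδ : 0 ≤ δ) (hx : δ = 0 → x = 0) : roundDown δ x ≤ x := by
  rcases hδ.eq_or_lt with h | h
  · simp [roundDown, ← h, hx h.symm]
  · calc roundDown δ x ≤ x / δ * δ := by unfold roundDown; gcongr; exact Int.floor_le _
      _ = x := div_mul_cancel₀ _ h.ne'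

theorem sub_le_roundDown {δ x : ℝ} (hδ : 0 ≤ δ) (hx : δ = 0 → x = 0) : x - δ ≤ roundDown δ x := by
  rcases hδ.eq_or_lt with h | h
  · simp [roundDown, ← h, hx h.symm]
  · have := (Int.lt_floor_add_one (x / δ)).le
    rw [div_le_iff₀ h] at this
    unfold roundDown
    linarith

/-- A sum of marginals of a minded valuation is a sum over the steps. -/
theorem IsMinded.sum_marginals {m : ℕ} {K : Finset ℕ} {v : ℕ → ℝ} (hv : IsMinded m K v)
    (φ : ℝ → ℝ) (hφ : φ 0 = 0) {s : ℕ} (hs : s ≤ m) :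
    ∑ j ∈ Finset.Icc 1 s, φ (v j - v (j - 1)) = ∑ j ∈ K.filter (· ≤ s), φ (v j - v (j - 1)) := by
  symm
  apply Finset.sum_subset
  · intro j hj
    have hj' := Finset.mem_filter.1 hj
    exact Finset.mem_Icc.2 ⟨(Finset.mem_Icc.1 (hv.1 hj'.1)).1, hj'.2⟩
  · intro j hj hj'
    have h1 := Finset.mem_Icc.1 hj
    rw [hv.2 j h1.1 (h1.2.trans hs) fun h => hj' (Finset.mem_filter.2 ⟨h, h1.2⟩), sub_self, hφ]

theorem sum_Icc_marginals (v : ℕ → ℝ) (s : ℕ) :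
    ∑ j ∈ Finset.Icc 1 s, (v j - v (j - 1)) = v s - v 0 := by
  induction s with
  | zero => simp
  | succ s ih => rw [Finset.sum_Icc_succ_top (by omega), ih]; simp

theorem IsMinded.value_eq {m : ℕ} {K : Finset ℕ} {v : ℕ → ℝ} (hv : IsMinded m K v)
    (h0 : IsValuation m v) {s : ℕ} (hs : s ≤ m) :
    v s = ∑ j ∈ K.filter (· ≤ s), (v j - v (j - 1)) := by
  rw [← hv.sum_marginals (fun x => x) rfl hs, sum_Icc_marginals, h0.1, sub_zero]

open Classical in
/-- The reward that the allocation rule adds at each step. -/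
noncomputable def reward (n m k : ℕ) (ε δ : ℝ) (v : ℕ → ℝ) : ℝ :=
  if 3 * δ * (n : ℝ) ^ 2 * (k : ℝ) ^ 2 / ε ≤ v m then 2 * δ * k * n else 0

theorem reward_nonneg {n m k : ℕ} {ε δ : ℝ} {v : ℕ → ℝ} (hδ : 0 ≤ δ) :
    0 ≤ reward n m k ε δ v := by
  unfold reward
  split_ifs <;> positivity

theorem reward_le {n m k : ℕ} {ε δ : ℝ} {v : ℕ → ℝ} (hδ : 0 ≤ δ) :
    reward n m k ε δ v ≤ 2 * δ * k * n := by
  unfold reward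
  split_ifs
  · exact le_rfl
  · positivity

/-- The reward counts steps, so it can be spread over them. Each modified value becomes a sum of one
term per step, and comparing two shares becomes a sum over the steps between them. -/
theorem rewarded_eq_sum {n m k : ℕ} {ε δ : ℝ} {K : Finset ℕ} {v : ℕ → ℝ} (hv : IsMinded m K v)
    {s : ℕ} (hs : s ≤ m) : rewarded n m k ε δ K v s =
      ∑ j ∈ K.filter (· ≤ s), (roundDown δ (v j - v (j - 1)) + reward n m k ε δ v) := by
  rw [Finset.sum_add_distrib, ← hv.sum_marginals _ (roundDown_zero δ) hs, Finset.sum_const,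
    nsmul_eq_mul]
  unfold rewarded reward marginalRounded
  split_ifs <;> simp

theorem sum_filter_le_sub (K : Finset ℕ) (w : ℕ → ℝ) {s s' : ℕ} (h : s ≤ s') :
    ∑ j ∈ K.filter (· ≤ s'), w j - ∑ j ∈ K.filter (· ≤ s), w j =
      ∑ j ∈ K.filter (fun j => s < j ∧ j ≤ s'), w j := by
  rw [sub_eq_iff_eq_add, ← Finset.sum_union]
  · congr 1
    ext j
    simp only [Finset.mem_filter, Finset.mem_union]
    constructor
    · rintro ⟨h1, h2⟩
      by_cases h3 : s < j
      · exact Or.inl ⟨h1, h3, h2⟩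
      · exact Or.inr ⟨h1, not_lt.1 h3⟩
    · rintro (⟨h1, h2, h3⟩ | ⟨h1, h2⟩)
      · exact ⟨h1, h3⟩
      · exact ⟨h1, h2.trans h⟩
  · rw [Finset.disjoint_filter]
    intro j _ h1
    omega

/-! ### The rounding unit -/

section RoundingUnit

variable {n k : ℕ} {ε w w' : ℝ}

/-- No power of a positive base is at most `0`, and the supremum of the empty set of reals is `0`.
-/
theorem roundingUnit_of_eq_zero (h : w = 0) (hn : 0 < n) (hk : 0 < k) :
    roundingUnit n k ε w = 0 := by
  subst h
  have hb : (0 : ℝ) < 4 * k * n := by positivity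
  unfold roundingUnit
  convert Real.sSup_empty
  refine Set.eq_empty_of_forall_notMem ?_
  rintro x ⟨p, rfl, hp⟩
  have := zpow_pos hb p
  simp at hp
  linarith

theorem one_lt_base (hn : 0 < n) (hk : 0 < k) : (1 : ℝ) < 4 * k * n := by
  have h1 : (1 : ℝ) ≤ k := by exact_mod_cast hk
  have h2 : (1 : ℝ) ≤ n := by exact_mod_cast hn
  nlinarith

/-- Bracketing between consecutive powers identifies the unit; this is also how the output of
`unitProg` is certified. -/
theorem roundingUnit_eq_of_mem (hn : 0 < n) (hk : 0 < k) {p : ℤ}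
    (h : (4 * k * n : ℝ) ^ p ≤ ε * w / (3 * (n : ℝ) ^ 2 * (k : ℝ) ^ 2))
    (h' : ε * w / (3 * (n : ℝ) ^ 2 * (k : ℝ) ^ 2) < (4 * k * n : ℝ) ^ (p + 1)) :
    roundingUnit n k ε w = (4 * k * n : ℝ) ^ p := by
  refine IsGreatest.csSup_eq ⟨⟨p, rfl, h⟩, ?_⟩
  rintro x ⟨p', rfl, hp'⟩
  have := (zpow_lt_zpow_iff_right₀ (one_lt_base hn hk)).1 (hp'.trans_lt h')
  exact (zpow_le_zpow_iff_right₀ (one_lt_base hn hk)).2 (by omega)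

theorem exists_roundingUnit_eq (hn : 0 < n) (hk : 0 < k) (hε : 0 < ε) (hw : 0 < w) :
    ∃ p : ℤ, roundingUnit n k ε w = (4 * k * n : ℝ) ^ p ∧
      (4 * k * n : ℝ) ^ p ≤ ε * w / (3 * (n : ℝ) ^ 2 * (k : ℝ) ^ 2) ∧
      ε * w / (3 * (n : ℝ) ^ 2 * (k : ℝ) ^ 2) < (4 * k * n : ℝ) ^ (p + 1) := by
  obtain ⟨p, hp, hp'⟩ := exists_mem_Ico_zpow
    (show 0 < ε * w / (3 * (n : ℝ) ^ 2 * (k : ℝ) ^ 2) by positivity) (one_lt_base hn hk)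
  exact ⟨p, roundingUnit_eq_of_mem hn hk hp hp', hp, hp'⟩

theorem roundingUnit_nonneg (hn : 0 < n) (hk : 0 < k) (hε : 0 < ε) (hw : 0 ≤ w) :
    0 ≤ roundingUnit n k ε w := by
  rcases hw.eq_or_lt with h | h
  · rw [roundingUnit_of_eq_zero h.symm hn hk]
  · obtain ⟨p, hp, -⟩ := exists_roundingUnit_eq hn hk hε h
    rw [hp]; positivity

theorem roundingUnit_pos (hn : 0 < n) (hk : 0 < k) (hε : 0 < ε) (hw : 0 < w) :
    0 < roundingUnit n k ε w := by
  obtain ⟨p, hp, -⟩ := exists_roundingUnit_eq hn hk hε hw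
  rw [hp]; positivity

theorem roundingUnit_le (hn : 0 < n) (hk : 0 < k) (hε : 0 < ε) (hw : 0 ≤ w) :
    roundingUnit n k ε w ≤ ε * w / (3 * (n : ℝ) ^ 2 * (k : ℝ) ^ 2) := by
  rcases hw.eq_or_lt with h | h
  · rw [roundingUnit_of_eq_zero h.symm hn hk]; positivity
  · obtain ⟨p, hp, hp', -⟩ := exists_roundingUnit_eq hn hk hε h
    rwa [hp]

/-- Maximality of the exponent. It bounds `w / δ`, and with it the width of the dynamic programming
table. -/
theorem lt_base_mul_roundingUnit (hn : 0 < n) (hk : 0 < k) (hε : 0 < ε) (hw : 0 < w) :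
    ε * w / (3 * (n : ℝ) ^ 2 * (k : ℝ) ^ 2) < 4 * k * n * roundingUnit n k ε w := by
  obtain ⟨p, hp, -, hp'⟩ := exists_roundingUnit_eq hn hk hε hw
  rwa [hp, mul_comm (4 * k * n : ℝ), ← zpow_add_one₀ (by positivity)]

theorem roundingUnit_mono (hn : 0 < n) (hk : 0 < k) (hε : 0 < ε) (hw : 0 ≤ w) (h : w ≤ w') :
    roundingUnit n k ε w ≤ roundingUnit n k ε w' := by
  rcases hw.eq_or_lt with h0 | h0
  · rw [roundingUnit_of_eq_zero h0.symm hn hk]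
    exact roundingUnit_nonneg hn hk hε (hw.trans h)
  · obtain ⟨p, hp, h1, -⟩ := exists_roundingUnit_eq hn hk hε h0
    obtain ⟨p', hp', -, h2⟩ := exists_roundingUnit_eq hn hk hε (h0.trans_le h)
    have h3 : ε * w / (3 * (n : ℝ) ^ 2 * (k : ℝ) ^ 2) ≤ ε * w' / (3 * (n : ℝ) ^ 2 *
      (k : ℝ) ^ 2) := by
      gcongr
    have := (zpow_lt_zpow_iff_right₀ (one_lt_base hn hk)).1 ((h1.trans h3).trans_lt h2)
    rw [hp, hp']
    exact (zpow_le_zpow_iff_right₀ (one_lt_base hn hk)).2 (by omega)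

/-- If the rounding unit increases, it grows by a factor of at least `4kn`. -/
theorem roundingUnit_jump (hn : 0 < n) (hk : 0 < k) (hε : 0 < ε) (hw : 0 ≤ w) (h : w ≤ w')
    (hlt : roundingUnit n k ε w < roundingUnit n k ε w') :
    4 * k * n * roundingUnit n k ε w ≤ roundingUnit n k ε w' ∧
      ε * w / (3 * (n : ℝ) ^ 2 * (k : ℝ) ^ 2) < roundingUnit n k ε w' := by
  rcases hw.eq_or_lt with h0 | h0
  · subst h0
    rw [roundingUnit_of_eq_zero rfl hn hk] at hlt ⊢
    -- For `w = 0` the old unit is `0`, and both claims say only that the new one is nonnegative or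
    -- positive.
    simpa using ⟨hlt.le, hlt⟩
  · obtain ⟨p, hp, -, h1⟩ := exists_roundingUnit_eq hn hk hε h0
    obtain ⟨p', hp', -, h2⟩ := exists_roundingUnit_eq hn hk hε (h0.trans_le h)
    rw [hp, hp'] at hlt ⊢
    have h3 := (zpow_lt_zpow_iff_right₀ (one_lt_base hn hk)).1 hlt
    have h4 : (4 * k * n : ℝ) ^ (p + 1) ≤ (4 * k * n : ℝ) ^ p' :=
      (zpow_le_zpow_iff_right₀ (one_lt_base hn hk)).2 (by omega)
    refine ⟨?_, h1.trans_le h4⟩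
    rwa [mul_comm (4 * k * n : ℝ), ← zpow_add_one₀ (by positivity)]

end RoundingUnit

/-! ### Selected allocations -/

theorem IsAllocation.le {n m : ℕ} {s : Fin n → ℕ} (h : IsAllocation m s) (i : Fin n) : s i ≤ m :=
  (Finset.single_le_sum (fun _ _ => Nat.zero_le _) (Finset.mem_univ i)).trans h

theorem isSelected_selected {n : ℕ} (m : ℕ) (u : Fin n → ℕ → ℝ) : IsSelected m u (selected m u) :=
  (existsUnique_isSelected m u).choose_spec.1

theorem IsSelected.eq_selected {n m : ℕ} {u : Fin n → ℕ → ℝ} {s : Fin n → ℕ}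
    (h : IsSelected m u s) : s = selected m u :=
  (existsUnique_isSelected m u).choose_spec.2 s h

/-- Optimality makes the advantage of `s` over `s'` nonnegative under `u` and nonpositive under
`u'`. If it does not decrease from `u` to `u'`, it is zero under both, so distinct `s` and `s'`
would each be preferred to the other. -/
theorem IsSelected.eq_of_le {n m : ℕ} {u u' : Fin n → ℕ → ℝ} {s s' : Fin n → ℕ}
    (h : IsSelected m u s) (h' : IsSelected m u' s')
    (hD : 0 ≤ ∑ j, ((u' j (s j) - u' j (s' j)) - (u j (s j) - u j (s' j)))) : s = s' := by
  by_contra hne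
  have h1 := h.2.1 s' h'.1
  have h2 := h'.2.1 s h.1
  simp only [Finset.sum_sub_distrib] at hD
  unfold welfare at h1 h2
  exact preferred_irrefl _ (preferred_trans
    (h.2.2 s' h'.1 (by unfold welfare; linarith) (Ne.symm hne))
    (h'.2.2 s h.1 (by unfold welfare; linarith) hne))

/-- Off the steps, taking one item away costs no welfare and lowers the total, so the result would
be preferred. -/
theorem IsSelected.mem_of_minded {n m : ℕ} {u : Fin n → ℕ → ℝ} {s : Fin n → ℕ}
    (h : IsSelected m u s) {i : Fin n} {K : Finset ℕ}
    (hK : ∀ j, 1 ≤ j → j ≤ m → j ∉ K → u i j = u i (j - 1)) (h0 : 1 ≤ s i) : s i ∈ K := by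
  by_contra hs
  have hlt : ∑ j, Function.update s i (s i - 1) j < ∑ j, s j := by
    apply Finset.sum_lt_sum
    · intro j _
      by_cases hj : j = i
      · subst hj; simp
      · simp [hj]
    · exact ⟨i, Finset.mem_univ _, by simp; omega⟩
  have hal : IsAllocation m (Function.update s i (s i - 1)) := hlt.le.trans h.1
  have hw : welfare u (Function.update s i (s i - 1)) = welfare u s := by
    refine Finset.sum_congr rfl fun j _ => ?_
    by_cases hj : j = i
    · subst hj; simp [hK _ h0 (h.1.le j) hs]
    · simp [hj]
  have hne : Function.update s i (s i - 1) ≠ s := fun e => by rw [e] at hlt; exact lt_irrefl _ hlt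
  rcases h.2.2 _ hal hw hne with h1 | h1
  · omega
  · omega

/-! ### Monotonicity of the allocation rule -/

section Rule

variable {n m : ℕ} {K : Fin n → Finset ℕ} {ε : ℝ}

theorem pos_of_one_le_maxSteps (hk : 1 ≤ maxSteps K) : 0 < n := by
  rcases Nat.eq_zero_or_pos n with rfl | h
  · simp [maxSteps] at hk
  · exact h

theorem card_le_maxSteps (K : Fin n → Finset ℕ) (i : Fin n) : (K i).card ≤ maxSteps K :=
  Finset.le_sup (f := fun i => (K i).card) (Finset.mem_univ i)

theorem le_vMax (v : Fin n → ℕ → ℝ) (i : Fin n) : v i m ≤ vMax m v :=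
  le_ciSup (f := fun i => v i m) (Set.finite_range _).bddAbove i

theorem IsValuation.nonneg {v : ℕ → ℝ} (h : IsValuation m v) {s : ℕ} (hs : s ≤ m) : 0 ≤ v s :=
  h.1 ▸ h.2 0 s (Nat.zero_le _) hs

theorem vMax_nonneg {v : Fin n → ℕ → ℝ} (hv : ∀ i, IsValuation m (v i)) : 0 ≤ vMax m v :=
  Real.iSup_nonneg fun i => (hv i).nonneg le_rfl

theorem exists_vMax_eq (hn : 0 < n) (v : Fin n → ℕ → ℝ) : ∃ i, v i m = vMax m v := by
  have : Nonempty (Fin n) := ⟨⟨0, hn⟩⟩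
  exact exists_eq_ciSup_of_finite

theorem eq_zero_of_vMax_eq_zero {v : Fin n → ℕ → ℝ} (hv : ∀ i, IsValuation m (v i))
    (h : vMax m v = 0) (i : Fin n) {s : ℕ} (hs : s ≤ m) : v i s = 0 :=
  le_antisymm (((hv i).2 s m hs le_rfl).trans (h ▸ le_vMax v i)) ((hv i).nonneg hs)

/-- The rounding unit vanishes only if all valuations do. -/
theorem marginal_eq_zero {v : Fin n → ℕ → ℝ} (hk : 1 ≤ maxSteps K) (hε : 0 < ε)
    (hv : ∀ i, IsValuation m (v i)) (h : roundingUnit n (maxSteps K) ε (vMax m v) = 0) (i : Fin n)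
    {s s' : ℕ} (hs : s ≤ m) (hs' : s' ≤ m) : v i s - v i s' = 0 := by
  have h0 : vMax m v = 0 := by
    by_contra hc
    exact (roundingUnit_pos (pos_of_one_le_maxSteps hk) hk hε
      (lt_of_le_of_ne (vMax_nonneg hv) (Ne.symm hc))).ne' h
  rw [eq_zero_of_vMax_eq_zero hv h0 i hs, eq_zero_of_vMax_eq_zero hv h0 i hs', sub_zero]

theorem isSelected_allocRule (m : ℕ) (K : Fin n → Finset ℕ) (ε : ℝ) (v : Fin n → ℕ → ℝ) :
    IsSelected m (fun i => rewarded n m (maxSteps K) ε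
      (roundingUnit n (maxSteps K) ε (vMax m v)) (K i) (v i)) (allocRule m K ε v) :=
  isSelected_selected _ _

theorem rewarded_eq_pred {k : ℕ} {δ : ℝ} {K : Finset ℕ} {v : ℕ → ℝ} (hv : IsMinded m K v)
    {j : ℕ} (hj : 1 ≤ j) (hjm : j ≤ m) (hjK : j ∉ K) :
    rewarded n m k ε δ K v j = rewarded n m k ε δ K v (j - 1) := by
  rw [rewarded_eq_sum hv hjm, rewarded_eq_sum hv (by omega)]
  congr 1
  ext x
  simp only [Finset.mem_filter, and_congr_right_iff]
  intro hx
  have : x ≠ j := fun e => hjK (e ▸ hx)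
  omega

theorem allocRule_mem {v : Fin n → ℕ → ℝ} {i : Fin n} (hv : IsMinded m (K i) (v i))
    (h : 1 ≤ allocRule m K ε v i) : allocRule m K ε v i ∈ K i :=
  (isSelected_allocRule m K ε v).mem_of_minded (fun _ hj hjm hjK => rewarded_eq_pred hv hj hjm hjK)
    h

/-- Two shares are separated by at most `k` steps, each contributing at most `B`. -/
theorem abs_sum_filter_sub_le {K : Finset ℕ} {w : ℕ → ℝ} {k : ℕ} {B : ℝ} (hK : K.card ≤ k)
    (hB : 0 ≤ B) (hw : ∀ j ∈ K, |w j| ≤ B) (s s' : ℕ) :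
    |∑ j ∈ K.filter (· ≤ s'), w j - ∑ j ∈ K.filter (· ≤ s), w j| ≤ k * B := by
  wlog h : s ≤ s' generalizing s s'
  · rw [abs_sub_comm]; exact this s' s (by omega)
  rw [sum_filter_le_sub K w h]
  calc _ ≤ ∑ j ∈ K.filter (fun j => s < j ∧ j ≤ s'), |w j| := Finset.abs_sum_le_sum_abs _ _
    _ ≤ ∑ j ∈ K.filter (fun j => s < j ∧ j ≤ s'), B :=
        Finset.sum_le_sum fun j hj => hw j (Finset.mem_filter.1 hj).1
    _ = ((K.filter (fun j => s < j ∧ j ≤ s')).card : ℝ) * B := by simp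
    _ ≤ k * B := by
        gcongr
        exact (Finset.card_filter_le _ _).trans hK

/-- Raising the valuation of player `i` does not lower the number of items he gets. -/
theorem allocRule_mono (hε : 0 < ε) (hk : 1 ≤ maxSteps K) {v v' : Fin n → ℕ → ℝ} (i : Fin n)
    (hv : ∀ j, IsValuation m (v j) ∧ IsMinded m (K j) (v j))
    (hv' : ∀ j, IsValuation m (v' j) ∧ IsMinded m (K j) (v' j))
    (hne : ∀ j, j ≠ i → v' j = v j)
    (hsc : ∀ s s', s < s' → s' ≤ m → v i s' - v i s ≤ v' i s' - v' i s) :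
    allocRule m K ε v i ≤ allocRule m K ε v' i := by
  have hn := pos_of_one_le_maxSteps hk
  set k := maxSteps K with hkdef
  have hn1 : (1 : ℝ) ≤ n := by exact_mod_cast hn
  have hk1 : (1 : ℝ) ≤ k := by exact_mod_cast hk
  have hkn1 : (1 : ℝ) ≤ k * n := by nlinarith
  have hS := isSelected_allocRule m K ε v
  have hS' := isSelected_allocRule m K ε v'
  have hmem := allocRule_mem (ε := ε) (hv i).2
  rw [← hkdef] at hS hS'
  set s := allocRule m K ε v
  set s' := allocRule m K ε v'
  set δ := roundingUnit n k ε (vMax m v) with hδdef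
  set δ' := roundingUnit n k ε (vMax m v') with hδdef'
  by_contra! hlt
  suffices h : s = s' by rw [h] at hlt; exact lt_irrefl _ hlt
  have hvi : v i m ≤ v' i m := by
    rcases Nat.eq_zero_or_pos m with h0 | h0
    · rw [h0, (hv i).1.1, (hv' i).1.1]
    · have := hsc 0 m h0 le_rfl
      rw [(hv i).1.1, (hv' i).1.1] at this
      simpa using this
  have hvm : ∀ j, v j m ≤ v' j m := fun j => by
    by_cases hj : j = i
    · exact hj ▸ hvi
    · rw [hne j hj]
  have hmax : vMax m v ≤ vMax m v' := by
    obtain ⟨j, hj⟩ := exists_vMax_eq (m := m) hn v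
    exact hj ▸ (hvm j).trans (le_vMax v' j)
  have hw0 := vMax_nonneg fun j => (hv j).1
  have hw0' := vMax_nonneg fun j => (hv' j).1
  have hδ0 : 0 ≤ δ := roundingUnit_nonneg hn hk hε hw0
  have hmarg : ∀ {x}, x ∈ K i → v i x - v i (x - 1) ≤ v' i x - v' i (x - 1) := fun {x} hx => by
    have := Finset.mem_Icc.1 ((hv i).2.1 hx)
    exact hsc _ _ (by omega) this.2
  -- The contribution of player `j` to the change, from `v` to `v'`, in the advantage of `s` over
  -- `s'`. By `IsSelected.eq_of_le` it remains to show that the sum is nonnegative.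
  set D : Fin n → ℝ := fun j =>
    (rewarded n m k ε δ' (K j) (v' j) (s j) - rewarded n m k ε δ' (K j) (v' j) (s' j))
      - (rewarded n m k ε δ (K j) (v j) (s j) - rewarded n m k ε δ (K j) (v j) (s' j)) with hD
  have hDeq : ∀ j, D j = ∑ x ∈ (K j).filter (· ≤ s j),
      ((roundDown δ' (v' j x - v' j (x - 1)) + reward n m k ε δ' (v' j))
        - (roundDown δ (v j x - v j (x - 1)) + reward n m k ε δ (v j)))
      - ∑ x ∈ (K j).filter (· ≤ s' j),
      ((roundDown δ' (v' j x - v' j (x - 1)) + reward n m k ε δ' (v' j))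
        - (roundDown δ (v j x - v j (x - 1)) + reward n m k ε δ (v j))) := fun j => by
    simp only [hD]
    rw [rewarded_eq_sum (hv j).2 (hS.1.le j), rewarded_eq_sum (hv j).2 (hS'.1.le j),
      rewarded_eq_sum (hv' j).2 (hS.1.le j), rewarded_eq_sum (hv' j).2 (hS'.1.le j)]
    simp only [Finset.sum_sub_distrib]
    ring
  refine hS.eq_of_le hS' ?_
  change 0 ≤ ∑ j, D j
  -- With an unchanged unit the others contribute `0`, and player `i` gains at each step between `s'
  -- i` and `s i`: his marginals rise and he cannot leave `TOP`.
  rcases (roundingUnit_mono hn hk hε hw0 hmax).eq_or_lt with heq | hjump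
  · refine Finset.sum_nonneg fun j _ => ?_
    by_cases hj : j = i
    · subst hj
      rw [hDeq, sum_filter_le_sub _ _ hlt.le]
      refine Finset.sum_nonneg fun x hx => ?_
      have h1 := roundDown_mono hδ0 (hmarg (Finset.mem_filter.1 hx).1)
      have h2 : reward n m k ε δ (v j) ≤ reward n m k ε δ (v' j) := by
        unfold reward
        split_ifs with h3 h4
        · exact le_rfl
        · exact absurd (h3.trans hvi) h4
        · positivity
        · exact le_rfl
      rw [show δ' = δ from heq.symm]
      linarith
    · simp only [hD]
      rw [hne j hj, show δ' = δ from heq.symm, sub_self]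
  · obtain ⟨hj1, hj2⟩ := roundingUnit_jump hn hk hε hw0 hmax hjump
    rw [← hδdef, ← hδdef'] at hj1 hjump
    rw [← hδdef'] at hj2
    have hδ'0 : 0 < δ' := hδ0.trans_lt hjump
    have hδ4 : 4 * δ ≤ δ' := le_trans (by nlinarith) hj1
    -- The unit has jumped: `4knδ ≤ δ'`, so an old reward `2knδ` is at most `δ' / 2`.
    have hrew : ∀ j, reward n m k ε δ (v j) ≤ δ' / 2 := fun j =>
      (reward_le hδ0).trans (by linarith)
    have hz : ∀ j, ∀ x ∈ K j, δ = 0 → v j x - v j (x - 1) = 0 := fun j x hx h0 => by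
      have := Finset.mem_Icc.1 ((hv j).2.1 hx)
      exact marginal_eq_zero hk hε (fun j => (hv j).1) h0 j this.2 (by omega)
    have hz' : ∀ x : ℝ, δ' = 0 → x = 0 := fun _ h0 => absurd h0 hδ'0.ne'
    -- Only player `i` can have raised the maximum, so he attains it and is in `TOP`. Each step he
    -- gives up carries the new reward; against it stand at most `δ'` from rounding and `δ' / 2`
    -- from the old reward.
    have hDi : 2 * δ' * k * n - 3 / 2 * δ' ≤ D i := by
      have htop : reward n m k ε δ' (v' i) = 2 * δ' * k * n := by
        have hmi : v' i m = vMax m v' := by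
          obtain ⟨j, hj⟩ := exists_vMax_eq (m := m) hn v'
          by_cases hji : j = i
          · exact hji ▸ hj
          · exfalso
            rw [hne j hji] at hj
            have : vMax m v = vMax m v' := le_antisymm hmax (hj ▸ le_vMax v j)
            rw [hδdef, hδdef', this] at hjump
            exact lt_irrefl _ hjump
        unfold reward
        rw [if_pos]
        have h1 : δ' ≤ _ := roundingUnit_le hn hk hε hw0'
        rw [le_div_iff₀ (by positivity)] at h1
        rw [div_le_iff₀ hε, hmi]
        linarith
      rw [hDeq, sum_filter_le_sub _ _ hlt.le]
      have hpos : 0 ≤ 2 * δ' * k * n - 3 / 2 * δ' := by nlinarith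
      have hterm : ∀ x ∈ (K i).filter (fun j => s' i < j ∧ j ≤ s i),
          2 * δ' * k * n - 3 / 2 * δ' ≤
            (roundDown δ' (v' i x - v' i (x - 1)) + reward n m k ε δ' (v' i))
            - (roundDown δ (v i x - v i (x - 1)) + reward n m k ε δ (v i)) := by
        intro x hx
        have hxK := (Finset.mem_filter.1 hx).1
        have h1 := sub_le_roundDown hδ'0.le (hz' (v' i x - v' i (x - 1)))
        have h2 := roundDown_le hδ0 (hz i x hxK)
        have h3 := hmarg hxK
        have h4 := hrew i
        linarith
      -- At least one step is given up, namely `s i` itself.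
      have hsi : s i ∈ (K i).filter (fun j => s' i < j ∧ j ≤ s i) :=
        Finset.mem_filter.2 ⟨hmem (by omega), hlt, le_rfl⟩
      exact (hterm _ hsi).trans
        (Finset.single_le_sum (f := fun x =>
          (roundDown δ' (v' i x - v' i (x - 1)) + reward n m k ε δ' (v' i))
            - (roundDown δ (v i x - v i (x - 1)) + reward n m k ε δ (v i)))
          (fun x hx => hpos.trans (hterm x hx)) hsi)
    -- The new unit exceeds `ε` times the old maximum over `3n²k²`, so the other players are outside
    -- `TOP` now. Only rounding and old rewards remain, at most `3δ'/2` per step.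
    have hDj : ∀ j, j ≠ i → -(k * (3 / 2 * δ')) ≤ D j := by
      intro j hj
      rw [hDeq, hne j hj]
      refine (abs_le.1 (abs_sum_filter_sub_le (card_le_maxSteps K j) (by positivity) ?_ _ _)).1
      intro x hx
      have htop : reward n m k ε δ' (v j) = 0 := by
        unfold reward
        rw [if_neg]
        rw [not_le, lt_div_iff₀ hε]
        rw [div_lt_iff₀ (by positivity)] at hj2
        have := le_vMax (m := m) v j
        nlinarith
      have h1 := sub_le_roundDown hδ'0.le (hz' (v j x - v j (x - 1)))
      have h2 := roundDown_le hδ0 (hz j x hx)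
      have h3 := sub_le_roundDown hδ0 (hz j x hx)
      have h4 := roundDown_le hδ'0.le (hz' (v j x - v j (x - 1)))
      have h5 := hrew j
      have h6 := reward_nonneg (n := n) (m := m) (k := k) (ε := ε) (v := v j) hδ0
      rw [htop, abs_le]
      constructor <;> linarith
    rw [← Finset.add_sum_erase _ _ (Finset.mem_univ i)]
    have hsum : ∑ j ∈ Finset.univ.erase i, (-(k * (3 / 2 * δ'))) ≤ ∑ j ∈ Finset.univ.erase i, D j :=
      Finset.sum_le_sum fun j hj => hDj j (Finset.ne_of_mem_erase hj)
    rw [Finset.sum_const, Finset.card_erase_of_mem (Finset.mem_univ _), Finset.card_univ,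
      Fintype.card_fin, nsmul_eq_mul, Nat.cast_sub hn, Nat.cast_one] at hsum
    -- The loss of `3δ'/2` in `D i` is charged like a full player with `k` steps, so the total is at
    -- least `2knδ' - (3/2)knδ'`.
    have h1 : 3 / 2 * δ' ≤ 3 / 2 * δ' * k := by nlinarith
    have h2 : 0 ≤ δ' * k * n := by positivity
    nlinarith

/-- The output of the allocation rule is approximately optimal. -/
theorem allocRule_approx (hε : 0 < ε) (hk : 1 ≤ maxSteps K) {v : Fin n → ℕ → ℝ}
    (hv : ∀ j, IsValuation m (v j) ∧ IsMinded m (K j) (v j)) {o : Fin n → ℕ}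
    (ho : IsAllocation m o) : (1 - ε) * welfare v o ≤ welfare v (allocRule m K ε v) := by
  have hn := pos_of_one_le_maxSteps hk
  have hS := isSelected_allocRule m K ε v
  set k := maxSteps K with hkdef
  have hn1 : (1 : ℝ) ≤ n := by exact_mod_cast hn
  have hk1 : (1 : ℝ) ≤ k := by exact_mod_cast hk
  set s := allocRule m K ε v
  set δ := roundingUnit n k ε (vMax m v) with hδdef
  have hw0 := vMax_nonneg fun j => (hv j).1
  have hδ0 : 0 ≤ δ := roundingUnit_nonneg hn hk hε hw0
  have hz : ∀ j, ∀ x ∈ K j, δ = 0 → v j x - v j (x - 1) = 0 := fun j x hx h0 => by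
    have := Finset.mem_Icc.1 ((hv j).2.1 hx)
    exact marginal_eq_zero hk hε (fun j => (hv j).1) h0 j this.2 (by omega)
  have hcard : ∀ j a, (((K j).filter (· ≤ a)).card : ℝ) ≤ k := fun j a => by
    exact_mod_cast (Finset.card_filter_le _ _).trans (card_le_maxSteps K j)
  have hlow : ∀ j a, a ≤ m → v j a - k * δ ≤ rewarded n m k ε δ (K j) (v j) a := by
    intro j a ha
    rw [rewarded_eq_sum (hv j).2 ha, (hv j).2.value_eq (hv j).1 ha]
    have : ∑ x ∈ (K j).filter (· ≤ a), (v j x - v j (x - 1) - δ) ≤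
        ∑ x ∈ (K j).filter (· ≤ a),
          (roundDown δ (v j x - v j (x - 1)) + reward n m k ε δ (v j)) := by
      refine Finset.sum_le_sum fun x hx => ?_
      have h1 := sub_le_roundDown hδ0 (hz j x (Finset.mem_filter.1 hx).1)
      have h2 := reward_nonneg (n := n) (m := m) (k := k) (ε := ε) (v := v j) hδ0
      linarith
    rw [Finset.sum_sub_distrib, Finset.sum_const, nsmul_eq_mul] at this
    have h3 := mul_le_mul_of_nonneg_right (hcard j a) hδ0
    linarith
  have hupp : ∀ j a, a ≤ m → rewarded n m k ε δ (K j) (v j) a ≤ v j a + k * (2 * δ * k * n) := by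
    intro j a ha
    rw [rewarded_eq_sum (hv j).2 ha, (hv j).2.value_eq (hv j).1 ha]
    have : ∑ x ∈ (K j).filter (· ≤ a),
          (roundDown δ (v j x - v j (x - 1)) + reward n m k ε δ (v j)) ≤
        ∑ x ∈ (K j).filter (· ≤ a), (v j x - v j (x - 1) + 2 * δ * k * n) := by
      refine Finset.sum_le_sum fun x hx => ?_
      have h1 := roundDown_le hδ0 (hz j x (Finset.mem_filter.1 hx).1)
      have h2 := reward_le (n := n) (m := m) (k := k) (ε := ε) (v := v j) hδ0
      linarith
    rw [Finset.sum_add_distrib (f := fun x => v j x - v j (x - 1)), Finset.sum_const,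
      nsmul_eq_mul] at this
    have h3 := mul_le_mul_of_nonneg_right (hcard j a) (show 0 ≤ 2 * δ * k * n by positivity)
    linarith
  have hopt := hS.2.1 o ho
  have h1 : welfare v o - n * (k * δ) ≤ welfare (fun i => rewarded n m k ε δ (K i) (v i)) o := by
    have := Finset.sum_le_sum fun (j : Fin n) (_ : j ∈ Finset.univ) => hlow j _ (ho.le j)
    rw [Finset.sum_sub_distrib] at this
    simpa [welfare] using this
  have h2 : welfare (fun i => rewarded n m k ε δ (K i) (v i)) s
      ≤ welfare v s + n * (k * (2 * δ * k * n)) := by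
    have := Finset.sum_le_sum fun (j : Fin n) (_ : j ∈ Finset.univ) => hupp j _ (hS.1.le j)
    rw [Finset.sum_add_distrib] at this
    simpa [welfare] using this
  -- The first term is at most `n²k²δ`, so the sum is at most `3n²k²δ`; the definition of `δ` bounds
  -- this by `ε·v_max`.
  have h3 : n * (k * δ) + n * (k * (2 * δ * k * n)) ≤ ε * vMax m v := by
    have h4 : δ ≤ _ := roundingUnit_le hn hk hε hw0
    rw [le_div_iff₀ (by positivity)] at h4
    have h5 : n * k * δ * 1 ≤ n * k * δ * (n * k) := by gcongr; nlinarith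
    nlinarith
  obtain ⟨i, hi⟩ := exists_vMax_eq (m := m) hn v
  by_cases hcase : vMax m v ≤ welfare v o
  · have h6 := mul_le_mul_of_nonneg_left hcase hε.le
    linarith
  -- If `o` is worse than `v_max`, compare with giving all items to a player of maximal value.
  · have hal : IsAllocation m (Function.update (fun _ : Fin n => 0) i m) := by
      simp [IsAllocation, Finset.sum_update_of_mem]
    have h7 := hS.2.1 _ hal
    have h8 : vMax m v - n * (k * δ) ≤ welfare (fun i => rewarded n m k ε δ (K i) (v i))
        (Function.update (fun _ : Fin n => 0) i m) := by
      have h9 : welfare v (Function.update (fun _ : Fin n => 0) i m) = vMax m v := by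
        unfold welfare
        rw [Finset.sum_eq_single i]
        · simpa using hi
        · intro j _ hj; simp [hj, (hv j).1.1]
        · simp
      have := Finset.sum_le_sum fun (j : Fin n) (_ : j ∈ Finset.univ) => hlow j _ (hal.le j)
      rw [Finset.sum_sub_distrib] at this
      rw [← h9]
      simpa [welfare] using this
    have h10 : 0 ≤ welfare v o := Finset.sum_nonneg fun j _ => (hv j).1.nonneg (ho.le j)
    have h11 : 0 ≤ ε * welfare v o := by positivity
    rw [not_le] at hcase
    -- For `ε > 1` the left-hand side is nonpositive and values are nonnegative.
    by_cases hε1 : ε ≤ 1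
    · nlinarith
    · have h12 : 0 ≤ welfare v s := Finset.sum_nonneg fun j _ => (hv j).1.nonneg (hS.1.le j)
      nlinarith

end Rule

/-! ### Payments -/

section Price

variable {T : Type u} {m : ℕ} {V : T → ℕ → ℝ} {g : T → ℕ}

theorem price_of_forall_le {a : ℕ} (h : ∀ x, a ≤ g x) : price V g a = 0 := by
  classical
  unfold price
  rw [Finset.filter_false_of_mem, Finset.sum_empty]
  rintro b hb ⟨-, _, ⟨x, rfl⟩, hx⟩
  have := h x
  have := Finset.mem_range.1 hb
  omega

/-- The price increment between two consecutive quantities. -/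
theorem price_succ {a b : ℕ} (ha : a ∈ Set.range g) (hb : b ∈ Set.range g) (hab : a < b)
    (h : ∀ x, g x < b → g x ≤ a) :
    price V g b = price V g a + sInf ((fun x => V x b - V x a) '' {x | g x = b}) := by
  classical
  have hsup : sSup {b' | b' ∈ Set.range g ∧ b' < b} = a := by
    refine IsGreatest.csSup_eq ⟨⟨ha, hab⟩, ?_⟩
    rintro _ ⟨⟨x, rfl⟩, hx⟩
    exact h x hx
  unfold price
  have hfil : (Finset.range (b + 1)).filter
      (fun c => c ∈ Set.range g ∧ ∃ b' ∈ Set.range g, b' < c) =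
      insert b ((Finset.range (a + 1)).filter
        (fun c => c ∈ Set.range g ∧ ∃ b' ∈ Set.range g, b' < c)) := by
    ext c
    simp only [Finset.mem_filter, Finset.mem_range, Finset.mem_insert]
    constructor
    · rintro ⟨h1, h2, h3⟩
      rcases eq_or_ne c b with h4 | h4
      · exact Or.inl h4
      · obtain ⟨x, rfl⟩ := h2
        have := h x (by omega)
        exact Or.inr ⟨by omega, ⟨x, rfl⟩, h3⟩
    · rintro (rfl | ⟨h1, h2⟩)
      · exact ⟨by omega, hb, a, ha, hab⟩
      · exact ⟨by omega, h2⟩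
  rw [hfil, Finset.sum_insert (by simp; omega), hsup, add_comm]

variable [LinearOrder T]

theorem marginal_mono (hsc : SingleCrossing m V)
    {x y : T} (hxy : x ≤ y) {a b : ℕ} (hab : a < b) (hb : b ≤ m) :
    V x b - V x a ≤ V y b - V y a := by
  rcases hxy.eq_or_lt with rfl | h
  · exact le_rfl
  · exact hsc x y h a b hab hb

/-- The infimum in the price is attained at the least index with the given quantity. -/
theorem sInf_marginal_eq (hsc : SingleCrossing m V)
    {x : T} (hx : ∀ y, g y = g x → x ≤ y) {a : ℕ} (ha : a < g x) (hm : g x ≤ m) :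
    sInf ((fun y => V y (g x) - V y a) '' {y | g y = g x}) = V x (g x) - V x a := by
  refine IsLeast.csInf_eq ⟨⟨x, rfl, rfl⟩, ?_⟩
  rintro _ ⟨y, hy, rfl⟩
  exact marginal_mono hsc (hx y hy) ha hm

/-- Telescoping over the image of `g`. For a quantity `b ≤ g x`, some index at most `x` receives
`b`, so by single crossing the increment is at most the marginal of `x`. For `b` above `g x`, every
index receiving `b` lies above `x`, so the increment is at least that marginal. -/
theorem price_sub_le (hV : ∀ t, IsValuation m (V t)) (hsc : SingleCrossing m V)
    (hg : Monotone g) (hm : ∀ x, g x ≤ m) (x : T) (b : ℕ) :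
    ∀ a ≤ b, a ∈ Set.range g → b ∈ Set.range g →
      (b ≤ g x → price V g b - price V g a ≤ V x b - V x a) ∧
      (g x ≤ a → V x b - V x a ≤ price V g b - price V g a) := by
  induction b using Nat.strong_induction_on with
  | _ b ih =>
  intro a hab ha hb
  rcases hab.eq_or_lt with rfl | hlt
  · simp
  -- Its supremum `p` is the predecessor of `b` in the image: induct on the part from `a` to `p` and
  -- treat the increment from `p` to `b` directly.
  let S : Set ℕ := {c | c ∈ Set.range g ∧ c < b}
  have hSb : BddAbove S := ⟨b, fun c hc => hc.2.le⟩
  obtain ⟨hp1, hp2⟩ : sSup S ∈ S := Nat.sSup_mem ⟨a, ha, hlt⟩ hSb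
  have hap : a ≤ sSup S := le_csSup hSb ⟨ha, hlt⟩
  set p := sSup S
  obtain ⟨ih1, ih2⟩ := ih p hp2 a hap ha hp1
  have hstep := price_succ (V := V) hp1 hb hp2 fun y hy => le_csSup hSb ⟨⟨y, rfl⟩, hy⟩
  obtain ⟨z, rfl⟩ := hb
  constructor
  · intro hbx
    have h1 := ih1 (hp2.le.trans hbx)
    obtain ⟨z', hz', hzx⟩ : ∃ z', g z' = g z ∧ z' ≤ x := by
      rcases hbx.eq_or_lt with h | h
      · exact ⟨x, h.symm, le_rfl⟩
      · exact ⟨z, rfl, le_of_not_ge fun hc => absurd (hg hc) (not_le.2 h)⟩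
    have h2 : sInf ((fun y => V y (g z) - V y p) '' {y | g y = g z}) ≤ V z' (g z) - V z' p := by
      -- The real infimum needs a lower bound, which monotone valuations supply.
      refine csInf_le ⟨0, ?_⟩ ⟨z', hz', rfl⟩
      rintro _ ⟨y, -, rfl⟩
      exact sub_nonneg.2 ((hV y).2 _ _ hp2.le (hm z))
    have h3 := marginal_mono hsc hzx hp2 (hm z)
    linarith
  · intro hxa
    have h1 := ih2 hxa
    have h2 : V x (g z) - V x p ≤ sInf ((fun y => V y (g z) - V y p) '' {y | g y = g z}) := by
      refine le_csInf ⟨_, z, rfl, rfl⟩ ?_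
      rintro _ ⟨y, hy, rfl⟩
      refine marginal_mono hsc (le_of_not_ge fun hc => ?_) hp2 (hm z)
      have := hg hc
      rw [show g y = g z from hy] at this
      omega
    linarith

theorem price_incentive (hV : ∀ t, IsValuation m (V t)) (hsc : SingleCrossing m V)
    (hg : Monotone g) (hm : ∀ x, g x ≤ m) (x y : T) :
    V x (g y) - price V g (g y) ≤ V x (g x) - price V g (g x) := by
  rcases le_total (g x) (g y) with h | h
  · have := (price_sub_le hV hsc hg hm x _ _ h ⟨x, rfl⟩ ⟨y, rfl⟩).2 le_rfl
    linarith
  · have := (price_sub_le hV hsc hg hm x _ _ h ⟨y, rfl⟩ ⟨x, rfl⟩).1 le_rfl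
    linarith

end Price

/-! ### Incentive compatibility -/

section Mechanism

variable {n m : ℕ} {K : Fin n → Finset ℕ} {ε : ℝ} {T : Fin n → Type u}
  {V : ∀ i, T i → ℕ → ℝ}

theorem implementable_of_incentiveCompatible {f : (∀ i, T i) → Fin n → ℕ}
    {P : (∀ i, T i) → Fin n → ℝ} (h : IncentiveCompatible V f P) : Implementable V f := by
  intro i t
  refine ⟨fun x => P (Function.update t i x) i, fun x y => ?_⟩
  simpa using h i (Function.update t i x) y

variable [∀ i, LinearOrder (T i)]

theorem monotone_allocRule (hε : 0 < ε) (hk : 1 ≤ maxSteps K)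
    (hV : ∀ i, IsMindedSingleCrossing m (K i) (V i)) (t : ∀ i, T i) (i : Fin n) :
    Monotone fun x => allocRule m K ε (fun j => V j (Function.update t i x j)) i := by
  intro x y hxy
  refine allocRule_mono hε hk i (fun j => ⟨(hV j).1 _, (hV j).2.1 _⟩)
    (fun j => ⟨(hV j).1 _, (hV j).2.1 _⟩) (fun j hj => by simp [hj]) ?_
  intro s s' hs hs'
  simpa using marginal_mono (hV i).2.2 hxy hs hs'

theorem incentiveCompatible_allocRule (hε : 0 < ε) (hk : 1 ≤ maxSteps K)
    (hV : ∀ i, IsMindedSingleCrossing m (K i) (V i)) :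
    IncentiveCompatible V (fun t => allocRule m K ε fun i => V i (t i))
      (payment V fun t => allocRule m K ε fun i => V i (t i)) := by
  intro i t x
  have := price_incentive (hV i).1 (hV i).2.2 (monotone_allocRule hε hk hV t i)
    (fun x => (isSelected_allocRule m K ε _).1.le i) (t i) x
  -- Overwriting the report of `i` does not change his rule, so both payments come from the same
  -- price function.
  simpa [payment] using this

end Mechanism

/-! ### Dynamic program

Player `i` chooses one of the options `r = 0, …, k`: option `r` has size `κ i r` and value
`U i r`. -/

/-- The smallest size needed for value `w` if the first `R` options of the last player may be used
and the other players need size `A w'` for value `w'`; sizes above `m` are replaced by `m + 1`. -/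
def minSizeStep (m : ℕ) (A κ U : ℕ → ℕ) (w : ℕ) : ℕ → ℕ
  | 0 => m + 1
  | r + 1 => if U r ≤ w then min (minSizeStep m A κ U w r) (A (w - U r) + κ r)
      else minSizeStep m A κ U w r

/-- The smallest size needed by the first `i` players for the total value `w`. -/
def minSize (m k : ℕ) (κ U : ℕ → ℕ → ℕ) : ℕ → ℕ → ℕ
  | 0, w => if w = 0 then 0 else m + 1
  | i + 1, w => minSizeStep m (minSize m k κ U i) (κ i) (U i) w (k + 1)

/-- The cap keeps every table entry within the register bound. -/
theorem minSizeStep_le_cap (m : ℕ) (A κ U : ℕ → ℕ) (w R : ℕ) :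
    minSizeStep m A κ U w R ≤ m + 1 := by
  induction R with
  | zero => exact le_rfl
  | succ r ih =>
    simp only [minSizeStep]
    split_ifs
    · exact (min_le_left _ _).trans ih
    · exact ih

theorem minSizeStep_le {m : ℕ} {A κ U : ℕ → ℕ} {w R r : ℕ} (hr : r < R) (hU : U r ≤ w) :
    minSizeStep m A κ U w R ≤ A (w - U r) + κ r := by
  induction R with
  | zero => omega
  | succ R ih =>
    simp only [minSizeStep]
    rcases Nat.lt_succ_iff_lt_or_eq.1 hr with h | rfl
    · split_ifs
      · exact (min_le_left _ _).trans (ih h)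
      · exact ih h
    · rw [if_pos hU]
      exact min_le_right _ _

theorem exists_minSizeStep_eq {m : ℕ} {A κ U : ℕ → ℕ} {w R : ℕ}
    (h : minSizeStep m A κ U w R ≤ m) :
    ∃ r < R, U r ≤ w ∧ A (w - U r) + κ r = minSizeStep m A κ U w R := by
  induction R with
  | zero => simp [minSizeStep] at h
  | succ R ih =>
    simp only [minSizeStep] at h ⊢
    split_ifs at h ⊢ with hU
    · rcases min_cases (minSizeStep m A κ U w R) (A (w - U R) + κ R) with h1 | h1
      · rw [h1.1] at h ⊢
        obtain ⟨r, hr, h2⟩ := ih h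
        exact ⟨r, by omega, h2⟩
      · rw [h1.1]
        exact ⟨R, by omega, hU, rfl⟩
    · obtain ⟨r, hr, h2⟩ := ih h
      exact ⟨r, by omega, h2⟩

theorem minSize_le_cap (m k : ℕ) (κ U : ℕ → ℕ → ℕ) (i w : ℕ) : minSize m k κ U i w ≤ m + 1 := by
  cases i with
  | zero => simp only [minSize]; split_ifs <;> omega
  | succ i => exact minSizeStep_le_cap _ _ _ _ _ _

theorem minSize_sum_le {m k : ℕ} {κ U : ℕ → ℕ → ℕ} {r : ℕ → ℕ} (i : ℕ) (hr : ∀ j < i, r j ≤ k) :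
    minSize m k κ U i (∑ j ∈ Finset.range i, U j (r j)) ≤ ∑ j ∈ Finset.range i, κ j (r j) := by
  induction i with
  | zero => simp [minSize]
  | succ i ih =>
    rw [Finset.sum_range_succ, Finset.sum_range_succ]
    have h1 := ih fun j hj => hr j (by omega)
    have h2 := minSizeStep_le (m := m) (A := minSize m k κ U i) (κ := κ i) (U := U i)
      (w := ∑ j ∈ Finset.range i, U j (r j) + U i (r i)) (show r i < k + 1 from
        Nat.lt_succ_of_le (hr i (Nat.lt_succ_self i)))
      (Nat.le_add_left _ _)
    rw [Nat.add_sub_cancel] at h2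
    simp only [minSize]
    omega

/-- `c i` is the last option of player `i` from which the minimal size for the value `w (i + 1)` can
be attained, and `w i` is the value that remains for the players before him. -/
def IsBacktrack (m k : ℕ) (κ U : ℕ → ℕ → ℕ) (w c : ℕ → ℕ) (i : ℕ) : Prop :=
  c i ≤ k ∧ U i (c i) ≤ w (i + 1) ∧ w i = w (i + 1) - U i (c i) ∧
    minSize m k κ U i (w i) + κ i (c i) = minSize m k κ U (i + 1) (w (i + 1)) ∧
    ∀ r ≤ k, c i < r → U i r ≤ w (i + 1) →
      minSize m k κ U (i + 1) (w (i + 1)) < minSize m k κ U i (w (i + 1) - U i r) + κ i r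

/-- Minimal sizes only decrease along the backtrack, so none reaches the cap. In row `0` this forces
the remaining value to be `0`, and the choices then add up. -/
theorem sum_eq_of_isBacktrack {n m k : ℕ} {κ U : ℕ → ℕ → ℕ} {w c : ℕ → ℕ}
    (h : ∀ i < n, IsBacktrack m k κ U w c i) (hm : minSize m k κ U n (w n) ≤ m) :
    ∀ i ≤ n, ∑ j ∈ Finset.range i, U j (c j) = w i ∧
      ∑ j ∈ Finset.range i, κ j (c j) = minSize m k κ U i (w i) := by
  have hle : ∀ i ≤ n, minSize m k κ U i (w i) ≤ m := by
    intro i hi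
    induction hi using Nat.decreasingInduction with
    | self => exact hm
    | of_succ i hi ih => have := (h i hi).2.2.2.1; omega
  intro i hi
  induction i with
  | zero =>
    have h0 := hle 0 (Nat.zero_le _)
    simp only [minSize] at h0
    have hw : w 0 = 0 := by
      by_contra hc
      rw [if_neg hc] at h0
      omega
    simp [minSize, hw]
  | succ i ih =>
    obtain ⟨h1, h2⟩ := ih (by omega)
    obtain ⟨-, h3, h4, h5, -⟩ := h i (by omega)
    rw [Finset.sum_range_succ, Finset.sum_range_succ, h1, h2]
    omega

/-- Backtracking from the largest value that can be attained yields the selected allocation. -/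
theorem isSelected_of_isBacktrack {n m k W : ℕ} {κ U : ℕ → ℕ → ℕ} {u : Fin n → ℕ → ℕ}
    (hκ : ∀ i : Fin n, Monotone (κ i)) (hU : ∀ (i : Fin n) (r : ℕ), U i r = u i (κ i r))
    (hcov : ∀ (i : Fin n) (s : ℕ), s ≤ m → ∃ r ≤ k, κ i r ≤ s ∧ u i (κ i r) = u i s)
    (hW : ∀ r : ℕ → ℕ, (∀ j < n, r j ≤ k) → ∑ j ∈ Finset.range n, U j (r j) ≤ W)
    {w c : ℕ → ℕ} (hm : minSize m k κ U n (w n) ≤ m)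
    (hmax : ∀ w' ≤ W, minSize m k κ U n w' ≤ m → w' ≤ w n)
    (h : ∀ i < n, IsBacktrack m k κ U w c i) :
    IsSelected m (fun i s => (u i s : ℝ)) (fun i => κ i (c i)) := by
  have hsum := sum_eq_of_isBacktrack h hm
  obtain ⟨hsumU, hsumκ⟩ := hsum n le_rfl
  -- Any allocation can be shrunk to options without changing a value, so options suffice for
  -- optimality and for the least total.
  have hrep : ∀ s' : Fin n → ℕ, IsAllocation m s' → ∃ r : ℕ → ℕ, (∀ j < n, r j ≤ k) ∧
      ∀ j : Fin n, κ j (r j) ≤ s' j ∧ U j (r j) = u j (s' j) := by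
    intro s' hs'
    choose r hr1 hr2 hr3 using fun i : Fin n => hcov i (s' i) (hs'.le i)
    refine ⟨fun j => if hj : j < n then r ⟨j, hj⟩ else 0, fun j hj => ?_, fun j => ?_⟩
    · simpa [hj] using hr1 ⟨j, hj⟩
    · simpa [hU] using ⟨hr2 j, hr3 j⟩
  have hwel : ∀ s' : Fin n → ℕ, welfare (fun i s => (u i s : ℝ)) s' =
      ((∑ j, u j (s' j) : ℕ) : ℝ) := fun s' => by simp [welfare]
  have hwc : ∑ j : Fin n, u j (κ j (c j)) = w n := by
    rw [← hsumU, Finset.sum_range]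
    simp [hU]
  have halc : ∑ j : Fin n, κ j (c j) = minSize m k κ U n (w n) := by
    rw [← hsumκ, Finset.sum_range]
  have hle : ∀ (s' : Fin n → ℕ) (r : ℕ → ℕ), (∀ j : Fin n, κ j (r j) ≤ s' j ∧
      U j (r j) = u j (s' j)) → ∑ j ∈ Finset.range n, κ j (r j) ≤ ∑ j, s' j ∧
        ∑ j ∈ Finset.range n, U j (r j) = ∑ j, u j (s' j) := by
    intro s' r hr
    rw [Finset.sum_range, Finset.sum_range]
    exact ⟨Finset.sum_le_sum fun j _ => (hr j).1, Finset.sum_congr rfl fun j _ => (hr j).2⟩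
  refine ⟨show ∑ j : Fin n, κ j (c j) ≤ m by omega, fun s' hs' => ?_, fun s' hs' hw hne => ?_⟩
  · obtain ⟨r, hr, hr'⟩ := hrep s' hs'
    obtain ⟨h1, h2⟩ := hle s' r hr'
    rw [hwel, hwel, hwc]
    norm_cast
    rw [← h2]
    exact hmax _ (hW r hr) ((minSize_sum_le n hr).trans (h1.trans hs'))
  · obtain ⟨r, hr, hr'⟩ := hrep s' hs'
    obtain ⟨h1, h2⟩ := hle s' r hr'
    rw [hwel, hwel, hwc] at hw
    norm_cast at hw
    have h3 := minSize_sum_le (m := m) (κ := κ) (U := U) n hr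
    rw [h2, hw, ← halc] at h3
    rcases (h3.trans h1).lt_or_eq with h4 | h4
    · exact Or.inl h4
    -- Equal totals, and suppose `s'` is preferred, with `l` the last index of difference. The
    -- minimal total forces `s'` to consist of options already.
    · refine (preferred_or hne).resolve_right fun hp => ?_
      rcases hp with hp | ⟨-, l, hl, hl'⟩
      · simp only at hp
        omega
      have h5 : ∀ j : Fin n, κ j (r j) = s' j := by
        have h6 : ∑ j : Fin n, κ j (r j) = ∑ j, s' j := by
          rw [Finset.sum_range] at h1 h3; omega
        intro j
        exact (Finset.sum_eq_sum_iff_of_le fun j _ => (hr' j).1).1 h6 j (Finset.mem_univ j)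
      have h7 : ∀ j < n, (l : ℕ) < j → κ j (r j) = κ j (c j) ∧ U j (r j) = U j (c j) := by
        intro j hj hlj
        have h8 := hl' ⟨j, hj⟩ hlj
        have h9 := h5 ⟨j, hj⟩
        have h10 : κ j (r j) = κ j (c j) := h9.trans h8
        have h11 := hU ⟨j, hj⟩ (r j)
        have h12 := hU ⟨j, hj⟩ (c j)
        simp only at h11 h12
        exact ⟨h10, by rw [h11, h12, h10]⟩
      have hsplit : ∀ f : ℕ → ℕ, ∑ j ∈ Finset.range n, f j =
          ∑ j ∈ Finset.range l, f j + f l + ∑ j ∈ Finset.Ico (l + 1 : ℕ) n, f j := by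
        intro f
        rw [← Finset.sum_range_succ, Finset.sum_range_add_sum_Ico _ l.2]
      have hIco : ∀ f g : ℕ → ℕ, (∀ j < n, (l : ℕ) < j → f j = g j) →
          ∑ j ∈ Finset.Ico (l + 1 : ℕ) n, f j = ∑ j ∈ Finset.Ico (l + 1 : ℕ) n, g j := by
        intro f g hfg
        refine Finset.sum_congr rfl fun j hj => ?_
        have := Finset.mem_Ico.1 hj
        exact hfg j this.2 (by omega)
      have hU1 := hsplit fun j => U j (r j)
      have hU2 := hsplit fun j => U j (c j)
      have hκ1 := hsplit fun j => κ j (r j)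
      have hκ2 := hsplit fun j => κ j (c j)
      rw [hIco _ _ fun j hj hlj => (h7 j hj hlj).2] at hU1
      rw [hIco _ _ fun j hj hlj => (h7 j hj hlj).1] at hκ1
      obtain ⟨h8, h9⟩ := hsum (l + 1) l.2
      rw [Finset.sum_range_succ] at h8 h9
      -- Above `l` both allocations agree, so the same value `w (l + 1)` is left for the players up
      -- to `l`. There `s'` takes a later option than `c l`. As `c l` is the last optimal one, `s'`
      -- needs strictly more items in total, which contradicts equality.
      have h10 : ∑ j ∈ Finset.range l, U j (r j) = w (l + 1) - U l (r l) := by omega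
      have h11 : U l (r l) ≤ w (l + 1) := by omega
      have h12 := minSize_sum_le (m := m) (κ := κ) (U := U) (l : ℕ) (r := r)
        fun j hj => hr j (by omega)
      rw [h10] at h12
      have h13 : κ l (c l) < κ l (r l) := by rw [h5 l]; exact hl
      have h14 : c l < r l := by
        by_contra hc
        exact absurd (hκ l (not_lt.1 hc)) (not_le.2 h13)
      have h15 := (h l l.2).2.2.2.2 (r l) (hr l l.2) h14 h11
      rw [Finset.sum_range] at h1 h3
      have h16 : ∑ j ∈ Finset.range n, κ j (r j) = ∑ j ∈ Finset.range n, κ j (c j) := by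
        rw [Finset.sum_range, Finset.sum_range]; omega
      omega

/-- A positive factor changes neither maximizers nor ties. The factor `0` makes everything a tie, so
there `u` itself must vanish. -/
theorem IsSelected.of_scaled {n m : ℕ} {u u' : Fin n → ℕ → ℝ} {s : Fin n → ℕ} {δ : ℝ}
    (h : IsSelected m u s) (hδ : 0 ≤ δ) (hu : ∀ i, ∀ s ≤ m, u' i s = δ * u i s)
    (h0 : δ = 0 → ∀ i, ∀ s ≤ m, u i s = 0) : IsSelected m u' s := by
  have hw : ∀ s', IsAllocation m s' → welfare u' s' = δ * welfare u s' := by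
    intro s' hs'
    unfold welfare
    rw [Finset.mul_sum]
    exact Finset.sum_congr rfl fun i _ => hu i _ (hs'.le i)
  refine ⟨h.1, fun s' hs' => ?_, fun s' hs' he hne => ?_⟩
  · rw [hw _ hs', hw _ h.1]
    exact mul_le_mul_of_nonneg_left (h.2.1 s' hs') hδ
  · refine h.2.2 s' hs' ?_ hne
    rcases eq_or_ne δ 0 with hz | hz
    · have : ∀ s', IsAllocation m s' → welfare u s' = 0 := fun s' hs' =>
        Finset.sum_eq_zero fun i _ => h0 hz i _ (hs'.le i)
      rw [this _ hs', this _ h.1]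
    · rw [hw _ hs', hw _ h.1] at he
      exact mul_left_cancel₀ hz he

/-! ### The options of a player -/

/-- The `r`-th smallest element of `K`, preceded by `0` and with the largest element repeated. -/
def optionSize (K : Finset ℕ) (r : ℕ) : ℕ :=
  if r = 0 then 0 else (K.sort (· ≤ ·)).getD (min r K.card - 1) 0

section Options

variable {K : Finset ℕ}

theorem optionSize_zero : optionSize K 0 = 0 := rfl

theorem optionSize_succ {r : ℕ} (hr : r < K.card) :
    optionSize K (r + 1) = (K.sort (· ≤ ·)).getD r 0 := by
  rw [optionSize, if_neg (by omega), show min (r + 1) K.card - 1 = r by omega]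

theorem optionSize_succ_of_le {r : ℕ} (hr : K.card ≤ r) :
    optionSize K (r + 1) = optionSize K r := by
  rcases Nat.eq_zero_or_pos r with rfl | h
  · have : K = ∅ := by simpa using hr
    simp [optionSize, this]
  · rw [optionSize, optionSize, if_neg (by omega), if_neg (by omega),
      show min (r + 1) K.card = min r K.card by omega]

theorem optionSize_mem {r : ℕ} (hr : r < K.card) : optionSize K (r + 1) ∈ K := by
  have h : r < (K.sort (· ≤ ·)).length := by simpa using hr
  rw [optionSize_succ hr, List.getD_eq_getElem _ _ h]
  exact (Finset.mem_sort _).1 (List.getElem_mem h)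

theorem exists_optionSize_eq {x : ℕ} (hx : x ∈ K) : ∃ r < K.card, optionSize K (r + 1) = x := by
  obtain ⟨r, hr, h⟩ := List.getElem_of_mem ((Finset.mem_sort (· ≤ ·)).2 hx)
  have hr' : r < K.card := by simpa using hr
  exact ⟨r, hr', by rw [optionSize_succ hr', List.getD_eq_getElem _ _ hr, h]⟩

theorem optionSize_lt_succ {r : ℕ} (h0 : 0 ∉ K) (hr : r < K.card) :
    optionSize K r < optionSize K (r + 1) := by
  rcases r with _ | r
  · exact Nat.pos_of_ne_zero fun h => h0 (h ▸ optionSize_mem hr)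
  · have h1 : r < (K.sort (· ≤ ·)).length := by simp; omega
    have h2 : r + 1 < (K.sort (· ≤ ·)).length := by simpa using hr
    rw [optionSize_succ hr, optionSize_succ (by omega), List.getD_eq_getElem _ _ h1,
      List.getD_eq_getElem _ _ h2]
    exact (Finset.sortedLT_sort K).strictMono_get (show (⟨r, h1⟩ : Fin _) < ⟨r + 1, h2⟩ by simp)

theorem optionSize_mono (h0 : 0 ∉ K) : Monotone (optionSize K) := by
  refine monotone_nat_of_le_succ fun r => ?_
  rcases lt_or_ge r K.card with h | h
  · exact (optionSize_lt_succ h0 h).le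
  · exact (optionSize_succ_of_le h).ge

theorem optionSize_le {m : ℕ} (hK : ∀ x ∈ K, x ≤ m) (r : ℕ) : optionSize K r ≤ m := by
  induction r with
  | zero => exact Nat.zero_le _
  | succ r ih =>
    rcases lt_or_ge r K.card with h | h
    · exact hK _ (optionSize_mem h)
    · rw [optionSize_succ_of_le h]; exact ih

theorem filter_le_optionSize_succ {r : ℕ} (h0 : 0 ∉ K) (hr : r < K.card) :
    K.filter (· ≤ optionSize K (r + 1)) =
      insert (optionSize K (r + 1)) (K.filter (· ≤ optionSize K r)) := by
  ext x
  simp only [Finset.mem_filter, Finset.mem_insert]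
  constructor
  · rintro ⟨hx, hle⟩
    obtain ⟨j, hj, rfl⟩ := exists_optionSize_eq hx
    rcases lt_trichotomy j r with h | h | h
    · exact Or.inr ⟨hx, optionSize_mono h0 h⟩
    · exact Or.inl (by rw [h])
    · have h1 := optionSize_lt_succ h0 hj
      have h2 := optionSize_mono h0 (show r + 1 ≤ j from h)
      omega
  · rintro (rfl | ⟨hx, hle⟩)
    · exact ⟨optionSize_mem hr, le_rfl⟩
    · exact ⟨hx, hle.trans (optionSize_lt_succ h0 hr).le⟩

theorem exists_optionSize_le (h0 : 0 ∉ K) (s : ℕ) : ∃ r ≤ K.card, optionSize K r ≤ s ∧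
    K.filter (· ≤ optionSize K r) = K.filter (· ≤ s) := by
  have hex : optionSize K 0 ≤ s := Nat.zero_le _
  -- The last option that fits into `s`; every step up to `s` is an option and hence not beyond it.
  refine ⟨Nat.findGreatest (fun r => optionSize K r ≤ s) K.card, Nat.findGreatest_le _,
    Nat.findGreatest_spec (P := fun r => optionSize K r ≤ s) (Nat.zero_le _) hex, ?_⟩
  ext x
  simp only [Finset.mem_filter, and_congr_right_iff]
  intro hx
  constructor
  · intro h
    exact h.trans (Nat.findGreatest_spec (P := fun r => optionSize K r ≤ s) (Nat.zero_le _) hex)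
  · intro h
    obtain ⟨j, hj, rfl⟩ := exists_optionSize_eq hx
    exact optionSize_mono h0 (Nat.le_findGreatest hj h)

end Options

/-! ### Rounded valuations in multiples of the rounding unit -/

open Classical in
/-- The reward at each step in multiples of the rounding unit. -/
noncomputable def rewardUnits (n m k : ℕ) (ε δ : ℝ) (v : ℕ → ℝ) : ℕ :=
  if 0 < δ ∧ 3 * δ * (n : ℝ) ^ 2 * (k : ℝ) ^ 2 / ε ≤ v m then 2 * k * n else 0

/-- The rounded and rewarded valuation in multiples of the rounding unit. -/
noncomputable def rewardedUnits (n m k : ℕ) (ε δ : ℝ) (K : Finset ℕ) (v : ℕ → ℝ) (s : ℕ) : ℕ :=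
  ∑ j ∈ K.filter (· ≤ s), (⌊(v j - v (j - 1)) / δ⌋₊ + rewardUnits n m k ε δ v)

section Units

variable {n m k : ℕ} {ε δ : ℝ} {K : Finset ℕ} {v : ℕ → ℝ}

theorem marginal_nonneg (h : IsValuation m v) (hv : IsMinded m K v) {j : ℕ} (hj : j ∈ K) :
    0 ≤ v j - v (j - 1) :=
  sub_nonneg.2 (h.2 _ _ (Nat.sub_le _ _) (Finset.mem_Icc.1 (hv.1 hj)).2)

theorem rewarded_eq_mul (hδ : 0 ≤ δ) (h : IsValuation m v) (hv : IsMinded m K v) {s : ℕ}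
    (hs : s ≤ m) : rewarded n m k ε δ K v s = δ * rewardedUnits n m k ε δ K v s := by
  rw [rewarded_eq_sum hv hs, rewardedUnits, Nat.cast_sum, Finset.mul_sum]
  refine Finset.sum_congr rfl fun j hj => ?_
  have h1 : 0 ≤ (v j - v (j - 1)) / δ :=
    div_nonneg (marginal_nonneg h hv (Finset.mem_filter.1 hj).1) hδ
  have h2 : reward n m k ε δ v = δ * rewardUnits n m k ε δ v := by
    unfold reward rewardUnits
    rcases hδ.eq_or_lt with h3 | h3
    · simp [← h3]
    · simp only [h3, true_and]
      split_ifs <;> push_cast <;> ring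
  rw [Nat.cast_add, mul_add, ← h2, roundDown, natCast_floor_eq_intCast_floor h1, mul_comm δ]

theorem rewardedUnits_eq_zero (h : δ = 0) (s : ℕ) : rewardedUnits n m k ε δ K v s = 0 := by
  simp [rewardedUnits, rewardUnits, h]

theorem zero_notMem_of_isMinded (hv : IsMinded m K v) : 0 ∉ K := fun h => by
  have := Finset.mem_Icc.1 (hv.1 h)
  omega

/-- The recurrence by which the program fills the option table, with only one new query per step. -/
theorem rewardedUnits_option_succ (h : IsValuation m v) (hv : IsMinded m K v) {r : ℕ}
    (hr : r < K.card) :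
    rewardedUnits n m k ε δ K v (optionSize K (r + 1)) =
      rewardedUnits n m k ε δ K v (optionSize K r) +
        (⌊(v (optionSize K (r + 1)) - v (optionSize K r)) / δ⌋₊ + rewardUnits n m k ε δ v) := by
  have h0 := zero_notMem_of_isMinded hv
  have hlt := optionSize_lt_succ h0 hr
  have hm := (Finset.mem_Icc.1 (hv.1 (optionSize_mem hr))).2
  -- There is no step strictly between consecutive options, so the value just below the next option
  -- is that of the current one.
  have hpred : v (optionSize K (r + 1) - 1) = v (optionSize K r) := by
    rw [hv.value_eq h (show optionSize K (r + 1) - 1 ≤ m by omega),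
      hv.value_eq h (show optionSize K r ≤ m by omega)]
    congr 1
    ext x
    have := Finset.ext_iff.1 (filter_le_optionSize_succ h0 hr) x
    simp only [Finset.mem_filter, Finset.mem_insert] at this ⊢
    constructor
    · rintro ⟨h1, h2⟩
      have h3 : x ≠ optionSize K (r + 1) := by omega
      exact (this.1 ⟨h1, by omega⟩).resolve_left h3
    · rintro ⟨h1, h2⟩
      exact ⟨h1, by omega⟩
  unfold rewardedUnits
  rw [filter_le_optionSize_succ h0 hr, Finset.sum_insert (by simp; omega), hpred, add_comm]

theorem exists_option_rewardedUnits (hv : IsMinded m K v) (hk : K.card ≤ k) (s : ℕ) :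
    ∃ r ≤ k, optionSize K r ≤ s ∧
      rewardedUnits n m k ε δ K v (optionSize K r) = rewardedUnits n m k ε δ K v s := by
  obtain ⟨r, hr, h1, h2⟩ := exists_optionSize_le (zero_notMem_of_isMinded hv) s
  exact ⟨r, hr.trans hk, h1, by unfold rewardedUnits; rw [h2]⟩

theorem rewardUnits_le : rewardUnits n m k ε δ v ≤ 2 * k * n := by
  unfold rewardUnits
  split_ifs
  · exact le_rfl
  · exact Nat.zero_le _

/-- The rounded marginals add up to at most `w / δ`, and `4kn · 3n²k² = 12n³k³` bounds this by
maximality of `δ`. Each of at most `k` steps adds at most `2kn` units of reward. -/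
theorem rewardedUnits_le {w : ℝ} (hn : 0 < n) (hk : 0 < k) (hε : 0 < ε) (h : IsValuation m v)
    (hv : IsMinded m K v) (hK : K.card ≤ k) (hw : v m ≤ w) {s : ℕ} (hs : s ≤ m) :
    rewardedUnits n m k ε (roundingUnit n k ε w) K v s
      ≤ 12 * n ^ 3 * k ^ 3 * ⌈1 / ε⌉₊ + 2 * k ^ 2 * n := by
  have hw0 : 0 ≤ w := (h.nonneg le_rfl).trans hw
  rcases hw0.eq_or_lt with h0 | h0
  · rw [rewardedUnits_eq_zero (roundingUnit_of_eq_zero h0.symm hn hk)]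
    exact Nat.zero_le _
  set δ := roundingUnit n k ε w with hδ
  have hδ0 : 0 < δ := roundingUnit_pos hn hk hε h0
  unfold rewardedUnits
  rw [Finset.sum_add_distrib, Finset.sum_const, smul_eq_mul]
  have h1 : (K.filter (· ≤ s)).card * rewardUnits n m k ε δ v ≤ k * (2 * k * n) :=
    Nat.mul_le_mul ((Finset.card_filter_le _ _).trans hK) rewardUnits_le
  have h2 : ∑ j ∈ K.filter (· ≤ s), ⌊(v j - v (j - 1)) / δ⌋₊ ≤ 12 * n ^ 3 * k ^ 3 * ⌈1 / ε⌉₊ := by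
    have h3 : ((∑ j ∈ K.filter (· ≤ s), ⌊(v j - v (j - 1)) / δ⌋₊ : ℕ) : ℝ) ≤ w / δ := by
      rw [Nat.cast_sum]
      calc _ ≤ ∑ j ∈ K.filter (· ≤ s), (v j - v (j - 1)) / δ :=
            Finset.sum_le_sum fun j hj => Nat.floor_le
              (div_nonneg (marginal_nonneg h hv (Finset.mem_filter.1 hj).1) hδ0.le)
        _ = v s / δ := by rw [← Finset.sum_div, ← hv.value_eq h hs]
        _ ≤ w / δ := by gcongr; exact (h.2 _ _ hs le_rfl).trans hw
    have h4 : w / δ ≤ 12 * n ^ 3 * k ^ 3 * (1 / ε) := by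
      have h5 := lt_base_mul_roundingUnit hn hk hε h0
      rw [div_lt_iff₀ (by positivity), ← hδ] at h5
      rw [div_le_iff₀ hδ0, mul_one_div, div_mul_eq_mul_div, le_div_iff₀ hε]
      nlinarith
    have h5 : (12 * n ^ 3 * k ^ 3 * (1 / ε) : ℝ) ≤ ((12 * n ^ 3 * k ^ 3 * ⌈1 / ε⌉₊ : ℕ) : ℝ) := by
      push_cast
      gcongr
      exact Nat.le_ceil _
    exact_mod_cast h3.trans (h4.trans h5)
  nlinarith

end Units

/-! ### The allocation program: largest value and rounding unit -/

/-- The memory holds the static part of the input; `ε = a / b`. -/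
structure HasInput {n : ℕ} (m : ℕ) (K : Fin n → Finset ℕ) (a b : ℕ) (σ : Memory) : Prop where
  players : σ 0 0 = n
  items : σ 0 1 = m
  steps : σ 0 2 = maxSteps K
  num : σ 0 3 = a
  den : σ 0 4 = b
  card : ∀ i : Fin n, σ 2 i = (K i).card
  size : ∀ (i : Fin n) (r : ℕ), r < (K i).card →
    σ 3 (i * maxSteps K + r : ℕ) = optionSize (K i) (r + 1)

theorem HasInput.congr {n m : ℕ} {K : Fin n → Finset ℕ} {a b : ℕ} {σ σ' : Memory}
    (h : HasInput m K a b σ) (h0 : σ' 0 = σ 0) (h2 : σ' 2 = σ 2) (h3 : σ' 3 = σ 3) :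
    HasInput m K a b σ' := by
  constructor
  · rw [h0]; exact h.players
  · rw [h0]; exact h.items
  · rw [h0]; exact h.steps
  · rw [h0]; exact h.num
  · rw [h0]; exact h.den
  · rw [h2]; exact h.card
  · rw [h3]; exact h.size

/-- The values of the profile `τ` are given by fractions of at most `c` bits. -/
def HasValues (q : ValueOracle) (n m c : ℕ) (τ : Fin n → ℕ) : Prop :=
  ∀ (i : Fin n) (s : ℕ), s ≤ m → (q i (τ i) s).2 ≠ 0 ∧ answerBits (q i (τ i) s) ≤ c

/-- The valuations of the profile `τ`. -/
noncomputable def profile (q : ValueOracle) {n : ℕ} (τ : Fin n → ℕ) : Fin n → ℕ → ℝ :=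
  fun i s => answerValue (q i (τ i) s)

theorem HasValues.pos {q : ValueOracle} {n m c : ℕ} {τ : Fin n → ℕ} (h : HasValues q n m c τ)
    (i : Fin n) {s : ℕ} (hs : s ≤ m) : 0 < (q i (τ i) s).2 :=
  Nat.pos_of_ne_zero (h i s hs).1

theorem HasValues.fst_lt {q : ValueOracle} {n m c : ℕ} {τ : Fin n → ℕ} (h : HasValues q n m c τ)
    (i : Fin n) {s : ℕ} (hs : s ≤ m) : (q i (τ i) s).1 < 2 ^ c :=
  Nat.size_le.1 ((Nat.le_add_right _ _).trans (h i s hs).2)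

theorem HasValues.snd_lt {q : ValueOracle} {n m c : ℕ} {τ : Fin n → ℕ} (h : HasValues q n m c τ)
    (i : Fin n) {s : ℕ} (hs : s ≤ m) : (q i (τ i) s).2 < 2 ^ c :=
  Nat.size_le.1 ((Nat.le_add_left _ _).trans (h i s hs).2)

/-- Computes `v_max` as a fraction in the variables `14`, `15`. -/
def maxValueProg : Program :=
  .seq (.set 14 0) <| .seq (.set 15 1) <| .forLt 12 (.cell 0 0) <|
    .seq (.query 16 17 (reg 12) (.cell 10 (reg 12)) (.cell 0 1)) <|
    .ifLe (reg 14 * reg 17) (reg 16 * reg 15) (.seq (.set 14 (reg 16)) (.set 15 (reg 17))) .skip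

/-! ### Correctness of the programs for `v_max` and the rounding unit -/

section

variable {q : ValueOracle} {B n m c : ℕ} {K : Fin n → Finset ℕ} {a b : ℕ} {τ : Fin n → ℕ}

theorem run_maxValueProg {σ : Memory} (hin : HasInput m K a b σ)
    (hτ : ∀ i : Fin n, σ 10 i = τ i) (hq : HasValues q n m c τ) (hn : 0 < n)
    (hv : ∀ i, IsValuation m (profile q τ i)) (hnB : n ≤ B) (hcB : 2 ^ c ≤ B) :
    Run q B maxValueProg σ (n * 6 + 4) fun σ' => ∃ vn vd : ℕ, σ' 14 0 = vn ∧ σ' 15 0 = vd ∧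
      0 < vd ∧ vn < 2 ^ c ∧ vd ≤ 2 ^ c ∧ vMax m (profile q τ) = (vn : ℝ) / vd := by
  have hc1 : 1 ≤ 2 ^ c := Nat.one_le_two_pow
  refine Run.assign_seq 0 0 rfl rfl (by simp) ?_
  refine Run.assign_seq 0 1 rfl rfl (by simp; omega) ?_
  -- The running maximum starts as `0 / 1`, which need not be a value: hence the disjunction at the
  -- end of the invariant and the non-strict bound on `vd`, as `c` may be `0`.
  refine (Run.forLt (T := 4) n (fun i σ => ∃ vn vd : ℕ, σ 14 0 = vn ∧ σ 15 0 = vd ∧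
    0 < vd ∧ vn < 2 ^ c ∧ vd ≤ 2 ^ c ∧ (∀ j : Fin n, (j : ℕ) < i → profile q τ j m ≤
      (vn : ℝ) / vd) ∧
    ((vn : ℝ) / vd = 0 ∨ ∃ j, profile q τ j m = (vn : ℝ) / vd)) hnB rfl ?_ ?_ ?_).mono
    (by omega) ?_
  · intro i σ' hfr _
    have h0 : σ' 0 = σ 0 := by rw [hfr 0 rfl]; simp
    simpa [h0] using hin.players
  · rintro i hi σ' hfr hx ⟨vn, vd, hvn, hvd, hvd0, hvnc, hvdc, hle, hex⟩
    have h0 : σ' 0 = σ 0 := by rw [hfr 0 rfl]; simp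
    have h10 : σ' 10 = σ 10 := by rw [hfr 10 rfl]; simp
    have hτi : σ' 10 i = τ ⟨i, hi⟩ := by rw [h10]; exact hτ ⟨i, hi⟩
    have hfst := hq.fst_lt ⟨i, hi⟩ le_rfl
    have hsnd := hq.snd_lt ⟨i, hi⟩ le_rfl
    have hpos := hq.pos ⟨i, hi⟩ le_rfl
    have hval : profile q τ ⟨i, hi⟩ m =
        ((q i (τ ⟨i, hi⟩) m).1 : ℝ) / ((q i (τ ⟨i, hi⟩) m).2 : ℝ) := rfl
    simp only at hfst hsnd hpos
    have hpos' : (0 : ℝ) < ((q i (τ ⟨i, hi⟩) m).2 : ℝ) := by exact_mod_cast hpos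
    have hvd0' : (0 : ℝ) < vd := by exact_mod_cast hvd0
    refine Run.query_seq (T := 3) i (τ ⟨i, hi⟩) m (by simp [hx])
      (by rw [RExpr.eval_cell i (by simp [hx])]; exact hτi) (by simp [h0, hin.items])
      (by omega) (by omega) ?_
    refine Run.ifLe (fun hg => ?_) (fun hg => ?_)
    · refine Run.assign_seq 0 _ rfl rfl (by simp; omega) ?_
      refine Run.assign 0 _ rfl rfl (by simp; omega) ?_
      refine ⟨(q i (τ ⟨i, hi⟩) m).1, (q i (τ ⟨i, hi⟩) m).2, by simp, by simp, hpos, hfst, hsnd.le,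
        ?_, Or.inr ⟨_, hval⟩⟩
      have hg' : (vn : ℝ) / vd ≤ ((q i (τ ⟨i, hi⟩) m).1 : ℝ) / ((q i (τ ⟨i, hi⟩) m).2 : ℝ) := by
        rw [div_le_div_iff₀ hvd0' hpos']
        simp [hvn, hvd] at hg
        exact_mod_cast hg
      intro j hj
      rcases Nat.lt_succ_iff_lt_or_eq.1 hj with h | h
      · exact (hle j h).trans hg'
      · rw [show j = ⟨i, hi⟩ from Fin.ext h, hval]
    · refine (Run.skip ?_).mono (by omega) fun _ _ h => h
      refine ⟨vn, vd, by simp [hvn], by simp [hvd], hvd0, hvnc, hvdc, ?_, hex⟩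
      have hg' : ((q i (τ ⟨i, hi⟩) m).1 : ℝ) / ((q i (τ ⟨i, hi⟩) m).2 : ℝ) ≤ (vn : ℝ) / vd := by
        rw [div_le_div_iff₀ hpos' hvd0']
        simp [hvn, hvd] at hg
        exact_mod_cast hg.le
      intro j hj
      rcases Nat.lt_succ_iff_lt_or_eq.1 hj with h | h
      · exact hle j h
      · rw [show j = ⟨i, hi⟩ from Fin.ext h, hval]; exact hg'
  · exact ⟨0, 1, by simp, by simp, by omega, by omega, by omega, by simp, by simp⟩
  · rintro σ' - ⟨-, vn, vd, hvn, hvd, hvd0, hvnc, hvdc, hle, hex⟩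
    refine ⟨vn, vd, hvn, hvd, hvd0, hvnc, hvdc, le_antisymm ?_ ?_⟩
    · have : Nonempty (Fin n) := ⟨⟨0, hn⟩⟩
      exact ciSup_le fun j => hle j j.2
    · rcases hex with h | ⟨j, h⟩
      · rw [h]; exact vMax_nonneg hv
      · rw [← h]; exact le_vMax _ j

/-- The expression for `4kn`. -/
def baseExpr : RExpr := 4 * .cell 0 2 * .cell 0 0

/-- The expression for `3n²k²`. -/
def scaleExpr : RExpr := 3 * .cell 0 0 * .cell 0 0 * .cell 0 2 * .cell 0 2

/-- Computes the rounding unit as a fraction in the variables `18`, `19` from `v_max`. -/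
def unitProg : Program :=
  .seq (.set 20 (.cell 0 3 * reg 14)) <| .seq (.set 21 (.cell 0 4 * reg 15 * scaleExpr)) <|
  .seq (.set 18 1) <| .seq (.set 19 1) <|
  .ifLe 1 (reg 20)
    (.seq
      (.whileLe (reg 18 * baseExpr * reg 21) (reg 20) (.set 18 (reg 18 * baseExpr)))
      (.whileLe (reg 20 * reg 19 + 1) (reg 18 * reg 21) (.set 19 (reg 19 * baseExpr))))
    (.set 18 0)

theorem HasInput.eval_baseExpr {σ : Memory} (h : HasInput m K a b σ) :
    baseExpr.eval σ = (4 * maxSteps K * n : ℕ) := by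
  simp [baseExpr, h.players, h.steps]

theorem HasInput.eval_scaleExpr {σ : Memory} (h : HasInput m K a b σ) :
    scaleExpr.eval σ = (3 * n ^ 2 * maxSteps K ^ 2 : ℕ) := by
  simp [scaleExpr, h.players, h.steps]
  ring

/-- Limits the number of iterations of the two loops that search for the exponent. -/
theorem lt_size_of_pow_le {x y p : ℕ} (hx : 2 ≤ x) (h : x ^ p ≤ y) : p < y.size :=
  Nat.lt_size.2 ((Nat.pow_le_pow_left hx p).trans h)

/-- With `x = 4kn` and the threshold written as `(a * vn) / Y`, the first loop raises a numerator `x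
^ p` while its successor is still below the threshold. The second raises a denominator `x ^ r` until
the fraction is below it. The unit is `x ^ (p - r)`. -/
theorem run_unitProg {σ : Memory} (hin : HasInput m K a b σ) {vn vd : ℕ} (hvn : σ 14 0 = vn)
    (hvd : σ 15 0 = vd) (hvd0 : 0 < vd) (hn : 0 < n) (hk : 1 ≤ maxSteps K) (ha : 0 < a)
    (hb : 0 < b) (hB1 : a * vn ≤ B)
    (hB2 : b * vd * (3 * n ^ 2 * maxSteps K ^ 2) * (4 * maxSteps K * n) ≤ B) :
    Run q B unitProg σ (4 * B.size + 7) fun σ' => ∃ dn dd : ℕ, σ' 18 0 = dn ∧ σ' 19 0 = dd ∧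
      0 < dd ∧ roundingUnit n (maxSteps K) ((a : ℝ) / b) ((vn : ℝ) / vd) = (dn : ℝ) / dd := by
  set k := maxSteps K with hkdef
  set x := 4 * k * n with hx
  set Y := b * vd * (3 * n ^ 2 * k ^ 2) with hY
  have hx2 : 2 ≤ x := by have := Nat.mul_pos hk hn; rw [hx, mul_assoc]; omega
  have hY0 : 0 < Y := by positivity
  have hYB : Y ≤ B := le_trans (Nat.le_mul_of_pos_right _ (by omega)) hB2
  have hy : (a : ℝ) / b * ((vn : ℝ) / vd) / (3 * (n : ℝ) ^ 2 * (k : ℝ) ^ 2)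
      = ((a * vn : ℕ) : ℝ) / Y := by
    rw [hY]; push_cast; field_simp
  refine Run.assign_seq 0 (a * vn : ℕ) rfl (by simp [hin.num, hvn])
    (by rw [Int.natAbs_natCast]; exact hB1) ?_
  refine Run.assign_seq 0 (Y : ℕ) rfl ?_ (by rw [Int.natAbs_natCast]; exact hYB) ?_
  · have := (hin.congr (σ' := σ.write 20 0 (a * vn : ℕ)) (by simp) (by simp)
      (by simp)).eval_scaleExpr
    rw [RExpr.eval_mul, this]
    simp [hin.den, hvd, hY, hkdef]
  refine Run.assign_seq 0 1 rfl rfl (by simp; omega) ?_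
  refine Run.assign_seq 0 1 rfl rfl (by simp; omega) ?_
  set σ₁ := (((σ.write 20 0 (a * vn : ℕ)).write 21 0 (Y : ℕ)).write 18 0 1).write 19 0 1 with hσ₁
  have hin₁ : HasInput m K a b σ₁ := hin.congr (by simp [hσ₁]) (by simp [hσ₁]) (by simp [hσ₁])
  have h20 : σ₁ 20 0 = (a * vn : ℕ) := by simp [hσ₁]
  have h21 : σ₁ 21 0 = Y := by simp [hσ₁]
  have h18 : σ₁ 18 0 = 1 := by simp [hσ₁]
  have h19 : σ₁ 19 0 = 1 := by simp [hσ₁]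
  clear_value σ₁
  refine (Run.ifLe (T := B.size * 2 + 1 + (B.size * 2 + 1)) (fun hg => ?_) (fun hg => ?_)).mono
    (by omega) fun _ _ h => h
  · simp only [RExpr.eval_one, eval_reg, h20] at hg
    have hA : 1 ≤ a * vn := by exact_mod_cast hg
    have hvn0 : 0 < vn := Nat.pos_of_ne_zero fun h => by simp [h] at hA
    refine Run.seq (R := fun σ' => ∃ p : ℕ, σ' 18 0 = (x ^ p : ℕ) ∧
      (p = 0 ∨ x ^ p * Y ≤ a * vn) ∧ a * vn < x ^ (p + 1) * Y) ?_ ?_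
    · refine (Run.whileLe (T := 1) (fun j σ' => ∃ p : ℕ, σ' 18 0 = (x ^ p : ℕ) ∧
        (p = 0 ∨ x ^ p * Y ≤ a * vn) ∧ j = (a * vn).size - p) ?_ (a * vn).size
        ⟨0, by simp [h18], Or.inl rfl, rfl⟩).mono ?_ ?_
      · rintro j σ' hfr ⟨p, hp, -, rfl⟩ hg'
        have hin' : HasInput m K a b σ' := hin₁.congr (hfr 0 rfl) (hfr 2 rfl) (hfr 3 rfl)
        simp only [RExpr.eval_mul, eval_reg, hin'.eval_baseExpr, hfr 20 rfl, hfr 21 rfl, h20, h21,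
          hp, ← hx, ← hkdef] at hg'
        have hg'' : x ^ (p + 1) * Y ≤ a * vn := by rw [pow_succ]; exact_mod_cast hg'
        have hle : x ^ (p + 1) ≤ a * vn := (Nat.le_mul_of_pos_right _ hY0).trans hg''
        have hlt := lt_size_of_pow_le hx2 hle
        refine Run.assign 0 (x ^ (p + 1) : ℕ) rfl ?_ (by simpa using hle.trans hB1) ?_
        · simp only [RExpr.eval_mul, eval_reg, hin'.eval_baseExpr, hp, ← hx, ← hkdef]
          rw [pow_succ]; push_cast; ring
        · exact ⟨_, by omega, p + 1, by simp, Or.inr hg'', rfl⟩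
      · have := Nat.size_le_size hB1
        omega
      · rintro σ' hfr ⟨⟨-, p, hp, hp', -⟩, hg'⟩
        have hin' : HasInput m K a b σ' := hin₁.congr (hfr 0 rfl) (hfr 2 rfl) (hfr 3 rfl)
        simp only [RExpr.eval_mul, eval_reg, hin'.eval_baseExpr, hfr 20 rfl, hfr 21 rfl, h20, h21,
          hp, ← hx, ← hkdef] at hg'
        refine ⟨p, hp, hp', ?_⟩
        rw [pow_succ]; exact_mod_cast not_le.1 hg'
    · rintro σ₂ hfr₂ ⟨p, hp, hp', hlt⟩
      have hin₂ : HasInput m K a b σ₂ := hin₁.congr (hfr₂ 0 rfl) (hfr₂ 2 rfl) (hfr₂ 3 rfl)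
      have h20' : σ₂ 20 0 = (a * vn : ℕ) := by rw [hfr₂ 20 rfl, h20]
      have h21' : σ₂ 21 0 = Y := by rw [hfr₂ 21 rfl, h21]
      have h19' : σ₂ 19 0 = 1 := by rw [hfr₂ 19 rfl, h19]
      refine (Run.whileLe (T := 1) (fun j σ' => ∃ r : ℕ, σ' 19 0 = (x ^ r : ℕ) ∧
        a * vn * x ^ r < x ^ (p + 1) * Y ∧ j = Y.size - r) ?_ Y.size
        ⟨0, by simp [h19'], by simpa using hlt, rfl⟩).mono ?_ ?_
      · rintro j σ' hfr ⟨r, hr, -, rfl⟩ hg'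
        have hin' : HasInput m K a b σ' := hin₂.congr (hfr 0 rfl) (hfr 2 rfl) (hfr 3 rfl)
        simp only [RExpr.eval_mul, RExpr.eval_add, RExpr.eval_one, eval_reg, hfr 20 rfl, hfr 21 rfl,
          hfr 18 rfl, h20', h21', hr, hp] at hg'
        have hg'' : a * vn * x ^ r < x ^ p * Y := by exact_mod_cast Int.lt_iff_add_one_le.2 hg'
        -- The second loop runs only if the first did not: otherwise `x ^ p` is already below the
        -- threshold.
        obtain rfl : p = 0 := by
          rcases hp' with h | h
          · exact h
          · exfalso
            have : a * vn ≤ a * vn * x ^ r := Nat.le_mul_of_pos_right _ (by positivity)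
            omega
        have hle : x ^ r ≤ Y := by
          have : x ^ r ≤ a * vn * x ^ r := Nat.le_mul_of_pos_left _ hA
          simp only [pow_zero, one_mul] at hg''
          omega
        have hlt := lt_size_of_pow_le hx2 hle
        -- The last multiplication may overshoot `Y` by a factor `x`, which is the extra factor
        -- `4kn` in `hB2`.
        have hle' : x ^ (r + 1) ≤ B := by
          rw [pow_succ]; exact (Nat.mul_le_mul_right x hle).trans hB2
        refine Run.assign 0 (x ^ (r + 1) : ℕ) rfl ?_ (by simpa using hle') ?_
        · simp only [RExpr.eval_mul, eval_reg, hin'.eval_baseExpr, hr, ← hx, ← hkdef]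
          rw [pow_succ]; push_cast; ring
        · refine ⟨_, by omega, r + 1, by simp, ?_, rfl⟩
          calc a * vn * x ^ (r + 1) = a * vn * x ^ r * x := by ring
            _ < x ^ 0 * Y * x := Nat.mul_lt_mul_of_pos_right hg'' (by omega)
            _ = x ^ (0 + 1) * Y := by ring
      · have := Nat.size_le_size hYB
        omega
      · rintro σ' hfr ⟨⟨-, r, hr, hr', -⟩, hg'⟩
        simp only [RExpr.eval_mul, RExpr.eval_add, RExpr.eval_one, eval_reg, hfr 20 rfl, hfr 21 rfl,
          hfr 18 rfl, h20', h21', hr, hp] at hg'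
        have hg'' : x ^ p * Y ≤ a * vn * x ^ r := by
          rw [← Int.lt_iff_add_one_le, not_lt] at hg'
          exact_mod_cast hg'
        refine ⟨x ^ p, x ^ r, by rw [hfr 18 rfl, hp], hr, by positivity, ?_⟩
        have hx0 : (4 * k * n : ℝ) ≠ 0 := by positivity
        have hxe : ((x : ℕ) : ℝ) = 4 * k * n := by rw [hx]; push_cast; ring
        rw [roundingUnit_eq_of_mem hn hk (p := (p : ℤ) - r)]
        · rw [zpow_sub₀ hx0, ← hxe]; push_cast; rfl
        · rw [hy, zpow_sub₀ hx0, ← hxe, zpow_natCast, zpow_natCast,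
            div_le_div_iff₀ (by positivity) (by positivity)]
          exact_mod_cast hg''
        · rw [hy, show (p : ℤ) - r + 1 = ((p + 1 : ℕ) : ℤ) - r by push_cast; ring,
            zpow_sub₀ hx0, ← hxe, zpow_natCast, zpow_natCast,
            div_lt_div_iff₀ (by positivity) (by positivity)]
          exact_mod_cast hr'
  · simp only [RExpr.eval_one, eval_reg, h20] at hg
    have hvn0 : vn = 0 := by
      by_contra hc
      have : 0 < a * vn := Nat.mul_pos ha (Nat.pos_of_ne_zero hc)
      exact hg (by exact_mod_cast this)
    refine (Run.assign 0 0 rfl rfl (by simp) ?_).mono (by omega) fun _ _ h => h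
    refine ⟨0, 1, by simp, by simp [h19], by omega, ?_⟩
    rw [roundingUnit_of_eq_zero (by simp [hvn0]) hn hk]
    simp

end

/-! ### The allocation program: options of the players -/

/-- The sizes of the options of all players. -/
def optionSizes {n : ℕ} (K : Fin n → Finset ℕ) (i r : ℕ) : ℕ :=
  if h : i < n then optionSize (K ⟨i, h⟩) r else 0

/-- The values of the options of all players. -/
noncomputable def optionValues {n : ℕ} (m : ℕ) (K : Fin n → Finset ℕ) (ε δ : ℝ)
    (v : Fin n → ℕ → ℝ) (i r : ℕ) : ℕ :=
  if h : i < n then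
    rewardedUnits n m (maxSteps K) ε δ (K ⟨i, h⟩) (v ⟨i, h⟩) (optionSize (K ⟨i, h⟩) r)
  else 0

/-- The marginal of the next step in multiples of the rounding unit. -/
def marginalExpr : RExpr :=
  (reg 16 * reg 25 - reg 24 * reg 17) * reg 19 / (reg 17 * reg 25 * reg 18)

/-- The address of option `r` of player `i` in the tables `26` (sizes) and `27` (values), with `i`
in variable `12`. -/
def optionIdx (i r : RExpr) : RExpr := i * (.cell 0 2 + 1) + r

/-- Computes the reward of the player in variable `12` in variable `22`. -/
def rewardProg : Program :=
  .seq (.query 16 17 (reg 12) (.cell 10 (reg 12)) (.cell 0 1)) <|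
  .ifLe (reg 18 * scaleExpr * .cell 0 4 * reg 17) (.cell 0 3 * reg 16 * reg 19)
    (.set 22 (2 * .cell 0 2 * .cell 0 0 * reg 18 / reg 18)) (.set 22 0)

/-- Moves on to the next step of the player in variable `12`. -/
def nextStepProg : Program :=
  .ifLe (reg 13 + 1) (.cell 2 (reg 12))
    (.seq (.set 46 (.cell 3 (reg 12 * .cell 0 2 + reg 13))) <|
      .seq (.query 16 17 (reg 12) (.cell 10 (reg 12)) (reg 46)) <|
      .seq (.set 23 (reg 23 + (marginalExpr + reg 22))) <|
      .seq (.set 24 (reg 16)) (.set 25 (reg 17)))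
    .skip

/-- Fills the tables of options and computes the sum of the largest values in variable `28`. -/
def optionsProg : Program :=
  .seq (.set 28 0) <| .forLt 12 (.cell 0 0) <|
    .seq rewardProg <|
    .seq (.set 23 0) <| .seq (.set 24 0) <| .seq (.set 25 1) <| .seq (.set 46 0) <|
    .seq (.assign 26 (optionIdx (reg 12) 0) 0) <| .seq (.assign 27 (optionIdx (reg 12) 0) 0) <|
    .seq (.forLt 13 (.cell 0 2) <|
      .seq nextStepProg <|
      .seq (.assign 26 (optionIdx (reg 12) (reg 13 + 1)) (reg 46))
        (.assign 27 (optionIdx (reg 12) (reg 13 + 1)) (reg 23))) <|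
    .set 28 (reg 28 + reg 23)

/-- Over common denominators both sides are a quotient of natural numbers. The case `dn = 0` is
included, since both divisions by zero give `0`. -/
theorem fdiv_marginal {x₀ y₀ x₁ y₁ dn dd : ℕ} (hy₀ : 0 < y₀) (hy₁ : 0 < y₁)
    (h : (x₀ : ℝ) / y₀ ≤ (x₁ : ℝ) / y₁) :
    Int.fdiv (((x₁ : ℤ) * y₀ - x₀ * y₁) * dd) ((y₁ : ℤ) * y₀ * dn) =
      (⌊((x₁ : ℝ) / y₁ - (x₀ : ℝ) / y₀) / ((dn : ℝ) / dd)⌋₊ : ℕ) := by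
  rw [div_le_div_iff₀ (by positivity) (by positivity)] at h
  have h' : x₀ * y₁ ≤ x₁ * y₀ := by exact_mod_cast h
  obtain ⟨d, hd⟩ := Nat.exists_eq_add_of_le h'
  have h1 : ((x₁ : ℤ) * y₀ - x₀ * y₁) = d := by
    have : ((x₁ * y₀ : ℕ) : ℤ) = ((x₀ * y₁ + d : ℕ) : ℤ) := by rw [hd]
    push_cast at this
    linarith
  have h2 : (x₁ : ℝ) / y₁ - (x₀ : ℝ) / y₀ = (d : ℝ) / (y₁ * y₀) := by
    have : ((x₁ * y₀ : ℕ) : ℝ) = ((x₀ * y₁ + d : ℕ) : ℝ) := by rw [hd]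
    push_cast at this
    rw [div_sub_div _ _ (by positivity) (by positivity)]
    congr 1
    linarith
  have h3 : (d : ℝ) / (y₁ * y₀) / ((dn : ℝ) / dd) = ((d * dd : ℕ) : ℝ) /
    ((y₁ * y₀ * dn : ℕ) : ℝ) := by
    rw [div_div_div_eq]; push_cast; rfl
  rw [h1, h2, h3, Nat.floor_div_eq_div, Int.fdiv_eq_ediv_of_nonneg _ (by positivity)]
  push_cast
  rfl

/-- Row-major addresses increase from row to row, so a write to a new entry leaves the earlier ones
alone. -/
theorem flat_lt {S i i' r r' : ℕ} (hi : i' < i) (hr : r' < S) : i' * S + r' < i * S + r := by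
  have : (i' + 1) * S ≤ i * S := Nat.mul_le_mul_right _ hi
  rw [add_mul, one_mul] at this
  omega

/-! ### Correctness of the option tables -/

section

variable {q : ValueOracle} {B n m c : ℕ} {K : Fin n → Finset ℕ} {a b : ℕ} {τ : Fin n → ℕ}

theorem HasInput.eval_optionIdx {σ : Memory} (h : HasInput m K a b σ) {e e' : RExpr} {i r : ℕ}
    (he : e.eval σ = i) (he' : e'.eval σ = r) :
    (optionIdx e e').eval σ = (i * (maxSteps K + 1) + r : ℕ) := by
  simp [optionIdx, h.steps, he, he']

theorem run_rewardProg {σ : Memory} (hin : HasInput m K a b σ) {i : ℕ} (hi : i < n)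
    (hx : σ 12 0 = i) (hτ : σ 10 i = τ ⟨i, hi⟩) (hq : HasValues q n m c τ) {dn dd : ℕ}
    (hdn : σ 18 0 = dn) (hdd : σ 19 0 = dd) (hdd0 : 0 < dd) (ha : 0 < a) (hb : 0 < b)
    (hcB : 2 ^ c ≤ B) (hkB : 2 * maxSteps K * n ≤ B) :
    Run q B rewardProg σ 3 fun σ' => σ' 22 0 =
      (rewardUnits n m (maxSteps K) ((a : ℝ) / b) ((dn : ℝ) / dd) (profile q τ ⟨i, hi⟩) : ℕ) := by
  have hpos := hq.pos ⟨i, hi⟩ le_rfl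
  have hfst := hq.fst_lt ⟨i, hi⟩ le_rfl
  have hsnd := hq.snd_lt ⟨i, hi⟩ le_rfl
  simp only at hfst hsnd hpos
  set x := (q i (τ ⟨i, hi⟩) m).1 with hxdef
  set y := (q i (τ ⟨i, hi⟩) m).2 with hydef
  have hval : profile q τ ⟨i, hi⟩ m = (x : ℝ) / y := rfl
  -- Membership in `TOP`, cleared of denominators for the integer test.
  have hiff : 3 * ((dn : ℝ) / dd) * (n : ℝ) ^ 2 * (maxSteps K : ℝ) ^ 2 / ((a : ℝ) / b)
      ≤ profile q τ ⟨i, hi⟩ m ↔ dn * (3 * n ^ 2 * maxSteps K ^ 2) * b * y ≤ a * x * dd := by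
    have h1 : 3 * ((dn : ℝ) / dd) * (n : ℝ) ^ 2 * (maxSteps K : ℝ) ^ 2 / ((a : ℝ) / b)
        = ((dn * (3 * n ^ 2 * maxSteps K ^ 2) * b : ℕ) : ℝ) / ((a * dd : ℕ) : ℝ) := by
      push_cast; field_simp
    rw [hval, h1, div_le_div_iff₀ (by positivity) (by positivity)]
    norm_cast
    rw [show x * (a * dd) = a * x * dd by ring]
  refine Run.query_seq (T := 2) i (τ ⟨i, hi⟩) m (by simp [hx])
    (by rw [RExpr.eval_cell i (by simp [hx]), hτ]) (by simp [hin.items])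
    (by omega) (by omega) ?_
  set σ₁ := (σ.write 16 0 x).write 17 0 y with hσ₁
  have hin₁ : HasInput m K a b σ₁ := hin.congr (by simp [hσ₁]) (by simp [hσ₁]) (by simp [hσ₁])
  have h18 : σ₁ 18 0 = dn := by simp [hσ₁, hdn]
  have h19 : σ₁ 19 0 = dd := by simp [hσ₁, hdd]
  have h16 : σ₁ 16 0 = x := by simp [hσ₁]
  have h17 : σ₁ 17 0 = y := by simp [hσ₁]
  clear_value σ₁
  have hcond : (reg 18 * scaleExpr * .cell 0 4 * reg 17).eval σ₁
      ≤ (.cell 0 3 * reg 16 * reg 19 : RExpr).eval σ₁ ↔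
      dn * (3 * n ^ 2 * maxSteps K ^ 2) * b * y ≤ a * x * dd := by
    simp only [RExpr.eval_mul, hin₁.eval_scaleExpr, eval_reg, h16, h17, h18, h19,
      RExpr.eval_cell_ofNat, hin₁.num, hin₁.den]
    norm_cast
  have hδ : 0 < (dn : ℝ) / dd ↔ dn ≠ 0 := by
    rw [div_pos_iff_of_pos_right (by positivity), Nat.cast_pos, Nat.pos_iff_ne_zero]
  refine Run.ifLe (fun hg => ?_) (fun hg => ?_)
  · rw [hcond] at hg
    -- The program multiplies and divides by `dn`: the reward is unchanged for `dn ≠ 0`, while `0 /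
    -- 0 = 0` gives the required reward `0` for `δ = 0`.
    rcases eq_or_ne dn 0 with h | h
    · refine Run.assign 0 0 rfl (by simp [h18, h]) (by simp) ?_
      rw [rewardUnits, if_neg fun hc => hδ.1 hc.1 h]
      simp
    · refine Run.assign 0 (2 * maxSteps K * n : ℕ) rfl ?_
        (by rw [Int.natAbs_natCast]; exact hkB) ?_
      · simp only [RExpr.eval_div, RExpr.eval_mul, RExpr.eval_ofNat, RExpr.eval_cell_ofNat,
          RExpr.eval_cell_zero, eval_reg, hin₁.steps, hin₁.players, h18]
        rw [Int.mul_fdiv_cancel _ (by exact_mod_cast h)]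
        push_cast; rfl
      · rw [rewardUnits, if_pos ⟨hδ.2 h, hiff.2 hg⟩]
        simp
  · rw [hcond] at hg
    refine Run.assign 0 0 rfl rfl (by simp) ?_
    rw [rewardUnits, if_neg fun hc => hg (hiff.1 hc.2)]
    simp

/-- The state of the loop over the steps of a player with valuation `v` after `r` steps. -/
def StepState (B n m k : ℕ) (ε δ : ℝ) (K : Finset ℕ) (v : ℕ → ℝ) (r : ℕ) (σ : Memory) : Prop :=
  σ 46 0 = optionSize K r ∧ σ 23 0 = (rewardedUnits n m k ε δ K v (optionSize K r) : ℕ) ∧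
    ∃ x y : ℕ, σ 24 0 = x ∧ σ 25 0 = y ∧ 0 < y ∧ x ≤ B ∧ y ≤ B ∧
      v (optionSize K r) = (x : ℝ) / y

theorem run_nextStepProg {σ : Memory} (hin : HasInput m K a b σ) {i r : ℕ} (hi : i < n)
    (hx : σ 12 0 = i) (hr : σ 13 0 = r) (hτ : σ 10 i = τ ⟨i, hi⟩) (hq : HasValues q n m c τ)
    (hv : IsValuation m (profile q τ ⟨i, hi⟩)) (hmd : IsMinded m (K ⟨i, hi⟩) (profile q τ ⟨i, hi⟩))
    {ε : ℝ} {dn dd U : ℕ} (hdn : σ 18 0 = dn) (hdd : σ 19 0 = dd)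
    (hrew : σ 22 0 = (rewardUnits n m (maxSteps K) ε ((dn : ℝ) / dd) (profile q τ ⟨i, hi⟩) : ℕ))
    (hU : ∀ s ≤ m, rewardedUnits n m (maxSteps K) ε ((dn : ℝ) / dd) (K ⟨i, hi⟩)
      (profile q τ ⟨i, hi⟩) s ≤ U)
    (hUB : U ≤ B) (hcB : 2 ^ c ≤ B) (hmB : m ≤ B)
    (hst : StepState B n m (maxSteps K) ε ((dn : ℝ) / dd) (K ⟨i, hi⟩) (profile q τ ⟨i, hi⟩) r σ) :
    Run q B nextStepProg σ 6 fun σ' => StepState B n m (maxSteps K) ε ((dn : ℝ) / dd) (K ⟨i, hi⟩)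
      (profile q τ ⟨i, hi⟩) (r + 1) σ' := by
  obtain ⟨h46, h23, x₀, y₀, h24, h25, hy₀, hx₀B, hy₀B, hval₀⟩ := hst
  have hcard := hin.card ⟨i, hi⟩
  simp only at hcard
  refine Run.ifLe (T := 5) (fun hg => ?_) (fun hg => ?_)
  · rw [RExpr.eval_cell i (by simp [hx]), hcard] at hg
    simp only [RExpr.eval_add, eval_reg, hr, RExpr.eval_one] at hg
    have hrK : r < (K ⟨i, hi⟩).card := by exact_mod_cast hg
    have h0 := zero_notMem_of_isMinded hmd
    set s := optionSize (K ⟨i, hi⟩) (r + 1) with hs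
    have hsm : s ≤ m := (Finset.mem_Icc.1 (hmd.1 (optionSize_mem hrK))).2
    have hpos := hq.pos ⟨i, hi⟩ hsm
    have hfst := hq.fst_lt ⟨i, hi⟩ hsm
    have hsnd := hq.snd_lt ⟨i, hi⟩ hsm
    simp only at hfst hsnd hpos
    have hval : profile q τ ⟨i, hi⟩ s = ((q i (τ ⟨i, hi⟩) s).1 : ℝ) / (q i (τ ⟨i, hi⟩) s).2 := rfl
    refine Run.assign_seq (T := 4) 0 s rfl ?_ (by simpa using hsm.trans hmB) ?_
    · rw [RExpr.eval_cell (i * maxSteps K + r) (by simp [hx, hr, hin.steps])]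
      exact hin.size ⟨i, hi⟩ r hrK
    refine Run.query_seq (T := 3) i (τ ⟨i, hi⟩) s (by simp [hx])
      (by rw [RExpr.eval_cell i (by simp [hx])]; simpa using hτ) (by simp) (by omega) (by omega) ?_
    set x₁ := (q i (τ ⟨i, hi⟩) s).1
    set y₁ := (q i (τ ⟨i, hi⟩) s).2
    have hsucc := rewardedUnits_option_succ (n := n) (k := maxSteps K) (ε := ε)
      (δ := (dn : ℝ) / dd) hv hmd hrK
    have hle := hv.2 _ _ (optionSize_lt_succ h0 hrK).le hsm
    rw [hval₀, hval] at hle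
    have hfl := fdiv_marginal (dn := dn) (dd := dd) hy₀ hpos hle
    rw [← hval, ← hval₀] at hfl
    refine Run.assign_seq (T := 2) 0 (rewardedUnits n m (maxSteps K) ε ((dn : ℝ) / dd) (K ⟨i, hi⟩)
      (profile q τ ⟨i, hi⟩) s : ℕ) rfl ?_ (by simpa using (hU s hsm).trans hUB) ?_
    · rw [hsucc]
      simp [marginalExpr, h23, h24, h25, hdn, hdd, hrew, hfl, hs]
    refine Run.assign_seq (T := 1) 0 x₁ rfl (by simp) (by simp; omega) ?_
    refine Run.assign 0 y₁ rfl (by simp) (by simp; omega) ?_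
    exact ⟨by simp [← hs], by simp [← hs], x₁, y₁, by simp, by simp, hpos, by omega, by omega, hval⟩
  · rw [RExpr.eval_cell i (by simp [hx]), hcard] at hg
    simp only [RExpr.eval_add, eval_reg, hr, RExpr.eval_one] at hg
    -- No steps are left, so the last option is repeated and the state stays as it is; every player
    -- thus has exactly `k + 1` options.
    have hrK : (K ⟨i, hi⟩).card ≤ r := by
      rw [not_le] at hg; exact_mod_cast Int.lt_add_one_iff.1 hg
    refine (Run.skip ?_).mono (by omega) fun _ _ h => h
    unfold StepState
    rw [optionSize_succ_of_le hrK]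
    exact ⟨h46, h23, x₀, y₀, h24, h25, hy₀, hx₀B, hy₀B, hval₀⟩

/-- The tables `26` and `27` hold the options of the players before `i` and the options of player
`i` before `R`. -/
def HasOptions (k : ℕ) (κ U : ℕ → ℕ → ℕ) (i R : ℕ) (σ : Memory) : Prop :=
  ∀ j r, r ≤ k → (j < i ∨ j = i ∧ r < R) →
    σ 26 (j * (k + 1) + r) = κ j r ∧ σ 27 (j * (k + 1) + r) = U j r

theorem HasOptions.write {k : ℕ} {κ U : ℕ → ℕ → ℕ} {i R : ℕ} {σ : Memory}
    (h : HasOptions k κ U i R σ) :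
    HasOptions k κ U i (R + 1) ((σ.write 26 (i * (k + 1) + R : ℕ) (κ i R : ℕ)).write 27
      (i * (k + 1) + R : ℕ) (U i R : ℕ)) := by
  intro j r hr hj
  by_cases hjr : j = i ∧ r = R
  · obtain ⟨rfl, rfl⟩ := hjr
    simp
  · have hlt : j < i ∨ j = i ∧ r < R := by omega
    have hne : j * (k + 1) + r ≠ i * (k + 1) + R := by
      rcases hlt with h1 | ⟨rfl, h1⟩
      · exact (flat_lt h1 (by omega)).ne
      · omega
    simpa [Memory.write_idx_ne hne] using h j r hr hlt

theorem HasOptions.congr {k : ℕ} {κ U : ℕ → ℕ → ℕ} {i R : ℕ} {σ σ' : Memory}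
    (h : HasOptions k κ U i R σ) (h26 : σ' 26 = σ 26) (h27 : σ' 27 = σ 27) :
    HasOptions k κ U i R σ' := by
  unfold HasOptions
  rw [h26, h27]
  exact h

theorem run_optionsProg {σ : Memory} (hin : HasInput m K a b σ)
    (hτ : ∀ i : Fin n, σ 10 i = τ i) (hq : HasValues q n m c τ)
    (hv : ∀ i, IsValuation m (profile q τ i)) (hmd : ∀ i, IsMinded m (K i) (profile q τ i))
    {ε : ℝ} (hε : ε = (a : ℝ) / b) {dn dd U : ℕ} (hdn : σ 18 0 = dn) (hdd : σ 19 0 = dd)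
    (hdd0 : 0 < dd) (ha : 0 < a) (hb : 0 < b)
    (hU : ∀ i, ∀ s ≤ m, rewardedUnits n m (maxSteps K) ε ((dn : ℝ) / dd) (K i)
      (profile q τ i) s ≤ U)
    (hUB : n * U ≤ B) (hcB : 2 ^ c ≤ B) (hmB : m ≤ B) (hkB : 2 * maxSteps K * n ≤ B)
    (hkB' : maxSteps K ≤ B) (hnB : n ≤ B) :
    Run q B optionsProg σ (n * (maxSteps K * 10 + 14) + 3) fun σ' =>
      HasOptions (maxSteps K) (optionSizes K)
        (optionValues m K ε ((dn : ℝ) / dd) (profile q τ)) n 0 σ' ∧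
      σ' 28 0 = (∑ j ∈ Finset.range n, optionValues m K ε ((dn : ℝ) / dd) (profile q τ) j
        (maxSteps K) : ℕ) := by
  set k := maxSteps K with hk
  set OU := optionValues m K ε ((dn : ℝ) / dd) (profile q τ) with hOU
  have hB1 : 1 ≤ B := le_trans Nat.one_le_two_pow hcB
  have hsumB : ∀ i ≤ n, ∑ j ∈ Finset.range i, OU j k ≤ B := by
    intro i hi
    calc ∑ j ∈ Finset.range i, OU j k ≤ ∑ j ∈ Finset.range i, U := by
          refine Finset.sum_le_sum fun j hj => ?_
          have hj' : j < n := (Finset.mem_range.1 hj).trans_le hi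
          simp only [hOU, optionValues, hj', dite_true]
          exact hU _ _ (optionSize_le (fun x hx => (Finset.mem_Icc.1 ((hmd _).1 hx)).2) _)
      _ = i * U := by simp
      _ ≤ B := (Nat.mul_le_mul_right _ hi).trans hUB
  refine Run.assign_seq 0 0 rfl rfl (by simp) ?_
  refine (Run.forLt (T := k * 10 + 12) n
    (fun i σ => HasOptions k (optionSizes K) OU i 0 σ ∧
      σ 28 0 = (∑ j ∈ Finset.range i, OU j k : ℕ)) hnB rfl ?_ ?_ ?_).mono
    (le_of_eq (by ring)) ?_
  · intro i σ' hfr _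
    rw [RExpr.eval_cell_zero, hfr 0 rfl, Memory.write_ne (by decide), hin.players]
  · rintro i hi σ₁ hfr hx ⟨hopt, hW⟩
    have h0 : σ₁ 0 = σ 0 := by rw [hfr 0 rfl]; simp
    have h2 : σ₁ 2 = σ 2 := by rw [hfr 2 rfl]; simp
    have h3 : σ₁ 3 = σ 3 := by rw [hfr 3 rfl]; simp
    have h10 : σ₁ 10 = σ 10 := by rw [hfr 10 rfl]; simp
    have h18 : σ₁ 18 = σ 18 := by rw [hfr 18 rfl]; simp
    have h19 : σ₁ 19 = σ 19 := by rw [hfr 19 rfl]; simp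
    have hin₁ : HasInput m K a b σ₁ := hin.congr h0 h2 h3
    have hτ₁ : σ₁ 10 i = τ ⟨i, hi⟩ := by rw [h10]; exact hτ ⟨i, hi⟩
    have hUB' : U ≤ B := (Nat.le_mul_of_pos_left _ (by omega)).trans hUB
    have hsize : ∀ r, optionSizes K i r = optionSize (K ⟨i, hi⟩) r := fun r => by
      simp [optionSizes, hi]
    have hvalue : ∀ r, OU i r = rewardedUnits n m k ε ((dn : ℝ) / dd) (K ⟨i, hi⟩)
        (profile q τ ⟨i, hi⟩) (optionSize (K ⟨i, hi⟩) r) := fun r => by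
      simp [hOU, optionValues, hi, hk]
    -- Option `0` is the empty bundle, and `0` is never a step.
    have hvalue0 : OU i 0 = 0 := by
      rw [hvalue, optionSize_zero, rewardedUnits]
      refine Finset.sum_eq_zero fun x hx => ?_
      have hx' := Finset.mem_filter.1 hx
      exact absurd (Nat.le_zero.1 hx'.2 ▸ hx'.1) (zero_notMem_of_isMinded (hmd ⟨i, hi⟩))
    refine (Run.seq (T' := k * 10 + 9) (run_rewardProg hin₁ hi hx hτ₁ hq (h18 ▸ hdn)
      (h19 ▸ hdd) hdd0 ha hb hcB
      hkB) ?_).mono (by omega) fun _ _ h => h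
    intro σ₂ hfr₂ hrew
    rw [← hε] at hrew
    have hin₂ : HasInput m K a b σ₂ := hin₁.congr (hfr₂ 0 rfl) (hfr₂ 2 rfl) (hfr₂ 3 rfl)
    have hx₂ : σ₂ 12 0 = i := by rw [hfr₂ 12 rfl, hx]
    refine Run.assign_seq (T := k * 10 + 8) 0 0 rfl rfl (by simp) ?_
    refine Run.assign_seq (T := k * 10 + 7) 0 0 rfl rfl (by simp) ?_
    refine Run.assign_seq (T := k * 10 + 6) 0 1 rfl rfl (by simpa using hB1) ?_
    refine Run.assign_seq (T := k * 10 + 5) 0 0 rfl rfl (by simp) ?_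
    refine Run.assign_seq (T := k * 10 + 4) (i * (k + 1) + 0) 0 ?_ rfl (by simp) ?_
    · exact (hin₂.congr (by simp) (by simp) (by simp)).eval_optionIdx (by simp [hx₂]) rfl
    refine Run.assign_seq (T := k * 10 + 3) (i * (k + 1) + 0) 0 ?_ rfl (by simp) ?_
    · exact (hin₂.congr (by simp) (by simp) (by simp)).eval_optionIdx (by simp [hx₂]) rfl
    set σ₃ := ((((((σ₂.write 23 0 0).write 24 0 0).write 25 0 1).write 46 0 0).write 26
      (i * (k + 1) + 0) 0).write 27 (i * (k + 1) + 0) 0) with hσ₃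
    have hin₃ : HasInput m K a b σ₃ := hin₂.congr (by simp [hσ₃]) (by simp [hσ₃]) (by simp [hσ₃])
    have hx₃ : σ₃ 12 0 = i := by simp [hσ₃, hx₂]
    have hτ₃ : σ₃ 10 i = τ ⟨i, hi⟩ := by simp [hσ₃, hfr₂ 10 rfl, hτ₁]
    have h18₃ : σ₃ 18 0 = dn := by simp [hσ₃, hfr₂ 18 rfl, h18, hdn]
    have h19₃ : σ₃ 19 0 = dd := by simp [hσ₃, hfr₂ 19 rfl, h19, hdd]
    have h22₃ : σ₃ 22 0 = (rewardUnits n m k ε ((dn : ℝ) / dd) (profile q τ ⟨i, hi⟩) : ℕ) := by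
      simpa [hσ₃] using hrew
    have h28₃ : σ₃ 28 0 = (∑ j ∈ Finset.range i, OU j k : ℕ) := by
      rw [← hW, ← hfr₂ 28 rfl]; simp [hσ₃]
    have hst₃ : StepState B n m k ε ((dn : ℝ) / dd) (K ⟨i, hi⟩) (profile q τ ⟨i, hi⟩) 0 σ₃ := by
      refine ⟨by simp [hσ₃, optionSize_zero], ?_, 0, 1, by simp [hσ₃], by simp [hσ₃], by omega,
        by omega, hB1, ?_⟩
      · rw [← hvalue, hvalue0]; simp [hσ₃]
      · simpa [optionSize_zero] using (hv ⟨i, hi⟩).1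
    have hopt₃ : HasOptions k (optionSizes K) OU i 1 σ₃ := by
      have := ((hopt.congr (hfr₂ 26 rfl) (hfr₂ 27 rfl)).write)
      rw [hvalue0, hsize, optionSize_zero, Nat.cast_zero] at this
      refine this.congr ?_ ?_
      · funext j
        by_cases hj : j = i * (k + 1) + 0
        · subst hj; simp [hσ₃]
        · simp only [hσ₃, Memory.write_ne (show 26 ≠ 27 by decide), Memory.write_idx_ne hj,
            Memory.write_ne (show 26 ≠ 46 by decide), Memory.write_ne (show 26 ≠ 25 by decide),
            Memory.write_ne (show 26 ≠ 24 by decide), Memory.write_ne (show 26 ≠ 23 by decide)]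
      · funext j
        by_cases hj : j = i * (k + 1) + 0
        · subst hj; simp [hσ₃]
        · simp only [hσ₃, Memory.write_idx_ne hj, Memory.write_ne (show 27 ≠ 26 by decide),
            Memory.write_ne (show 27 ≠ 46 by decide), Memory.write_ne (show 27 ≠ 25 by decide),
            Memory.write_ne (show 27 ≠ 24 by decide), Memory.write_ne (show 27 ≠ 23 by decide)]
    clear_value σ₃
    refine Run.seq (T := k * 10 + 2) (T' := 1) (R := fun σ' => HasOptions k (optionSizes K) OU i
      (k + 1) σ' ∧
      StepState B n m k ε ((dn : ℝ) / dd) (K ⟨i, hi⟩) (profile q τ ⟨i, hi⟩) k σ') ?_ ?_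
    · refine (Run.forLt (T := 8) k (fun r σ' => HasOptions k (optionSizes K) OU i (r + 1) σ' ∧
        StepState B n m k ε ((dn : ℝ) / dd) (K ⟨i, hi⟩) (profile q τ ⟨i, hi⟩) r σ')
        hkB' rfl ?_ ?_ ?_).mono le_rfl fun _ _ h => h.2
      · intro r σ' hfr' _
        rw [RExpr.eval_cell_ofNat, hfr' 0 rfl, hin₃.steps]
      · rintro r hr σ₄ hfr₄ hr₄ ⟨hopt₄, hst₄⟩
        have hin₄ : HasInput m K a b σ₄ := hin₃.congr (hfr₄ 0 rfl) (hfr₄ 2 rfl) (hfr₄ 3 rfl)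
        have hx₄ : σ₄ 12 0 = i := by rw [hfr₄ 12 rfl, hx₃]
        refine Run.seq (T := 6) (T' := 2) (run_nextStepProg hin₄ hi hx₄ hr₄
          (by rw [hfr₄ 10 rfl, hτ₃]) hq
          (hv _) (hmd _) (by rw [hfr₄ 18 rfl, h18₃]) (by rw [hfr₄ 19 rfl, h19₃])
          (by rw [hfr₄ 22 rfl, h22₃]) (hU ⟨i, hi⟩) hUB' hcB hmB hst₄) ?_
        intro σ₅ hfr₅ hst₅
        have hin₅ : HasInput m K a b σ₅ := hin₄.congr (hfr₅ 0 rfl) (hfr₅ 2 rfl) (hfr₅ 3 rfl)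
        have hx₅ : σ₅ 12 0 = i := by rw [hfr₅ 12 rfl, hx₄]
        have hr₅ : σ₅ 13 0 = r := by rw [hfr₅ 13 rfl, hr₄]
        have hopt₅ := hopt₄.congr (hfr₅ 26 rfl) (hfr₅ 27 rfl)
        have hsm : optionSize (K ⟨i, hi⟩) (r + 1) ≤ m :=
          optionSize_le (fun x hx => (Finset.mem_Icc.1 ((hmd _).1 hx)).2) _
        refine Run.assign_seq (T := 1) (i * (k + 1) + (r + 1)) (optionSizes K i (r + 1) : ℕ) ?_ ?_
          ?_ ?_
        · exact hin₅.eval_optionIdx (by simp [hx₅]) (by simp [hr₅])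
        · rw [hsize]; exact hst₅.1
        · rw [hsize, Int.natAbs_natCast]; exact hsm.trans hmB
        refine Run.assign (i * (k + 1) + (r + 1)) (OU i (r + 1) : ℕ) ?_ ?_ ?_ ⟨?_, ?_⟩
        · exact (hin₅.congr (by simp) (by simp) (by simp)).eval_optionIdx (by simp [hx₅])
            (by simp [hr₅])
        · rw [hvalue]; simpa using hst₅.2.1
        · rw [hvalue, Int.natAbs_natCast]; exact (hU _ _ hsm).trans hUB'
        · exact hopt₅.write.congr (by simp) (by simp)
        · simpa [StepState] using hst₅
      · exact ⟨hopt₃.congr (by simp) (by simp), by simpa [StepState] using hst₃⟩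
    · rintro σ₄ hfr₄ ⟨hopt₄, hst₄⟩
      have hsum : ((∑ j ∈ Finset.range (i + 1), OU j k : ℕ) : ℤ) =
          (∑ j ∈ Finset.range i, OU j k : ℕ) + (OU i k : ℕ) := by
        rw [Finset.sum_range_succ]; push_cast; rfl
      refine Run.assign 0 (∑ j ∈ Finset.range (i + 1), OU j k : ℕ) rfl ?_ ?_ ⟨?_, by simp⟩
      · rw [hsum, hvalue, ← hst₄.2.1, RExpr.eval_add, eval_reg, eval_reg, hfr₄ 28 rfl, h28₃]
      · rw [Int.natAbs_natCast]; exact hsumB _ hi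
      -- A complete row of `k + 1` options for player `i` is the same as no options yet for player
      -- `i + 1`.
      · intro j r hr hj
        have h1 : j < i ∨ j = i ∧ r < k + 1 := by omega
        simpa using hopt₄ j r hr h1
  · refine ⟨?_, by simp⟩
    intro j r hr hj
    omega
  · rintro σ' - ⟨-, h1, h2⟩
    exact ⟨h1, h2⟩

end

/-! ### The allocation program: dynamic program -/

/-- The address of the entry for player `i` and value `w` in the table `29` of minimal sizes. -/
def sizeIdx (i w : RExpr) : RExpr := i * (reg 28 + 1) + w

/-- The size needed if player `i` takes option `r` and the total value is `w`. -/
def candidateExpr (i r w : RExpr) : RExpr :=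
  .cell 29 (sizeIdx i (w - .cell 27 (optionIdx i r))) + .cell 26 (optionIdx i r)

/-- Fills the table of minimal sizes. -/
def tableProg : Program :=
  .seq (.forLt 30 (reg 28 + 1) (.assign 29 (reg 30) (.cell 0 1 + 1))) <|
  .seq (.assign 29 0 0) <|
  .forLt 12 (.cell 0 0) <| .forLt 30 (reg 28 + 1) <|
    .seq (.set 31 (.cell 0 1 + 1)) <|
    .seq (.forLt 13 (.cell 0 2 + 1) <|
      .ifLe (.cell 27 (optionIdx (reg 12) (reg 13))) (reg 30)
        (.ifLe (candidateExpr (reg 12) (reg 13) (reg 30)) (reg 31)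
          (.set 31 (candidateExpr (reg 12) (reg 13) (reg 30))) .skip)
        .skip)
    (.assign 29 (sizeIdx (reg 12 + 1) (reg 30)) (reg 31))

/-- Finds the largest value that can be attained. -/
def bestValueProg : Program :=
  .seq (.set 32 0) <| .forLt 30 (reg 28 + 1) <|
    .ifLe (.cell 29 (sizeIdx (.cell 0 0) (reg 30))) (.cell 0 1) (.set 32 (reg 30)) .skip

/-- Finds the last option of the player in variable `34` that attains the minimal size. -/
def choiceProg : Program :=
  .seq (.set 33 0) <| .forLt 13 (.cell 0 2 + 1) <|
    .ifLe (.cell 27 (optionIdx (reg 34) (reg 13))) (reg 32)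
      (.ifLe (candidateExpr (reg 34) (reg 13) (reg 32)) (.cell 29 (sizeIdx (reg 34 + 1) (reg 32)))
        (.set 33 (reg 13)) .skip)
      .skip

/-- Computes the allocation in array `11`. -/
def backtrackProg : Program :=
  .forLt 12 (.cell 0 0) <|
    .seq (.set 34 (.cell 0 0 - (reg 12 + 1))) <| .seq choiceProg <|
    .seq (.assign 11 (reg 34) (.cell 26 (optionIdx (reg 34) (reg 33))))
      (.set 32 (reg 32 - .cell 27 (optionIdx (reg 34) (reg 33))))

/-- The table `29` holds the minimal sizes of the first `j < i` players and those of the first `i`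
players for values below `w₀`. -/
def HasSizes (m k W : ℕ) (κ U : ℕ → ℕ → ℕ) (i w₀ : ℕ) (σ : Memory) : Prop :=
  ∀ j w, w ≤ W → (j < i ∨ j = i ∧ w < w₀) → σ 29 (j * (W + 1) + w) = minSize m k κ U j w

theorem HasSizes.congr {m k W : ℕ} {κ U : ℕ → ℕ → ℕ} {i w₀ : ℕ} {σ σ' : Memory}
    (h : HasSizes m k W κ U i w₀ σ) (h29 : σ' 29 = σ 29) : HasSizes m k W κ U i w₀ σ' := by
  unfold HasSizes
  rw [h29]
  exact h

theorem HasSizes.write {m k W : ℕ} {κ U : ℕ → ℕ → ℕ} {i w₀ : ℕ} {σ : Memory}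
    (h : HasSizes m k W κ U i w₀ σ) :
    HasSizes m k W κ U i (w₀ + 1) (σ.write 29 (i * (W + 1) + w₀) (minSize m k κ U i w₀ : ℕ)) := by
  intro j w hw hj
  by_cases hjw : j = i ∧ w = w₀
  · obtain ⟨rfl, rfl⟩ := hjw
    simp
  · have hlt : j < i ∨ j = i ∧ w < w₀ := by omega
    have hne : j * (W + 1) + w ≠ i * (W + 1) + w₀ := by
      rcases hlt with h1 | ⟨rfl, h1⟩
      · exact (flat_lt h1 (by omega)).ne
      · omega
    rw [Memory.write_idx_ne hne]
    exact h j w hw hlt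

/-! ### Correctness of the dynamic program and of the allocation program -/

section

variable {q : ValueOracle} {B n m W : ℕ} {K : Fin n → Finset ℕ} {a b : ℕ} {κ U : ℕ → ℕ → ℕ}

theorem HasOptions.eval {σ : Memory} (hin : HasInput m K a b σ)
    (ho : HasOptions (maxSteps K) κ U n 0 σ) {ei er : RExpr} {i r : ℕ} (hei : ei.eval σ = i)
    (her : er.eval σ = r) (hi : i < n) (hr : r ≤ maxSteps K) :
    (RExpr.cell 26 (optionIdx ei er)).eval σ = κ i r ∧
      (RExpr.cell 27 (optionIdx ei er)).eval σ = U i r := by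
  rw [RExpr.eval_cell _ (hin.eval_optionIdx hei her), RExpr.eval_cell _
    (hin.eval_optionIdx hei her)]
  exact ho i r hr (Or.inl hi)

theorem eval_sizeIdx {σ : Memory} (hW : σ 28 0 = W) {ei ew : RExpr} {i w : ℕ}
    (hei : ei.eval σ = i) (hew : ew.eval σ = w) :
    (sizeIdx ei ew).eval σ = (i * (W + 1) + w : ℕ) := by
  simp [sizeIdx, hW, hei, hew]

/-- The entry read lies in row `i < i'`, which is already filled, and `U i r ≤ w` keeps its column
within the row. -/
theorem eval_candidateExpr {σ : Memory} (hin : HasInput m K a b σ) (hW : σ 28 0 = W)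
    (ho : HasOptions (maxSteps K) κ U n 0 σ) {i' w₀ : ℕ}
    (hs : HasSizes m (maxSteps K) W κ U i' w₀ σ) {ei er ew : RExpr} {i r w : ℕ}
    (hei : ei.eval σ = i) (her : er.eval σ = r) (hew : ew.eval σ = w) (hi : i < n) (hii : i < i')
    (hr : r ≤ maxSteps K) (hw : w ≤ W) (hU : U i r ≤ w) :
    (candidateExpr ei er ew).eval σ = (minSize m (maxSteps K) κ U i (w - U i r) + κ i r : ℕ) := by
  obtain ⟨h1, h2⟩ := ho.eval hin hei her hi hr
  have h3 : (ew - .cell 27 (optionIdx ei er)).eval σ = (w - U i r : ℕ) := by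
    rw [RExpr.eval_sub, h2, hew]; omega
  rw [candidateExpr, RExpr.eval_add, h1, RExpr.eval_cell _ (eval_sizeIdx hW hei h3),
    hs i _ (by omega) (Or.inl hii)]
  push_cast; rfl

/-- Rows are numbered by how many players they cover. Row `0` is `m + 1` except for a `0` at value
`0`; row `i + 1` needs only row `i`, and the innermost loop runs through the recursion of
`minSizeStep`. -/
theorem run_tableProg {σ : Memory} (hin : HasInput m K a b σ) (hW : σ 28 0 = W)
    (ho : HasOptions (maxSteps K) κ U n 0 σ) (hmB : m + 1 ≤ B) (hnB : n ≤ B) (hWB : W + 1 ≤ B)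
    (hkB : maxSteps K + 1 ≤ B) :
    Run q B tableProg σ ((W + 1) * 3 + n * ((W + 1) * ((maxSteps K + 1) * 5 + 6) + 4) + 5)
      fun σ' => HasSizes m (maxSteps K) W κ U (n + 1) 0 σ' := by
  set k := maxSteps K with hk
  refine (Run.seq (T' := n * ((W + 1) * ((k + 1) * 5 + 6) + 4) + 3)
    (R := fun σ' => ∀ w ≤ W, σ' 29 w = (m + 1 : ℕ)) ?_ ?_).mono
    (show (W + 1) * (1 + 2) + 2 + _ ≤ _ by omega) fun _ _ h => h
  · refine (Run.forLt (T := 1) (W + 1) (fun j σ' => ∀ w < j, σ' 29 w = (m + 1 : ℕ)) hWB rfl ?_ ?_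
      ?_).mono le_rfl fun σ' _ h w hw => h.2 w (by omega)
    · intro j σ' hfr _
      simp [hfr 28 rfl, hW]
    · intro j hj σ' hfr hx hI
      refine Run.assign j (m + 1 : ℕ) (by simp [hx]) (by simp [hfr 0 rfl, hin.items])
        (by rw [Int.natAbs_natCast]; exact hmB) ?_
      intro w hw
      rw [Memory.write_ne (by decide), Memory.write_apply]
      split_ifs with h
      · rfl
      · exact hI w (by omega)
    · intro w hw; omega
  intro σ₁ hfr₁ hI₁
  refine Run.assign_seq (T := n * ((W + 1) * ((k + 1) * 5 + 6) + 4) + 2) 0 0 rfl rfl (by simp) ?_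
  have hin₁ : HasInput m K a b (σ₁.write 29 0 0) :=
    hin.congr (by simp [hfr₁ 0 rfl]) (by simp [hfr₁ 2 rfl]) (by simp [hfr₁ 3 rfl])
  have ho₁ : HasOptions k κ U n 0 (σ₁.write 29 0 0) :=
    ho.congr (by simp [hfr₁ 26 rfl]) (by simp [hfr₁ 27 rfl])
  have hW₁ : σ₁.write 29 0 0 28 0 = W := by simp [hfr₁ 28 rfl, hW]
  have hs₁ : HasSizes m k W κ U 1 0 (σ₁.write 29 0 0) := by
    intro j w hw hj
    obtain rfl : j = 0 := by omega
    rw [zero_mul, zero_add, Memory.write_apply, minSize]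
    split_ifs with h
    · rfl
    · exact hI₁ w hw
  set σ₂ := σ₁.write 29 0 0
  clear_value σ₂
  refine (Run.forLt (T := (W + 1) * ((k + 1) * 5 + 6) + 2) n
    (fun i σ' => HasSizes m k W κ U (i + 1) 0 σ') hnB rfl ?_ ?_ ?_).mono
    (le_of_eq (by ring)) fun _ _ h => h.2
  · intro i σ' hfr _
    rw [RExpr.eval_cell_zero, hfr 0 rfl, hin₁.players]
  · intro i hi σ₃ hfr₃ hx₃ hs₃
    have hin₃ : HasInput m K a b σ₃ := hin₁.congr (hfr₃ 0 rfl) (hfr₃ 2 rfl) (hfr₃ 3 rfl)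
    have ho₃ := ho₁.congr (hfr₃ 26 rfl) (hfr₃ 27 rfl)
    have hW₃ : σ₃ 28 0 = W := by rw [hfr₃ 28 rfl, hW₁]
    refine (Run.forLt (T := (k + 1) * 5 + 4) (W + 1)
      (fun w σ' => HasSizes m k W κ U (i + 1) w σ') hWB rfl ?_ ?_ ?_).mono (le_of_eq (by ring)) ?_
    · intro w σ' hfr _
      simp [hfr 28 rfl, hW₃]
    · intro w hw σ₄ hfr₄ hx₄ hs₄
      have hin₄ : HasInput m K a b σ₄ := hin₃.congr (hfr₄ 0 rfl) (hfr₄ 2 rfl) (hfr₄ 3 rfl)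
      have ho₄ := ho₃.congr (hfr₄ 26 rfl) (hfr₄ 27 rfl)
      have hW₄ : σ₄ 28 0 = W := by rw [hfr₄ 28 rfl, hW₃]
      have hi₄ : σ₄ 12 0 = i := by rw [hfr₄ 12 rfl, hx₃]
      refine Run.assign_seq (T := (k + 1) * 5 + 3) 0 (m + 1 : ℕ) rfl (by simp [hin₄.items])
        (by rw [Int.natAbs_natCast]; exact hmB) ?_
      refine Run.seq (T := (k + 1) * (3 + 2) + 2) (T' := 1) (R := fun σ' =>
        σ' 31 0 = (minSize m k κ U (i + 1) w : ℕ)) ?_ ?_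
      · refine (Run.forLt (T := 3) (k + 1)
          (fun r σ' => σ' 31 0 = (minSizeStep m (minSize m k κ U i) (κ i) (U i) w r : ℕ)) hkB rfl
          ?_ ?_ ?_).mono le_rfl fun _ _ h => h.2
        · intro r σ' hfr _
          simp [hfr 0 rfl, hin₄.steps, hk]
        · intro r hr σ₅ hfr₅ hx₅ hI₅
          have hin₅ : HasInput m K a b σ₅ := hin₄.congr (by simp [hfr₅ 0 rfl])
            (by simp [hfr₅ 2 rfl]) (by simp [hfr₅ 3 rfl])
          have ho₅ : HasOptions k κ U n 0 σ₅ :=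
            ho₄.congr (by simp [hfr₅ 26 rfl]) (by simp [hfr₅ 27 rfl])
          have hs₅ : HasSizes m k W κ U (i + 1) w σ₅ := hs₄.congr (by simp [hfr₅ 29 rfl])
          have hW₅ : σ₅ 28 0 = W := by simp [hfr₅ 28 rfl, hW₄]
          have hi₅ : (reg 12).eval σ₅ = i := by simp [hfr₅ 12 rfl, hi₄]
          have hw₅ : (reg 30).eval σ₅ = w := by simp [hfr₅ 30 rfl, hx₄]
          have hr₅ : (reg 13).eval σ₅ = r := by simp [hx₅]
          have hU₅ := (ho₅.eval hin₅ hi₅ hr₅ hi (by omega)).2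
          have hcap := minSizeStep_le_cap m (minSize m k κ U i) (κ i) (U i) w (r + 1)
          refine Run.ifLe (T := 2) (fun hg => ?_) (fun hg => ?_)
          · rw [hU₅, hw₅, Nat.cast_le] at hg
            have hc₅ := eval_candidateExpr hin₅ hW₅ ho₅ hs₅ hi₅ hr₅ hw₅ hi (by omega)
              (show r ≤ maxSteps K by omega) (by omega) hg
            rw [minSizeStep, if_pos hg] at hcap
            refine Run.ifLe (fun hg' => ?_) (fun hg' => ?_)
            · rw [hc₅, eval_reg, hI₅, Nat.cast_le] at hg'
              rw [min_eq_right hg'] at hcap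
              refine Run.assign 0 _ rfl hc₅ (by rw [Int.natAbs_natCast]; omega) ?_
              rw [minSizeStep, if_pos hg, min_eq_right hg']
              simp
            · rw [hc₅, eval_reg, hI₅, Nat.cast_le, not_le] at hg'
              refine Run.skip ?_
              rw [minSizeStep, if_pos hg, min_eq_left hg'.le]
              simpa using hI₅
          · rw [hU₅, hw₅, Nat.cast_le] at hg
            refine (Run.skip ?_).mono (by omega) fun _ _ h => h
            rw [minSizeStep, if_neg hg]
            simpa using hI₅
        · simp [minSizeStep]
      · intro σ₅ hfr₅ hI₅
        have hcap := minSize_le_cap m k κ U (i + 1) w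
        refine Run.assign ((i + 1) * (W + 1) + w) _ (eval_sizeIdx ?_ ?_ ?_) hI₅
          (by rw [Int.natAbs_natCast]; omega) ?_
        · simp [hfr₅ 28 rfl, hW₄]
        · simp [hfr₅ 12 rfl, hi₄]
        · simp [hfr₅ 30 rfl, hx₄]
        · exact (HasSizes.write (σ := σ₅) (hs₄.congr (by simp [hfr₅ 29 rfl]))).congr (by simp)
    · exact hs₃.congr (by simp)
    · rintro σ' - ⟨-, h⟩
      intro j w hw hj
      have h1 : j < i + 1 ∨ j = i + 1 ∧ w < W + 1 := by omega
      simpa using h j w hw h1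
  · exact hs₁.congr (by simp)

theorem run_bestValueProg {σ : Memory} (hin : HasInput m K a b σ) (hW : σ 28 0 = W)
    (hs : HasSizes m (maxSteps K) W κ U (n + 1) 0 σ) (h0 : minSize m (maxSteps K) κ U n 0 ≤ m)
    (hWB : W + 1 ≤ B) :
    Run q B bestValueProg σ ((W + 1) * 4 + 3) fun σ' => ∃ w : ℕ, σ' 32 0 = w ∧ w ≤ W ∧
      minSize m (maxSteps K) κ U n w ≤ m ∧
      ∀ w' ≤ W, minSize m (maxSteps K) κ U n w' ≤ m → w' ≤ w := by
  refine Run.assign_seq 0 0 rfl rfl (by simp) ?_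
  refine (Run.forLt (T := 2) (W + 1) (fun j σ' => ∃ w : ℕ, σ' 32 0 = w ∧ w ≤ W ∧
      minSize m (maxSteps K) κ U n w ≤ m ∧
      ∀ w' < j, minSize m (maxSteps K) κ U n w' ≤ m → w' ≤ w) hWB rfl ?_ ?_ ?_).mono le_rfl ?_
  · intro j σ' hfr _
    simp [hfr 28 rfl, hW]
  · rintro j hj σ' hfr hx ⟨w, hw, hwW, hwm, hmax⟩
    have hcell : (RExpr.cell 29 (sizeIdx (.cell 0 0) (reg 30))).eval σ'
        = minSize m (maxSteps K) κ U n j := by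
      rw [RExpr.eval_cell _ (eval_sizeIdx (W := W) (i := n) (w := j) (by simp [hfr 28 rfl, hW])
        (by simp [hfr 0 rfl, hin.players]) (by simp [hx]))]
      rw [hfr 29 rfl]
      simpa using hs n j (by omega) (Or.inl (by omega))
    have hm' : (RExpr.cell 0 1).eval σ' = m := by simp [hfr 0 rfl, hin.items]
    refine Run.ifLe (fun hg => ?_) (fun hg => ?_)
    · rw [hcell, hm', Nat.cast_le] at hg
      refine Run.assign 0 j rfl (by simp [hx]) (by simp; omega) ?_
      exact ⟨j, by simp, by omega, hg, fun w' hw' _ => by omega⟩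
    · rw [hcell, hm', Nat.cast_le] at hg
      refine Run.skip ⟨w, by simp [hw], hwW, hwm, fun w' hw' h => ?_⟩
      rcases Nat.lt_succ_iff_lt_or_eq.1 hw' with h1 | rfl
      · exact hmax w' h1 h
      · exact absurd h hg
  · exact ⟨0, by simp, by omega, h0, by simp⟩
  · rintro σ' - ⟨-, w, hw, hwW, hwm, hmax⟩
    exact ⟨w, hw, hwW, hwm, fun w' hw' => hmax w' (by omega)⟩

theorem run_choiceProg {σ : Memory} (hin : HasInput m K a b σ) (hW : σ 28 0 = W)
    (ho : HasOptions (maxSteps K) κ U n 0 σ) (hs : HasSizes m (maxSteps K) W κ U (n + 1) 0 σ)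
    {i w : ℕ} (hi : i < n) (hx : σ 34 0 = i) (hw : σ 32 0 = w) (hwW : w ≤ W)
    (hwm : minSize m (maxSteps K) κ U (i + 1) w ≤ m) (hkB : maxSteps K + 1 ≤ B) :
    Run q B choiceProg σ ((maxSteps K + 1) * 5 + 3) fun σ' => ∃ r : ℕ, σ' 33 0 = r ∧
      r ≤ maxSteps K ∧ U i r ≤ w ∧
      minSize m (maxSteps K) κ U i (w - U i r) + κ i r = minSize m (maxSteps K) κ U (i + 1) w ∧
      ∀ r' ≤ maxSteps K, r < r' → U i r' ≤ w → minSize m (maxSteps K) κ U (i + 1) w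
        < minSize m (maxSteps K) κ U i (w - U i r') + κ i r' := by
  set k := maxSteps K with hk
  -- The option `r` attains the minimal size; `≤` is enough, since no option does better.
  let M : ℕ → Prop := fun r => U i r ≤ w ∧
    minSize m k κ U i (w - U i r) + κ i r ≤ minSize m k κ U (i + 1) w
  refine Run.assign_seq 0 0 rfl rfl (by simp) ?_
  -- Either no match has been seen or `r` is the last one. As the tabulated size is at most `m`, a
  -- match exists, so the loop ends in the second case.
  refine (Run.forLt (T := 3) (k + 1) (fun j σ' => ∃ r : ℕ, σ' 33 0 = r ∧ r ≤ k ∧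
      ∀ r' < j, M r' → r' ≤ r ∧ M r) hkB rfl ?_ ?_ ?_).mono le_rfl ?_
  · intro j σ' hfr _
    simp [hfr 0 rfl, hin.steps, hk]
  · rintro j hj σ' hfr hj' ⟨r, hr, hrk, hmax⟩
    have hin' : HasInput m K a b σ' := hin.congr (by simp [hfr 0 rfl])
      (by simp [hfr 2 rfl]) (by simp [hfr 3 rfl])
    have ho' : HasOptions k κ U n 0 σ' :=
      ho.congr (by simp [hfr 26 rfl]) (by simp [hfr 27 rfl])
    have hs' : HasSizes m k W κ U (n + 1) 0 σ' := hs.congr (by simp [hfr 29 rfl])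
    have hW' : σ' 28 0 = W := by simp [hfr 28 rfl, hW]
    have hi' : (reg 34).eval σ' = i := by simp [hfr 34 rfl, hx]
    have hw' : (reg 32).eval σ' = w := by simp [hfr 32 rfl, hw]
    have hr' : (reg 13).eval σ' = j := by simp [hj']
    have hU' := (ho'.eval hin' hi' hr' hi (by omega)).2
    have hstay : ¬ M j → ∀ r' < j + 1, M r' → r' ≤ r ∧ M r := by
      intro hM r' h1 h2
      rcases Nat.lt_succ_iff_lt_or_eq.1 h1 with h3 | rfl
      · exact hmax r' h3 h2
      · exact absurd h2 hM
    refine Run.ifLe (T := 2) (fun hg => ?_) (fun hg => ?_)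
    · rw [hU', hw', Nat.cast_le] at hg
      have hc' := eval_candidateExpr hin' hW' ho' hs' hi' hr' hw' hi (by omega)
        (show j ≤ maxSteps K by omega) (by omega) hg
      have ht' : (RExpr.cell 29 (sizeIdx (reg 34 + 1) (reg 32))).eval σ'
          = minSize m k κ U (i + 1) w := by
        rw [RExpr.eval_cell _ (eval_sizeIdx (W := W) (i := i + 1) (w := w) hW'
          (by rw [RExpr.eval_add, hi']; simp) hw')]
        exact hs' _ _ hwW (Or.inl (by omega))
      refine Run.ifLe (fun hg' => ?_) (fun hg' => ?_)
      · rw [hc', ht', Nat.cast_le] at hg'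
        refine Run.assign 0 j rfl hr' (by simp; omega) ?_
        exact ⟨j, by simp, by omega, fun r' h1 h2 => ⟨by omega, hg, hg'⟩⟩
      · rw [hc', ht', Nat.cast_le] at hg'
        exact Run.skip ⟨r, by simp [hr], hrk, hstay fun h => hg' h.2⟩
    · rw [hU', hw', Nat.cast_le] at hg
      exact (Run.skip ⟨r, by simp [hr], hrk, hstay fun h => hg h.1⟩).mono (by omega)
        fun _ _ h => h
  · exact ⟨0, by simp, by omega, by simp⟩
  · rintro σ' - ⟨-, r, hr, hrk, hmax⟩
    obtain ⟨r₀, hr₀, hU₀, heq₀⟩ := exists_minSizeStep_eq (show minSizeStep m (minSize m k κ U i)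
      (κ i) (U i) w (k + 1) ≤ m from hwm)
    have hM := (hmax r₀ hr₀ ⟨hU₀, heq₀.le⟩).2
    refine ⟨r, hr, hrk, hM.1, le_antisymm hM.2 (minSizeStep_le (by omega) hM.1), ?_⟩
    intro r' h1 h2 h3
    by_contra hc
    have := (hmax r' (by omega) ⟨h3, not_lt.1 hc⟩).1
    omega

theorem run_backtrackProg {σ : Memory} (hin : HasInput m K a b σ) (hW : σ 28 0 = W)
    (ho : HasOptions (maxSteps K) κ U n 0 σ) (hs : HasSizes m (maxSteps K) W κ U (n + 1) 0 σ)
    {w₀ : ℕ} (hw : σ 32 0 = w₀) (hwW : w₀ ≤ W) (hwm : minSize m (maxSteps K) κ U n w₀ ≤ m)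
    (hkB : maxSteps K + 1 ≤ B) (hnB : n ≤ B) (hmB : m ≤ B) (hWB : W ≤ B) :
    Run q B backtrackProg σ (n * ((maxSteps K + 1) * 5 + 8) + 2) fun σ' => ∃ w c : ℕ → ℕ,
      w n = w₀ ∧ (∀ i < n, IsBacktrack m (maxSteps K) κ U w c i) ∧
      ∀ i < n, σ' 11 i = κ i (c i) := by
  set k := maxSteps K with hk
  -- Players are treated from the last to the first: after `j` rounds the choices of those from `n -
  -- j` on are final, and `w (n - j)` is the value left.
  refine (Run.forLt (T := (k + 1) * 5 + 6) n (fun j σ' => ∃ w c : ℕ → ℕ, w n = w₀ ∧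
      σ' 32 0 = w (n - j) ∧ w (n - j) ≤ W ∧ minSize m k κ U (n - j) (w (n - j)) ≤ m ∧
      ∀ i < n, n - j ≤ i → IsBacktrack m k κ U w c i ∧ σ' 11 i = κ i (c i)) hnB rfl ?_ ?_ ?_).mono
      le_rfl ?_
  · intro j σ' hfr _
    rw [RExpr.eval_cell_zero, hfr 0 rfl, hin.players]
  · rintro j hj σ₁ hfr hx ⟨w, c, hwn, hw32, hwjW, hwjm, hI⟩
    have hin₁ : HasInput m K a b σ₁ := hin.congr (hfr 0 rfl) (hfr 2 rfl) (hfr 3 rfl)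
    have ho₁ := ho.congr (hfr 26 rfl) (hfr 27 rfl)
    have hs₁ := hs.congr (hfr 29 rfl)
    have hW₁ : σ₁ 28 0 = W := by rw [hfr 28 rfl, hW]
    obtain ⟨i, hi⟩ : ∃ i, n = i + (j + 1) := ⟨n - (j + 1), by omega⟩
    have hnj : n - j = i + 1 := by omega
    have hnj' : n - (j + 1) = i := by omega
    rw [hnj] at hw32 hwjW hwjm hI
    refine Run.assign_seq (T := (k + 1) * 5 + 3 + 2) 0 i rfl
      (by simp [hin₁.players, hx, hi]) (by simp; omega) ?_
    refine Run.seq (run_choiceProg (W := W) (w := w (i + 1)) (κ := κ) (U := U)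
      (hin₁.congr (by simp) (by simp) (by simp)) (by simpa using hW₁)
      (ho₁.congr (by simp) (by simp)) (hs₁.congr (by simp)) (show i < n by omega) (by simp)
      (by simpa using hw32) hwjW hwjm hkB) ?_
    rintro σ₂ hfr₂ ⟨r, hr, hrk, hUr, heq, hlast⟩
    simp only [← hk] at heq hrk hlast
    have hin₂ : HasInput m K a b σ₂ := hin₁.congr (by simp [hfr₂ 0 rfl]) (by simp [hfr₂ 2 rfl])
      (by simp [hfr₂ 3 rfl])
    have ho₂ : HasOptions k κ U n 0 σ₂ :=
      ho₁.congr (by simp [hfr₂ 26 rfl]) (by simp [hfr₂ 27 rfl])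
    have hx₂ : (reg 34).eval σ₂ = i := by simp [hfr₂ 34 rfl]
    have hr₂ : (reg 33).eval σ₂ = r := by simp [hr]
    have hw₂ : σ₂ 32 0 = w (i + 1) := by simp [hfr₂ 32 rfl, hw32]
    have hopt₂ := ho₂.eval hin₂ hx₂ hr₂ (by omega) hrk
    refine Run.assign_seq (T := 1) i (κ i r : ℕ) hx₂ hopt₂.1 (by
      rw [Int.natAbs_natCast]; omega) ?_
    have hopt₃ := (ho₂.congr (σ' := σ₂.write 11 i (κ i r : ℕ)) (by simp) (by simp)).eval
      (hin₂.congr (by simp) (by simp) (by simp)) (ei := reg 34) (er := reg 33) (i := i) (r := r)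
      (by simpa using hx₂) (by simpa using hr₂) (by omega) hrk
    refine Run.assign 0 (w (i + 1) - U i r : ℕ) rfl ?_ (by rw [Int.natAbs_natCast]; omega) ?_
    · rw [RExpr.eval_sub, hopt₃.2, eval_reg, Memory.write_ne (by decide), hw₂]; omega
    -- Only the entries at `i` are new; the conditions for later players involve `w` and `c` above
    -- `i` alone.
    refine ⟨Function.update w i (w (i + 1) - U i r), Function.update c i r, ?_, ?_, ?_, ?_, ?_⟩
    · rw [Function.update_of_ne (by omega), hwn]
    · simp [hnj']
    · rw [hnj', Function.update_self]; omega
    · rw [hnj', Function.update_self]; omega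
    · intro i' hi' hle
      rw [hnj'] at hle
      by_cases hii : i' = i
      · subst hii
        refine ⟨?_, by simp⟩
        unfold IsBacktrack
        rw [Function.update_self, Function.update_self, Function.update_of_ne (by omega)]
        exact ⟨hrk, hUr, rfl, heq, hlast⟩
      · obtain ⟨h1, h2⟩ := hI i' hi' (by omega)
        refine ⟨?_, ?_⟩
        · unfold IsBacktrack
          rw [Function.update_of_ne hii, Function.update_of_ne hii,
            Function.update_of_ne (by omega)]
          exact h1
        · rw [Function.update_of_ne hii, ← h2, Memory.write_ne (by decide),
            Memory.write_ne (by decide), Memory.write_idx_ne hii, hfr₂ 11 rfl,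
            Memory.write_ne (by decide)]
  · exact ⟨fun _ => w₀, fun _ => 0, rfl, by simpa using hw, hwW, by simpa using hwm,
      fun i h1 h2 => by omega⟩
  · rintro σ' - ⟨-, w, c, hwn, -, -, -, hI⟩
    exact ⟨w, c, hwn, fun i hi => (hI i hi (by omega)).1, fun i hi => (hI i hi (by omega)).2⟩

/-- Computes the allocation for the profile in array `10`. -/
def allocProg : Program :=
  .seq maxValueProg <| .seq unitProg <| .seq optionsProg <| .seq tableProg <|
    .seq bestValueProg backtrackProg

/-- An upper bound for the value of the rounded valuations in multiples of the rounding unit. -/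
def unitsBound (n k e : ℕ) : ℕ := 12 * n ^ 3 * k ^ 3 * e + 2 * k ^ 2 * n

/-- An upper bound for the number of steps of `allocProg`. -/
def allocTime (n k W s : ℕ) : ℕ :=
  n * 6 + 4 + (4 * s + 7) + (n * (k * 10 + 14) + 3) +
    ((W + 1) * 3 + n * ((W + 1) * ((k + 1) * 5 + 6) + 4) + 5) + ((W + 1) * 4 + 3) +
    (n * ((k + 1) * 5 + 8) + 2)

/-- The bound `B` on the registers is large enough for `allocProg`. -/
structure IsLarge (n m k c a b e B : ℕ) : Prop where
  num : a * 2 ^ c ≤ B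
  den : b * 2 ^ c * (3 * n ^ 2 * k ^ 2) * (4 * k * n) ≤ B
  units : n * unitsBound n k e + 1 ≤ B
  items : m + 1 ≤ B
  reward : 2 * k * n ≤ B
  steps : k + 1 ≤ B
  players : n ≤ B

theorem run_allocProg {σ : Memory} {c : ℕ} {τ : Fin n → ℕ} {ε : ℝ} (hin : HasInput m K a b σ)
    (hτ : ∀ i : Fin n, σ 10 i = τ i) (hq : HasValues q n m c τ)
    (hv : ∀ i, IsValuation m (profile q τ i)) (hmd : ∀ i, IsMinded m (K i) (profile q τ i))
    (hk : 1 ≤ maxSteps K) (hε : ε = (a : ℝ) / b) (ha : 0 < a) (hb : 0 < b)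
    (hB : IsLarge n m (maxSteps K) c a b ⌈1 / ε⌉₊ B) :
    Run q B allocProg σ
      (allocTime n (maxSteps K) (n * unitsBound n (maxSteps K) ⌈1 / ε⌉₊) B.size)
      fun σ' => ∀ i : Fin n, σ' 11 i = allocRule m K ε (profile q τ) i := by
  have hn := pos_of_one_le_maxSteps hk
  have hε0 : 0 < ε := by rw [hε]; positivity
  have hcB : 2 ^ c ≤ B := (Nat.le_mul_of_pos_left _ ha).trans hB.num
  set k := maxSteps K with hkdef
  set Ub := unitsBound n k ⌈1 / ε⌉₊ with hUb
  refine (Run.seq (run_maxValueProg hin hτ hq hn hv hB.players hcB) (T' := 4 * B.size + 7 +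
    (n * (k * 10 + 14) + 3 + (((n * Ub + 1) * 3 + n * ((n * Ub + 1) * ((k + 1) * 5 + 6) + 4) + 5) +
    ((n * Ub + 1) * 4 + 3 + (n * ((k + 1) * 5 + 8) + 2))))) ?_).mono
    (le_of_eq (by unfold allocTime; ring)) fun _ _ h => h
  rintro σ₁ hfr₁ ⟨vn, vd, h14, h15, hvd0, hvnc, hvdc, hmax⟩
  have hin₁ : HasInput m K a b σ₁ := hin.congr (hfr₁ 0 rfl) (hfr₁ 2 rfl) (hfr₁ 3 rfl)
  refine Run.seq (run_unitProg hin₁ h14 h15 hvd0 hn hk ha hb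
    ((Nat.mul_le_mul_left _ hvnc.le).trans hB.num) (le_trans (by gcongr) hB.den)) ?_
  rintro σ₂ hfr₂ ⟨dn, dd, h18, h19, hdd0, hδ⟩
  rw [← hmax, ← hε, ← hkdef] at hδ
  have hin₂ : HasInput m K a b σ₂ := hin₁.congr (hfr₂ 0 rfl) (hfr₂ 2 rfl) (hfr₂ 3 rfl)
  have hU : ∀ i, ∀ s ≤ m, rewardedUnits n m k ε ((dn : ℝ) / dd) (K i) (profile q τ i) s ≤ Ub := by
    intro i s hs
    rw [← hδ]
    exact rewardedUnits_le hn hk hε0 (hv i) (hmd i) (card_le_maxSteps K i) (le_vMax _ i) hs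
  refine Run.seq (run_optionsProg hin₂ (by rw [hfr₂ 10 rfl, hfr₁ 10 rfl]; exact hτ) hq hv hmd hε
    h18 h19 hdd0 ha hb hU ((Nat.le_succ _).trans hB.units) hcB
      (by have := hB.items; omega) hB.reward
    (by have := hB.steps; omega) hB.players) ?_
  rintro σ₃ hfr₃ ⟨ho₃, hW₃⟩
  have hin₃ : HasInput m K a b σ₃ := hin₂.congr (hfr₃ 0 rfl) (hfr₃ 2 rfl) (hfr₃ 3 rfl)
  set κ := optionSizes K
  set U := optionValues m K ε ((dn : ℝ) / dd) (profile q τ) with hUdef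
  set W := ∑ j ∈ Finset.range n, U j (maxSteps K) with hW
  have hmem : ∀ i, ∀ x ∈ K i, x ≤ m := fun i x hx => (Finset.mem_Icc.1 ((hmd i).1 hx)).2
  have h0 : ∀ i, 0 ∉ K i := fun i => zero_notMem_of_isMinded (hmd i)
  have hκi : ∀ (i : Fin n) r, κ i r = optionSize (K i) r := fun i r => by simp [κ, optionSizes]
  have hUi : ∀ (i : Fin n) r, U i r = rewardedUnits n m k ε ((dn : ℝ) / dd) (K i)
      (profile q τ i) (κ i r) := fun i r => by simp [hUdef, optionValues, hκi, hkdef]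
  have hWle : W ≤ n * Ub := by
    rw [hW, Finset.sum_range]
    calc ∑ j : Fin n, U j (maxSteps K) ≤ ∑ j : Fin n, Ub := by
          refine Finset.sum_le_sum fun j _ => ?_
          rw [hUi, hκi]
          exact hU _ _ (optionSize_le (hmem _) _)
      _ = n * Ub := by simp
  have hWB : W + 1 ≤ B := (Nat.succ_le_succ hWle).trans hB.units
  refine (Run.seq (run_tableProg hin₃ hW₃ ho₃ hB.items hB.players hWB hB.steps) (T' :=
    (W + 1) * 4 + 3 +
    (n * ((k + 1) * 5 + 8) + 2)) ?_).mono (by gcongr) fun _ _ h => h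
  intro σ₄ hfr₄ hs₄
  have hin₄ : HasInput m K a b σ₄ := hin₃.congr (hfr₄ 0 rfl) (hfr₄ 2 rfl) (hfr₄ 3 rfl)
  have hW₄ : σ₄ 28 0 = W := by rw [hfr₄ 28 rfl, hW₃]
  -- The empty allocation attains the value `0`, so the search for the best value has a valid start.
  have hmin0 : minSize m (maxSteps K) κ U n 0 ≤ m := by
    have h1 := minSize_sum_le (m := m) (k := maxSteps K) (κ := κ) (U := U) (r := fun _ => 0) n
      (by simp)
    have h2 : ∑ j ∈ Finset.range n, κ j 0 = 0 := by
      rw [Finset.sum_range]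
      exact Finset.sum_eq_zero fun j _ => by rw [hκi, optionSize_zero]
    have h3 : ∑ j ∈ Finset.range n, U j 0 = 0 := by
      rw [Finset.sum_range]
      refine Finset.sum_eq_zero fun j _ => ?_
      rw [hUi, hκi, optionSize_zero, rewardedUnits]
      refine Finset.sum_eq_zero fun x hx => ?_
      have hx' := Finset.mem_filter.1 hx
      exact absurd (Nat.le_zero.1 hx'.2 ▸ hx'.1) (h0 _)
    rw [h2, h3] at h1
    omega
  refine Run.seq (run_bestValueProg hin₄ hW₄ hs₄ hmin0 hWB) ?_
  rintro σ₅ hfr₅ ⟨w₀, hw₀, hw₀W, hw₀m, hw₀max⟩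
  have hin₅ : HasInput m K a b σ₅ := hin₄.congr (hfr₅ 0 rfl) (hfr₅ 2 rfl) (hfr₅ 3 rfl)
  refine (run_backtrackProg hin₅ (by rw [hfr₅ 28 rfl, hW₄])
    ((ho₃.congr (hfr₄ 26 rfl) (hfr₄ 27 rfl)).congr (hfr₅ 26 rfl) (hfr₅ 27 rfl))
    (hs₄.congr (hfr₅ 29 rfl)) hw₀ hw₀W hw₀m hB.steps hB.players (by have := hB.items; omega)
    (by omega)).mono le_rfl ?_
  rintro σ' - ⟨w, ch, hwn, hbt, h11⟩
  have hsel : IsSelected m (fun i s => (rewardedUnits n m k ε ((dn : ℝ) / dd) (K i)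
      (profile q τ i) s : ℝ)) (fun i => κ i (ch i)) := by
    refine isSelected_of_isBacktrack (k := maxSteps K) (W := W) (κ := κ) (U := U) (w := w) (c := ch)
      (fun i => ?_) hUi (fun i s hs => ?_) (fun r hr => ?_) (hwn ▸ hw₀m) (hwn ▸ hw₀max) hbt
    · rw [show κ i = optionSize (K i) from funext (hκi i)]
      exact optionSize_mono (h0 i)
    · obtain ⟨r, h1, h2, h3⟩ := exists_option_rewardedUnits (n := n) (k := k) (ε := ε)
        (δ := (dn : ℝ) / dd) (hmd i) (card_le_maxSteps K i) s
      exact ⟨r, h1, by rw [hκi]; exact h2, by rw [hκi]; exact h3⟩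
    · rw [hW, Finset.sum_range, Finset.sum_range]
      refine Finset.sum_le_sum fun j _ => ?_
      rw [hUi, hUi, hκi, hκi]
      unfold rewardedUnits
      refine Finset.sum_le_sum_of_subset fun x hx => ?_
      have hx' := Finset.mem_filter.1 hx
      exact Finset.mem_filter.2 ⟨hx'.1, hx'.2.trans (optionSize_mono (h0 _) (hr j j.2))⟩
  have hδ0 : 0 ≤ (dn : ℝ) / dd := by positivity
  -- The dynamic program maximizes in units of `δ`; rescaling gives the allocation of the rule.
  have hsel' := hsel.of_scaled (u' := fun i => rewarded n m k ε ((dn : ℝ) / dd) (K i)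
    (profile q τ i)) hδ0 (fun i s hs => rewarded_eq_mul hδ0 (hv i) (hmd i) hs)
    (fun h i s _ => by exact_mod_cast rewardedUnits_eq_zero h s)
  rw [← hδ] at hsel'
  intro i
  rw [h11 i i.2, allocRule, ← hsel'.eq_selected]

end

/-! ### The payment program -/

/-- Replaces the index of the player in variable `40` by `e` and computes the allocation. -/
def allocAtProg (e : RExpr) : Program := .seq (.assign 10 (reg 40) e) allocProg

/-- One step of the binary search for the least index at which the player in variable `40` gets more
items than in variable `45`. -/
def searchStepProg : Program :=
  .seq (.set 51 ((reg 43 + reg 44) / 2)) <| .seq (allocAtProg (reg 51)) <|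
    .ifLe (.cell 11 (reg 40)) (reg 45) (.set 43 (reg 51)) (.set 44 (reg 51))

/-- Adds the next price increment to the fraction in the variables `41`, `42`. -/
def incrementProg : Program :=
  .seq (.set 44 (.cell 1 (reg 40))) <|
  .seq (.whileLe (reg 43 + 2) (reg 44) searchStepProg) <|
  .seq (allocAtProg (reg 44)) <|
  .seq (.set 52 (.cell 11 (reg 40))) <|
  .seq (.query 47 48 (reg 40) (reg 44) (reg 52)) <|
  .seq (.query 49 50 (reg 40) (reg 44) (reg 45)) <|
  .seq (.set 41 (reg 41 * reg 48 * reg 50 + (reg 47 * reg 50 - reg 49 * reg 48) * reg 42)) <|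
  .seq (.set 42 (reg 42 * reg 48 * reg 50)) <|
  .seq (.set 45 (reg 52)) (.set 43 (reg 44))

/-- Computes the payment of the player in variable `40`. -/
def paymentProg : Program :=
  .seq (.set 41 0) <| .seq (.set 42 1) <| .seq (.set 43 0) <|
  .seq (allocAtProg 0) <| .seq (.set 45 (.cell 11 (reg 40))) <|
  .seq (.whileLe (reg 45 + 1) (.cell 4 (reg 40)) incrementProg) <|
  .seq (.assign 10 (reg 40) (.cell 1 (reg 40))) <|
  .seq (.assign 5 (reg 40) (reg 41)) (.assign 6 (reg 40) (reg 42))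

/-- Computes the allocation and the payments. -/
def mechanismProg : Program :=
  .seq (.forLt 12 (.cell 0 0) (.assign 10 (reg 12) (.cell 1 (reg 12)))) <|
  .seq allocProg <|
  .seq (.forLt 12 (.cell 0 0) (.assign 4 (reg 12) (.cell 11 (reg 12)))) <|
  .forLt 40 (.cell 0 0) paymentProg

/-- The hypotheses on the input under which the program is correct. -/
structure IsInstance (q : ValueOracle) (B : ℕ) {n : ℕ} (m c : ℕ) (K : Fin n → Finset ℕ) (ε : ℝ)
    (a b : ℕ) (N : Fin n → ℕ∞) (t : ∀ i, DomainIndex (N i)) : Prop where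
  steps : 1 ≤ maxSteps K
  eps : ε = (a : ℝ) / b
  num_pos : 0 < a
  den_pos : 0 < b
  domain : ∀ i, IsMindedSingleCrossing m (K i) (oracleDomain q i (N i))
  values : ∀ (i : Fin n) (x : DomainIndex (N i)), x ≤ t i →
    HasValues q n m c (Function.update (fun j => (t j : ℕ)) i x)
  large : IsLarge n m (maxSteps K) c a b ⌈1 / ε⌉₊ B
  fraction : (2 ^ c) ^ (2 * maxSteps K + 1) ≤ B
  index : ∀ i, (t i : ℕ) ≤ B

/-- The number of items of player `i` as a function of his index. -/
noncomputable def share (q : ValueOracle) {n : ℕ} (m : ℕ) (K : Fin n → Finset ℕ) (ε : ℝ)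
    (N : Fin n → ℕ∞) (t : ∀ i, DomainIndex (N i)) (i : Fin n) (x : DomainIndex (N i)) : ℕ :=
  allocRule m K ε (fun j => oracleDomain q j (N j) (Function.update t i x j)) i

/-- An upper bound for the number of steps of `incrementProg`. -/
def incrementTime (Ta S : ℕ) : ℕ := S * (Ta + 5) + Ta + 10

/-- An upper bound for the number of steps of `paymentProg`. -/
def paymentTime (Ta S k : ℕ) : ℕ := k * (incrementTime Ta S + 1) + Ta + 9

/-- An upper bound for the number of steps of `mechanismProg`. -/
def mechanismTime (n k e S : ℕ) : ℕ :=
  n * 6 + 6 + allocTime n k (n * unitsBound n k e) S +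
    n * (paymentTime (allocTime n k (n * unitsBound n k e) S) S k + 2)

/-! ### Correctness of the payment program -/

section

variable {q : ValueOracle} {B n m c : ℕ} {K : Fin n → Finset ℕ} {ε : ℝ} {a b : ℕ}
  {N : Fin n → ℕ∞} {t : ∀ i, DomainIndex (N i)}

theorem profile_update (i : Fin n) (x : DomainIndex (N i)) :
    profile q (Function.update (fun j => (t j : ℕ)) i x) =
      fun j : Fin n => oracleDomain q j (N j) (Function.update t i x j) := by
  funext j
  by_cases h : j = i
  · subst h; funext s; simp [profile, oracleDomain]
  · funext s; simp [profile, oracleDomain, h]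

/-- The state of the payment program for player `i` after `j` increments, at the index `x`. -/
def PayState (q : ValueOracle) (m c : ℕ) (K : Fin n → Finset ℕ) (ε : ℝ)
    (N : Fin n → ℕ∞) (t : ∀ i, DomainIndex (N i)) (i : Fin n) (x : DomainIndex (N i)) (j : ℕ)
    (σ : Memory) : Prop :=
  x ≤ t i ∧ σ 43 0 = (x : ℕ) ∧ σ 45 0 = share q m K ε N t i x ∧
    (∀ l : Fin n, l ≠ i → σ 10 l = (t l : ℕ)) ∧
    ∃ pn pd : ℕ, σ 41 0 = pn ∧ σ 42 0 = pd ∧ 0 < pd ∧ pd ≤ (2 ^ c) ^ (2 * j) ∧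
      price (oracleDomain q i (N i)) (share q m K ε N t i) (share q m K ε N t i x) = (pn : ℝ) / pd

/-- The least index of a domain. -/
def DomainIndex.bot {N : ℕ∞} (x : DomainIndex N) : DomainIndex N :=
  ⟨0, lt_of_le_of_lt (by simp) x.2⟩

theorem DomainIndex.bot_le {N : ℕ∞} (x y : DomainIndex N) : x.bot ≤ y := Nat.zero_le _

namespace IsInstance

theorem eps_pos (h : IsInstance q B m c K ε a b N t) : 0 < ε := by
  have := h.num_pos
  have := h.den_pos
  rw [h.eps]; positivity

theorem monotone_share (h : IsInstance q B m c K ε a b N t) (i : Fin n) :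
    Monotone (share q m K ε N t i) :=
  monotone_allocRule h.eps_pos h.steps h.domain t i

theorem share_le (i : Fin n) (x : DomainIndex (N i)) : share q m K ε N t i x ≤ m :=
  (isSelected_allocRule m K ε _).1.le i

theorem share_mem (h : IsInstance q B m c K ε a b N t) {i : Fin n} {x : DomainIndex (N i)}
    (hx : 1 ≤ share q m K ε N t i x) : share q m K ε N t i x ∈ K i :=
  allocRule_mem ((h.domain i).2.1 _) hx

theorem value_pos (h : IsInstance q B m c K ε a b N t) {i : Fin n} {x : DomainIndex (N i)}
    (hx : x ≤ t i) {s : ℕ} (hs : s ≤ m) : 0 < (q i x s).2 := by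
  simpa using (h.values i x hx).pos i hs

theorem fst_lt (h : IsInstance q B m c K ε a b N t) {i : Fin n} {x : DomainIndex (N i)}
    (hx : x ≤ t i) {s : ℕ} (hs : s ≤ m) : (q i x s).1 < 2 ^ c := by
  simpa using (h.values i x hx).fst_lt i hs

theorem snd_lt (h : IsInstance q B m c K ε a b N t) {i : Fin n} {x : DomainIndex (N i)}
    (hx : x ≤ t i) {s : ℕ} (hs : s ≤ m) : (q i x s).2 < 2 ^ c := by
  simpa using (h.values i x hx).snd_lt i hs

/-- The least quantity is free, so the price of a player's own share is at most his value for it.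
This bounds the accumulated numerator in terms of the denominator. -/
theorem price_lt (h : IsInstance q B m c K ε a b N t) {i : Fin n} {x : DomainIndex (N i)}
    (hx : x ≤ t i) : price (oracleDomain q i (N i)) (share q m K ε N t i)
      (share q m K ε N t i x) < 2 ^ c := by
  set g := share q m K ε N t i with hg
  have hV := h.domain i
  have hmono := h.monotone_share i
  have hm : g x ≤ m := share_le i x
  have h1 := (price_sub_le hV.1 hV.2.2 hmono (share_le i) x (g x) (g x.bot)
    (hmono (x.bot_le x)) ⟨_, rfl⟩ ⟨_, rfl⟩).1 le_rfl
  rw [price_of_forall_le fun y => hmono (x.bot_le y)] at h1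
  have h2 := (hV.1 x).nonneg (share_le i x.bot : g x.bot ≤ m)
  have h3 : oracleDomain q i (N i) x (g x) < 2 ^ c := by
    have h4 := h.value_pos hx hm
    have h5 : ((q i x (g x)).1 : ℝ) < 2 ^ c := by exact_mod_cast h.fst_lt hx hm
    have h6 : (1 : ℝ) ≤ ((q i x (g x)).2 : ℝ) := by exact_mod_cast h4
    exact (div_le_self (by positivity) h6).trans_lt h5
  linarith

theorem run_allocAtProg (h : IsInstance q B m c K ε a b N t) {σ : Memory}
    (hin : HasInput m K a b σ) {i : Fin n} (hi : σ 40 0 = (i : ℕ))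
    (h10 : ∀ j : Fin n, j ≠ i → σ 10 j = (t j : ℕ)) (x : DomainIndex (N i)) (hx : x ≤ t i)
    {e : RExpr} (he : e.eval σ = (x : ℕ)) :
    Run q B (allocAtProg e) σ
      (allocTime n (maxSteps K) (n * unitsBound n (maxSteps K) ⌈1 / ε⌉₊) B.size + 1)
      fun σ' => σ' 11 i = share q m K ε N t i x ∧ ∀ j : Fin n, j ≠ i → σ' 10 j = (t j : ℕ) := by
  have hxB : (x : ℕ) ≤ B := le_trans hx (h.index i)
  refine Run.assign_seq i (x : ℕ) (by simp [hi]) he (by rw [Int.natAbs_natCast]; exact hxB) ?_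
  have hprof := profile_update (q := q) (t := t) i x
  have h10' : ∀ j : Fin n, j ≠ i → σ.write 10 i (x : ℕ) 10 j = (t j : ℕ) := by
    intro j hj
    rw [Memory.write_idx_ne (fun e => hj (Fin.ext e))]
    exact h10 j hj
  refine (run_allocProg (τ := Function.update (fun j => (t j : ℕ)) i x)
    (hin.congr (by simp) (by simp) (by simp)) ?_ (h.values i x hx) ?_ ?_ h.steps h.eps
    h.num_pos h.den_pos h.large).mono le_rfl ?_
  · intro j
    by_cases hj : j = i
    · subst hj; simp
    · rw [h10' j hj, Function.update_of_ne hj]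
  · intro j; rw [hprof]; exact (h.domain j).1 _
  · intro j; rw [hprof]; exact (h.domain j).2.1 _
  · intro σ' hfr hσ'
    refine ⟨by rw [hσ', hprof]; rfl, fun j hj => ?_⟩
    rw [hfr 10 rfl, h10' j hj]

/-- Binary search for the least index at which player `i` gets more than `s` items. -/
theorem run_search (h : IsInstance q B m c K ε a b N t) {σ : Memory}
    (hin : HasInput m K a b σ) {i : Fin n} (hi : σ 40 0 = (i : ℕ))
    (h10 : ∀ j : Fin n, j ≠ i → σ 10 j = (t j : ℕ)) {x : DomainIndex (N i)} {s : ℕ}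
    (hlo : σ 43 0 = (x : ℕ)) (hhi : σ 44 0 = (t i : ℕ)) (hs : σ 45 0 = s)
    (hx : share q m K ε N t i x ≤ s) (ht : s < share q m K ε N t i (t i)) :
    Run q B (.whileLe (reg 43 + 2) (reg 44) searchStepProg) σ (B.size *
      (allocTime n (maxSteps K) (n * unitsBound n (maxSteps K) ⌈1 / ε⌉₊) B.size + 5) + 1)
      fun σ' => ∃ y : DomainIndex (N i), y ≤ t i ∧ σ' 44 0 = (y : ℕ) ∧
        s < share q m K ε N t i y ∧ (∀ z, z < y → share q m K ε N t i z ≤ s) ∧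
        ∀ j : Fin n, j ≠ i → σ' 10 j = (t j : ℕ) := by
  set g := share q m K ε N t i with hg
  have hmono : Monotone g := h.monotone_share i
  -- The search keeps `g lo ≤ s < g hi`. Its measure is the bit length of `hi - lo - 1`, which drops
  -- whenever the gap is halved.
  refine (Run.whileLe (T := allocTime n (maxSteps K) (n * unitsBound n (maxSteps K) ⌈1 / ε⌉₊)
    B.size + 4) (fun d σ' => ∃ lo hi : DomainIndex (N i), hi ≤ t i ∧ σ' 43 0 = (lo : ℕ) ∧
      σ' 44 0 = (hi : ℕ) ∧ g lo ≤ s ∧ s < g hi ∧ d = ((hi : ℕ) - lo - 1).size ∧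
      ∀ j : Fin n, j ≠ i → σ' 10 j = (t j : ℕ)) ?_ (((t i : ℕ) - x - 1).size)
      ⟨x, t i, le_rfl, hlo, hhi, hx, ht, rfl, h10⟩).mono ?_ ?_
  · rintro d σ₁ hfr ⟨lo, hi', hhit, h43, h44, hglo, hghi, rfl, h10₁⟩ hg₁
    simp only [RExpr.eval_add, eval_reg, RExpr.eval_ofNat, h43, h44] at hg₁
    have hin₁ : HasInput m K a b σ₁ := hin.congr (hfr 0 rfl) (hfr 2 rfl) (hfr 3 rfl)
    have hi₁ : σ₁ 40 0 = (i : ℕ) := by rw [hfr 40 rfl, hi]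
    have hs₁ : σ₁ 45 0 = s := by rw [hfr 45 rfl, hs]
    have hlt : (lo : ℕ) + 2 ≤ hi' := by exact_mod_cast hg₁
    have hmid1 : ((lo : ℕ) + hi') / 2 ≤ hi' := by omega
    set mid : DomainIndex (N i) := ⟨((lo : ℕ) + hi') / 2, lt_of_le_of_lt
      (by exact_mod_cast hmid1) hi'.2⟩ with hmid
    have hmidv : (mid : ℕ) = ((lo : ℕ) + hi') / 2 := rfl
    have hmidt : mid ≤ t i := le_trans (show (mid : ℕ) ≤ hi' from hmid1) hhit
    have hsize : ∀ e : ℕ, e ≤ ((hi' : ℕ) - lo - 1) / 2 → e.size < ((hi' : ℕ) - lo - 1).size := by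
      intro e he
      have h1 : 0 < ((hi' : ℕ) - lo - 1).size := Nat.size_pos.2 (by omega)
      have h2 := Nat.lt_size_self ((hi' : ℕ) - lo - 1)
      have h3 : e.size ≤ ((hi' : ℕ) - lo - 1).size - 1 := by
        rw [Nat.size_le]
        have h4 : 2 ^ ((hi' : ℕ) - lo - 1).size = 2 ^ (((hi' : ℕ) - lo - 1).size - 1) * 2 := by
          rw [← pow_succ]; congr 1; omega
        omega
      omega
    refine Run.assign_seq (T := allocTime n (maxSteps K) (n * unitsBound n (maxSteps K) ⌈1 / ε⌉₊)
      B.size + 1 + 2) 0 (mid : ℕ) rfl ?_ (by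
        rw [Int.natAbs_natCast]; exact le_trans hmidt (h.index i)) ?_
    · simp only [RExpr.eval_div, RExpr.eval_add, eval_reg, RExpr.eval_ofNat, h43, h44, hmidv]
      rw [Int.fdiv_eq_ediv_of_nonneg _ (by norm_num)]
      push_cast; rfl
    refine Run.seq (h.run_allocAtProg (hin₁.congr (by simp) (by simp) (by simp))
      (by simpa using hi₁) (by simpa using h10₁) mid hmidt (by simp)) ?_
    rintro σ₂ hfr₂ ⟨h11, h10₂⟩
    have hcell : (RExpr.cell 11 (reg 40)).eval σ₂ = g mid := by
      rw [RExpr.eval_cell i (by simp [hfr₂ 40 rfl, hi₁]), h11]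
    have hs₂ : (reg 45).eval σ₂ = s := by simp [hfr₂ 45 rfl, hs₁]
    have h51 : (reg 51).eval σ₂ = (mid : ℕ) := by simp [hfr₂ 51 rfl]
    have hmidB : ((mid : ℕ) : ℤ).natAbs ≤ B := by
      rw [Int.natAbs_natCast]; exact le_trans hmidt (h.index i)
    refine Run.ifLe (fun hg₂ => ?_) (fun hg₂ => ?_)
    · rw [hcell, hs₂, Nat.cast_le] at hg₂
      refine Run.assign 0 (mid : ℕ) rfl h51 hmidB ⟨_, hsize ((hi' : ℕ) - mid - 1)
        (by omega), mid, hi',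
        hhit, by simp, ?_, hg₂, hghi, rfl, by simpa using h10₂⟩
      simp [hfr₂ 44 rfl, h44]
    · rw [hcell, hs₂, Nat.cast_le, not_le] at hg₂
      refine Run.assign 0 (mid : ℕ) rfl h51 hmidB ⟨_, hsize ((mid : ℕ) - lo - 1)
        (by omega), lo, mid,
        hmidt, ?_, by simp, hglo, hg₂, rfl, by simpa using h10₂⟩
      simp [hfr₂ 43 rfl, h43]
  · have : ((t i : ℕ) - x - 1).size ≤ B.size := Nat.size_le_size (by have := h.index i; omega)
    gcongr
  · rintro σ' - ⟨⟨d, lo, hi', hhit, h43, h44, hglo, hghi, -, h10'⟩, hg'⟩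
    simp only [RExpr.eval_add, eval_reg, RExpr.eval_ofNat, h43, h44] at hg'
    -- On exit `hi ≤ lo + 1`, so every index below `hi` is at most `lo`, and monotonicity applies.
    refine ⟨hi', hhit, h44, hghi, fun z hz => (hmono ?_).trans hglo, h10'⟩
    have h1 : (z : ℕ) < hi' := hz
    have h2 : ¬ (lo : ℕ) + 2 ≤ hi' := by exact_mod_cast hg'
    show (z : ℕ) ≤ lo
    omega

/-- The least index `y` with a larger share than `x` gives the next quantity of the image, and by
single crossing the infimum is attained at `y`. The increment is added without reducing fractions,
so the denominator grows by two factors of at most `2 ^ c`. -/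
theorem run_incrementProg (h : IsInstance q B m c K ε a b N t) {σ : Memory}
    (hin : HasInput m K a b σ) {i : Fin n} (hi : σ 40 0 = (i : ℕ)) (h1 : σ 1 i = (t i : ℕ))
    {x : DomainIndex (N i)} {j : ℕ} (hst : PayState q m c K ε N t i x j σ)
    (hj : j + 1 ≤ maxSteps K) (hlt : share q m K ε N t i x < share q m K ε N t i (t i)) :
    Run q B incrementProg σ (incrementTime
      (allocTime n (maxSteps K) (n * unitsBound n (maxSteps K) ⌈1 / ε⌉₊) B.size) B.size)
      fun σ' => ∃ y : DomainIndex (N i), share q m K ε N t i x < share q m K ε N t i y ∧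
        PayState q m c K ε N t i y (j + 1) σ' := by
  obtain ⟨hx, h43, h45, h10, pn, pd, h41, h42, hpd, hpdj, hprice⟩ := hst
  set g := share q m K ε N t i with hg
  set Ta := allocTime n (maxSteps K) (n * unitsBound n (maxSteps K) ⌈1 / ε⌉₊) B.size with hTa
  have hV := h.domain i
  have hmono : Monotone g := h.monotone_share i
  have hmB : m ≤ B := by have := h.large.items; omega
  refine (Run.assign_seq (T := B.size * (Ta + 5) + 1 + (Ta + 1 + 7)) 0 (t i : ℕ) rfl
    (by rw [RExpr.eval_cell i (by simp [hi]), h1])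
    (by rw [Int.natAbs_natCast]; exact h.index i) ?_).mono
    (by unfold incrementTime; omega) fun _ _ h => h
  refine Run.seq (h.run_search (hin.congr (by simp) (by simp) (by simp)) (by simpa using hi)
    (by simpa using h10) (x := x) (s := g x) (by simpa using h43) (by simp) (by simpa using h45)
    le_rfl hlt) ?_
  rintro σ₁ hfr₁ ⟨y, hyt, h44, hgy, hleast, h10₁⟩
  rw [← hg] at hgy hleast
  have hin₁ : HasInput m K a b σ₁ := hin.congr (by simp [hfr₁ 0 rfl]) (by simp [hfr₁ 2 rfl])
    (by simp [hfr₁ 3 rfl])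
  have hi₁ : σ₁ 40 0 = (i : ℕ) := by simp [hfr₁ 40 rfl, hi]
  refine Run.seq (h.run_allocAtProg hin₁ hi₁ h10₁ y hyt (by simpa using h44)) ?_
  rintro σ₂ hfr₂ ⟨h11, h10₂⟩
  have hi₂ : σ₂ 40 0 = (i : ℕ) := by rw [hfr₂ 40 rfl, hi₁]
  have h45₂ : σ₂ 45 0 = g x := by simp [hfr₂ 45 rfl, hfr₁ 45 rfl, h45]
  have h44₂ : σ₂ 44 0 = (y : ℕ) := by rw [hfr₂ 44 rfl, h44]
  have h41₂ : σ₂ 41 0 = pn := by simp [hfr₂ 41 rfl, hfr₁ 41 rfl, h41]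
  have h42₂ : σ₂ 42 0 = pd := by simp [hfr₂ 42 rfl, hfr₁ 42 rfl, h42]
  have hgym : g y ≤ m := share_le i y
  have hgxm : g x ≤ m := share_le i x
  have hy1 := h.value_pos hyt hgym
  have hy0 := h.value_pos hyt hgxm
  have hx1 := h.fst_lt hyt hgym
  have hx0 := h.fst_lt hyt hgxm
  have hy1' := h.snd_lt hyt hgym
  have hy0' := h.snd_lt hyt hgxm
  have hv1 : oracleDomain q i (N i) y (g y) = ((q i y (g y)).1 : ℝ) / ((q i y (g y)).2 : ℝ) := rfl
  have hv0 : oracleDomain q i (N i) y (g x) = ((q i y (g x)).1 : ℝ) / ((q i y (g x)).2 : ℝ) := rfl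
  have hstep := price_succ (V := oracleDomain q i (N i)) (g := g) ⟨x, rfl⟩ ⟨y, rfl⟩ hgy (by
    intro z hz
    exact hleast z (lt_of_not_ge fun hc => absurd (hmono hc) (not_le.2 hz)))
  rw [sInf_marginal_eq hV.2.2 (fun z hz => le_of_not_gt fun hc => by
    have := hleast z hc; omega) hgy hgym, hprice, hv1, hv0] at hstep
  have hle : oracleDomain q i (N i) y (g x) ≤ oracleDomain q i (N i) y (g y) :=
    (hV.1 y).2 _ _ hgy.le hgym
  rw [hv1, hv0, div_le_div_iff₀ (by exact_mod_cast hy0) (by exact_mod_cast hy1)] at hle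
  have hplt := h.price_lt hyt
  rw [← hg] at hplt
  set x₁ := (q i y (g y)).1
  set y₁ := (q i y (g y)).2
  set x₀ := (q i y (g x)).1
  set y₀ := (q i y (g x)).2
  have hle' : x₀ * y₁ ≤ x₁ * y₀ := by exact_mod_cast hle
  obtain ⟨d, hd⟩ := Nat.exists_eq_add_of_le hle'
  have hdZ : (x₁ : ℤ) * y₀ - x₀ * y₁ = d := by
    have : ((x₁ * y₀ : ℕ) : ℤ) = ((x₀ * y₁ + d : ℕ) : ℤ) := by rw [hd]
    push_cast at this
    linarith
  have hdR : (x₁ : ℝ) * y₀ = x₀ * y₁ + d := by exact_mod_cast hd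
  set pn' := pn * y₁ * y₀ + d * pd with hpn'
  set pd' := pd * y₁ * y₀ with hpd'
  have hpd'0 : 0 < pd' := by positivity
  have hprice' : price (oracleDomain q i (N i)) g (g y) = (pn' : ℝ) / pd' := by
    rw [hstep, hpn', hpd']
    push_cast
    field_simp
    linear_combination (pd : ℝ) * hdR
  have hpd'j : pd' ≤ (2 ^ c) ^ (2 * (j + 1)) := by
    calc pd' ≤ (2 ^ c) ^ (2 * j) * 2 ^ c * 2 ^ c := by rw [hpd']; gcongr
      _ = _ := by ring
  have hc1 : 1 ≤ 2 ^ c := Nat.one_le_two_pow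
  have hpd'B : pd' * 2 ^ c ≤ B := by
    refine le_trans ?_ h.fraction
    rw [pow_succ (2 ^ c)]
    exact Nat.mul_le_mul_right _ (hpd'j.trans (Nat.pow_le_pow_right hc1 (by omega)))
  -- The new price is below `2 ^ c`, so the numerator is below `2 ^ c * pd'`; the odd exponent in
  -- `fraction` leaves room for this factor.
  have hpn'B : pn' ≤ B := by
    rw [hprice', div_lt_iff₀ (by exact_mod_cast hpd'0)] at hplt
    have : pn' < 2 ^ c * pd' := by exact_mod_cast hplt
    rw [mul_comm] at this
    omega
  have hpd'B' : pd' ≤ B := (Nat.le_mul_of_pos_right _ hc1).trans hpd'B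
  have hcB : 2 ^ c ≤ B := (Nat.le_mul_of_pos_left _ hpd'0).trans hpd'B
  refine Run.assign_seq (T := 6) 0 (g y : ℕ) rfl
    (by rw [RExpr.eval_cell i (by simp [hi₂]), h11]) (by rw [Int.natAbs_natCast]; omega) ?_
  refine Run.query_seq (T := 5) i y (g y) (by simp [hi₂]) (by simp [h44₂]) (by simp)
    (by omega) (by omega) ?_
  refine Run.query_seq (T := 4) i y (g x) (by simp [hi₂]) (by simp [h44₂]) (by simp [h45₂])
    (by omega) (by omega) ?_
  refine Run.assign_seq (T := 3) 0 (pn' : ℕ) rfl ?_ (by rw [Int.natAbs_natCast]; exact hpn'B) ?_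
  · have hd2 := hdZ
    simp only [RExpr.eval_add, RExpr.eval_sub, RExpr.eval_mul, eval_reg, Memory.write_same,
      Memory.write_ne, ne_eq, Nat.reduceEqDiff, not_false_eq_true, h41₂, h42₂]
    rw [hd2, hpn']
    push_cast; rfl
  refine Run.assign_seq (T := 2) 0 (pd' : ℕ) rfl ?_ (by rw [Int.natAbs_natCast]; exact hpd'B') ?_
  · simp [h42₂, hpd', y₁, y₀]
  refine Run.assign_seq (T := 1) 0 (g y : ℕ) rfl (by simp) (by rw [Int.natAbs_natCast]; omega) ?_
  refine Run.assign 0 (y : ℕ) rfl (by simp [h44₂]) (by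
    rw [Int.natAbs_natCast]; exact le_trans hyt (h.index i)) ?_
  exact ⟨y, hgy, hyt, by simp, by simp [← hg], by simpa using h10₂, pn', pd', by simp, by simp,
    hpd'0,
    hpd'j, hprice'⟩

theorem run_paymentProg (h : IsInstance q B m c K ε a b N t) {σ : Memory}
    (hin : HasInput m K a b σ) {i : Fin n} (hi : σ 40 0 = (i : ℕ)) (h1 : σ 1 i = (t i : ℕ))
    (h10 : ∀ j : Fin n, σ 10 j = (t j : ℕ)) (h4 : σ 4 i = share q m K ε N t i (t i)) :
    Run q B paymentProg σ (paymentTime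
      (allocTime n (maxSteps K) (n * unitsBound n (maxSteps K) ⌈1 / ε⌉₊) B.size) B.size
        (maxSteps K))
      fun σ' => (∀ j : Fin n, σ' 10 j = (t j : ℕ)) ∧ ∃ pn pd : ℤ,
        σ' 5 = Function.update (σ 5) i pn ∧ σ' 6 = Function.update (σ 6) i pd ∧ pd ≠ 0 ∧
        price (oracleDomain q i (N i)) (share q m K ε N t i) (share q m K ε N t i (t i))
          = (pn : ℝ) / pd := by
  set g := share q m K ε N t i with hg
  set Ta := allocTime n (maxSteps K) (n * unitsBound n (maxSteps K) ⌈1 / ε⌉₊) B.size with hTa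
  have hmono : Monotone g := h.monotone_share i
  have hmB : m ≤ B := by have := h.large.items; omega
  have hcB : (2 ^ c) ^ (2 * maxSteps K + 1) ≤ B := h.fraction
  have hc1 : 1 ≤ 2 ^ c := Nat.one_le_two_pow
  have hB1 : 1 ≤ B := le_trans (Nat.one_le_pow _ _ hc1) hcB
  refine (Run.assign_seq (T := Ta + 1 +
    (1 + (maxSteps K * (incrementTime Ta B.size + 1) + 1 + 3)) + 2) 0 0 rfl rfl (by simp) ?_).mono
    (by unfold paymentTime; omega)
    fun _ _ h => h
  refine Run.assign_seq (T := Ta + 1 +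
    (1 + (maxSteps K * (incrementTime Ta B.size + 1) + 1 + 3)) + 1) 0 1 rfl rfl
      (by simpa using hB1) ?_
  refine Run.assign_seq (T := Ta + 1 +
    (1 + (maxSteps K * (incrementTime Ta B.size + 1) + 1 + 3))) 0 0 rfl rfl (by simp) ?_
  refine Run.seq (h.run_allocAtProg (hin.congr (by simp) (by simp) (by simp)) (by simpa using hi)
    (fun j _ => by simpa using h10 j) (t i).bot ((t i).bot_le _) rfl) ?_
  rintro σ₁ hfr₁ ⟨h11, h10₁⟩
  have hin₁ : HasInput m K a b σ₁ := hin.congr (by simp [hfr₁ 0 rfl]) (by simp [hfr₁ 2 rfl])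
    (by simp [hfr₁ 3 rfl])
  have hi₁ : σ₁ 40 0 = (i : ℕ) := by simp [hfr₁ 40 rfl, hi]
  have hgm : ∀ x, g x ≤ m := share_le i
  rw [← hg] at h11
  refine Run.seq (R := fun σ' => σ' = σ₁.write 45 0 (g (t i).bot)) (T := 1)
    (Run.assign 0 _ rfl (by rw [RExpr.eval_cell i (by simp [hi₁]), h11])
      (by rw [Int.natAbs_natCast]; exact (hgm _).trans hmB) rfl) ?_
  rintro σ₂ - rfl
  have hst : PayState q m c K ε N t i (t i).bot 0 (σ₁.write 45 0 (g (t i).bot)) := by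
    refine ⟨(t i).bot_le _, ?_, by simp [hg], by simpa using h10₁, 0, 1, ?_, ?_, by omega,
      by simp, ?_⟩
    · simp [hfr₁ 43 rfl, DomainIndex.bot]
    · simp [hfr₁ 41 rfl]
    · simp [hfr₁ 42 rfl]
    · rw [price_of_forall_le fun y => hmono ((t i).bot_le y)]; simp
  set σ₂ := σ₁.write 45 0 (g (t i).bot) with hσ₂
  have hin₂ : HasInput m K a b σ₂ := hin₁.congr (by simp [hσ₂]) (by simp [hσ₂]) (by simp [hσ₂])
  have hi₂ : σ₂ 40 0 = (i : ℕ) := by simp [hσ₂, hi₁]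
  have h1₂ : σ₂ 1 i = (t i : ℕ) := by simp [hσ₂, hfr₁ 1 rfl, h1]
  have h4₂ : σ₂ 4 i = g (t i) := by simp [hσ₂, hfr₁ 4 rfl, h4]
  have h5₂ : σ₂ 5 = σ 5 := by simp [hσ₂, hfr₁ 5 rfl]
  have h6₂ : σ₂ 6 = σ 6 := by simp [hσ₂, hfr₁ 6 rfl]
  clear_value σ₂
  have hcard := card_le_maxSteps K i
  refine Run.seq (R := fun σ' => ∃ (x : DomainIndex (N i)) (j : ℕ), j ≤ maxSteps K ∧
    PayState q m c K ε N t i x j σ' ∧ g x = g (t i)) ?_ ?_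
  -- The measure counts the steps of `i` above his current share. A positive share is a step, so
  -- each increment uses one up, and at most `k` increments occur.
  · refine (Run.whileLe (T := incrementTime Ta B.size) (fun r σ' => ∃ (x : DomainIndex (N i))
      (j : ℕ),
      r = ((K i).filter (g x < ·)).card ∧ j + r ≤ maxSteps K ∧ PayState q m c K ε N t i x j σ')
      ?_ ((K i).filter (g (t i).bot < ·)).card ⟨_, 0, rfl, ?_, hst⟩).mono ?_ ?_
    · rintro r σ₃ hfr₃ ⟨x, j, rfl, hj, hst₃⟩ hg₃
      have hin₃ : HasInput m K a b σ₃ := hin₂.congr (hfr₃ 0 rfl) (hfr₃ 2 rfl) (hfr₃ 3 rfl)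
      have hi₃ : σ₃ 40 0 = (i : ℕ) := by rw [hfr₃ 40 rfl, hi₂]
      have h45₃ := hst₃.2.2.1
      rw [← hg] at h45₃
      rw [RExpr.eval_cell i (by simp [hi₃]), hfr₃ 4 rfl, h4₂] at hg₃
      simp only [RExpr.eval_add, eval_reg, RExpr.eval_one, h45₃] at hg₃
      have hlt : g x < g (t i) := by exact_mod_cast hg₃
      have hcardlt : ∀ y, g x < g y →
          ((K i).filter (g y < ·)).card < ((K i).filter (g x < ·)).card := by
        intro y hy
        refine Finset.card_lt_card (Finset.ssubset_iff_subset_ne.2 ⟨fun z hz => ?_, fun e => ?_⟩)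
        · have hz' := Finset.mem_filter.1 hz
          exact Finset.mem_filter.2 ⟨hz'.1, hy.trans hz'.2⟩
        · have hmem : g y ∈ (K i).filter (g x < ·) :=
            Finset.mem_filter.2 ⟨h.share_mem (show 1 ≤ g y by omega), hy⟩
          rw [← e] at hmem
          exact lt_irrefl _ (Finset.mem_filter.1 hmem).2
      have := hcardlt _ hlt
      refine (h.run_incrementProg hin₃ hi₃ (by rw [hfr₃ 1 rfl, h1₂]) hst₃ (by omega) hlt).mono
        le_rfl ?_
      rintro σ' - ⟨y, hy, hst'⟩
      have := hcardlt y hy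
      exact ⟨_, this, y, j + 1, rfl, by omega, hst'⟩
    · have := Finset.card_filter_le (K i) (g (t i).bot < ·)
      omega
    · have := Finset.card_filter_le (K i) (g (t i).bot < ·)
      gcongr
      omega
    · rintro σ' hfr' ⟨⟨r, x, j, -, hj, hst'⟩, hg'⟩
      refine ⟨x, j, by omega, hst', ?_⟩
      have h45' := hst'.2.2.1
      rw [← hg] at h45'
      rw [RExpr.eval_cell i (by simp [hfr' 40 rfl, hi₂]), hfr' 4 rfl, h4₂] at hg'
      simp only [RExpr.eval_add, eval_reg, RExpr.eval_one, h45'] at hg'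
      have h2 : ¬ g x + 1 ≤ g (t i) := by exact_mod_cast hg'
      have h3 := hmono hst'.1
      omega
  rintro σ₃ hfr₃ ⟨x, j, hj, ⟨hxt, -, -, h10₃, pn, pd, h41, h42, hpd, hpdj, hprice⟩, hgx⟩
  rw [← hg, hgx] at hprice
  have hpdc : pd * 2 ^ c ≤ B := by
    refine le_trans ?_ hcB
    rw [pow_succ (2 ^ c)]
    exact Nat.mul_le_mul_right _ (hpdj.trans (Nat.pow_le_pow_right hc1 (by omega)))
  have hpdB : pd ≤ B := (Nat.le_mul_of_pos_right _ hc1).trans hpdc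
  have hpnB : pn ≤ B := by
    have := h.price_lt (le_refl (t i))
    rw [← hg, hprice, div_lt_iff₀ (by exact_mod_cast hpd)] at this
    have : pn < 2 ^ c * pd := by exact_mod_cast this
    rw [mul_comm] at this
    omega
  have hi₃ : σ₃ 40 0 = (i : ℕ) := by rw [hfr₃ 40 rfl, hi₂]
  -- The search has overwritten the index of `i` in the profile; it is restored for the next player.
  refine Run.assign_seq (T := 2) i (t i : ℕ) (by simp [hi₃])
    (by rw [RExpr.eval_cell i (by simp [hi₃]), hfr₃ 1 rfl, h1₂])
    (by rw [Int.natAbs_natCast]; exact h.index i) ?_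
  refine Run.assign_seq (T := 1) i pn (by simp [hi₃]) (by simp [h41])
    (by rw [Int.natAbs_natCast]; exact hpnB) ?_
  refine Run.assign i pd (by simp [hi₃]) (by simp [h42])
    (by rw [Int.natAbs_natCast]; exact hpdB) ?_
  refine ⟨fun l => ?_, pn, pd, ?_, ?_, by exact_mod_cast hpd.ne',
    by rw [hprice, Int.cast_natCast, Int.cast_natCast]⟩
  · by_cases hl : l = i
    · subst hl; simp
    · have hne : (l : ℕ) ≠ i := fun e => hl (Fin.ext e)
      simpa [Memory.write_idx_ne hne] using h10₃ l hl
  · simp [Memory.write, hfr₃ 5 rfl, h5₂]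
  · simp [Memory.write, hfr₃ 6 rfl, h6₂]

theorem run_mechanismProg (h : IsInstance q B m c K ε a b N t) {σ : Memory}
    (hin : HasInput m K a b σ) (h1 : ∀ i : Fin n, σ 1 i = (t i : ℕ)) :
    Run q B mechanismProg σ (mechanismTime n (maxSteps K) ⌈1 / ε⌉₊ B.size) fun σ' =>
      IsOutput σ' (allocRule m K ε fun i : Fin n => oracleDomain q i (N i) (t i))
        (payment (fun i : Fin n => oracleDomain q i (N i))
          (fun x => allocRule m K ε fun i : Fin n => oracleDomain q i (N i) (x i)) t) := by
  have hn := pos_of_one_le_maxSteps h.steps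
  have hnB := h.large.players
  have hmB : m ≤ B := by have := h.large.items; omega
  set Ta := allocTime n (maxSteps K) (n * unitsBound n (maxSteps K) ⌈1 / ε⌉₊) B.size with hTa
  set f := fun x : ∀ i, DomainIndex (N i) => allocRule m K ε fun i : Fin n => oracleDomain q i
    (N i) (x i)
    with hf
  refine (Run.seq (T := n * (1 + 2) + 2) (T' := Ta + (n * (1 + 2) + 2 +
    (n * (paymentTime Ta B.size (maxSteps K) + 2) + 2))) (R := fun σ' => ∀ i : Fin n, σ' 10 i =
      (t i : ℕ)) ?_ ?_).mono
    (by unfold mechanismTime; rw [← hTa]; omega) fun _ _ h => h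
  · refine (Run.forLt (T := 1) n (fun j σ' => ∀ i : Fin n, (i : ℕ) < j → σ' 10 i =
      (t i : ℕ)) hnB rfl
      ?_ ?_ (by simp)).mono le_rfl fun σ' _ h i => h.2 i i.2
    · intro j σ' hfr _
      rw [RExpr.eval_cell_zero, hfr 0 rfl, hin.players]
    · intro j hj σ' hfr hx hI
      refine Run.assign j (t ⟨j, hj⟩ : ℕ) (by simp [hx])
        (by rw [RExpr.eval_cell j (by simp [hx]), hfr 1 rfl]; exact h1 ⟨j, hj⟩)
        (by rw [Int.natAbs_natCast]; exact h.index _) ?_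
      intro i hi
      by_cases hij : (i : ℕ) = j
      · obtain rfl : i = ⟨j, hj⟩ := Fin.ext hij
        simp
      · simpa [Memory.write_idx_ne hij] using hI i (by omega)
  intro σ₁ hfr₁ h10₁
  have hin₁ : HasInput m K a b σ₁ := hin.congr (hfr₁ 0 rfl) (hfr₁ 2 rfl) (hfr₁ 3 rfl)
  have hprof : profile q (fun j => (t j : ℕ)) = fun j : Fin n => oracleDomain q j (N j) (t j) := rfl
  have hval : HasValues q n m c (fun j => (t j : ℕ)) := by
    have := h.values ⟨0, hn⟩ (t ⟨0, hn⟩) le_rfl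
    rwa [Function.update_eq_self] at this
  refine Run.seq (run_allocProg hin₁ h10₁ hval (fun i => (h.domain i).1 _)
    (fun i => (h.domain i).2.1 _) h.steps h.eps h.num_pos h.den_pos h.large) ?_
  intro σ₂ hfr₂ h11₂
  rw [hprof] at h11₂
  have hin₂ : HasInput m K a b σ₂ := hin₁.congr (hfr₂ 0 rfl) (hfr₂ 2 rfl) (hfr₂ 3 rfl)
  refine Run.seq (R := fun σ' => ∀ i : Fin n, σ' 4 i = f t i) ?_ ?_
  · refine (Run.forLt (T := 1) n (fun j σ' => ∀ i : Fin n, (i : ℕ) < j → σ' 4 i = f t i) hnB rfl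
      ?_ ?_ (by simp)).mono le_rfl fun σ' _ h i => h.2 i i.2
    · intro j σ' hfr _
      rw [RExpr.eval_cell_zero, hfr 0 rfl, hin₂.players]
    · intro j hj σ' hfr hx hI
      have hle : f t ⟨j, hj⟩ ≤ m := (isSelected_allocRule m K ε _).1.le _
      refine Run.assign j (f t ⟨j, hj⟩ : ℕ) (by simp [hx])
        (by rw [RExpr.eval_cell j (by simp [hx]), hfr 11 rfl]; exact h11₂ ⟨j, hj⟩)
        (by rw [Int.natAbs_natCast]; omega) ?_
      intro i hi
      by_cases hij : (i : ℕ) = j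
      · obtain rfl : i = ⟨j, hj⟩ := Fin.ext hij
        simp
      · simpa [Memory.write_idx_ne hij] using hI i (by omega)
  intro σ₃ hfr₃ h4₃
  have hin₃ : HasInput m K a b σ₃ := hin₂.congr (hfr₃ 0 rfl) (hfr₃ 2 rfl) (hfr₃ 3 rfl)
  have h10₃ : ∀ i : Fin n, σ₃ 10 i = (t i : ℕ) := by
    rw [hfr₃ 10 rfl, hfr₂ 10 rfl]; exact h10₁
  have h1₃ : ∀ i : Fin n, σ₃ 1 i = (t i : ℕ) := by
    rw [hfr₃ 1 rfl, hfr₂ 1 rfl, hfr₁ 1 rfl]; exact h1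
  refine (Run.forLt (T := paymentTime Ta B.size (maxSteps K)) n (fun j σ' =>
    (∀ i : Fin n, σ' 10 i = (t i : ℕ)) ∧ ∀ i : Fin n, (i : ℕ) < j → σ' 6 i ≠ 0 ∧
      payment (fun i : Fin n => oracleDomain q i (N i)) f t i = (σ' 5 i : ℝ) / (σ' 6 i : ℝ)) hnB rfl
      ?_ ?_ ?_).mono le_rfl ?_
  · intro j σ' hfr _
    rw [RExpr.eval_cell_zero, hfr 0 rfl, hin₃.players]
  · rintro j hj σ₄ hfr₄ hx₄ ⟨h10₄, hI⟩
    have hin₄ : HasInput m K a b σ₄ := hin₃.congr (hfr₄ 0 rfl) (hfr₄ 2 rfl) (hfr₄ 3 rfl)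
    have hshare : share q m K ε N t ⟨j, hj⟩ (t ⟨j, hj⟩) = f t ⟨j, hj⟩ := by
      unfold share; rw [Function.update_eq_self]
    refine (h.run_paymentProg (i := ⟨j, hj⟩) hin₄ hx₄ (by rw [hfr₄ 1 rfl, h1₃]) h10₄
      (by rw [hfr₄ 4 rfl, h4₃, hshare])).mono le_rfl ?_
    rintro σ' - ⟨h10', pn, pd, h5, h6, hpd, hprice⟩
    refine ⟨by simpa using h10', fun i hi => ?_⟩
    rw [Memory.write_ne (by decide), Memory.write_ne (by decide), h5, h6]
    by_cases hij : (i : ℕ) = j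
    · obtain rfl : i = ⟨j, hj⟩ := Fin.ext hij
      rw [hshare] at hprice
      simpa using ⟨hpd, hprice⟩
    · rw [Function.update_of_ne hij, Function.update_of_ne hij]
      exact hI i (by omega)
  · exact ⟨by simpa using h10₃, by simp⟩
  · rintro σ' hfr' ⟨-, -, hI⟩ i
    exact ⟨by rw [hfr' 4 rfl, h4₃], hI i i.2⟩

end IsInstance

end

/-! ### Polynomial running time -/

/-- The number of bits that suffices for the registers, if the parameters are at most `x`. -/
def registerLength (x : ℕ) : ℕ := x * (2 * x + 1) + 12 * x

/-- The time bound is built from `x` and constants by sums, products and fixed powers. Here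
`registerLength x + 1` is the binary length of `2 ^ registerLength x`. -/
theorem polyBounded_time (F : ℕ) : PolyBounded fun x =>
    mechanismTime x x x (registerLength x + 1) * (F * (registerLength x + 1 + 1) ^ 2) := by
  unfold mechanismTime paymentTime incrementTime allocTime unitsBound registerLength
  repeat' with_reducible first
    | exact PolyBounded.const _
    | exact PolyBounded.id
    | refine PolyBounded.add ?_ ?_
    | refine PolyBounded.mul ?_ ?_
    | refine PolyBounded.pow ?_ _

theorem mechanismTime_mono {n k e S n' k' e' S' : ℕ} (hn : n ≤ n') (hk : k ≤ k') (he : e ≤ e')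
    (hS : S ≤ S') : mechanismTime n k e S ≤ mechanismTime n' k' e' S' := by
  unfold mechanismTime paymentTime incrementTime allocTime unitsBound
  gcongr

/-- Every parameter is at most `y = 2 ^ x`, apart from `m + 1 ≤ 2 * y`. Every requirement is then at
most `16 * y ^ 8 ≤ y ^ 12`, which the summand `12 * x` of `registerLength` covers. -/
theorem isLarge_of_le {n m k c a b e x : ℕ} (hx : 1 ≤ x) (hn : n ≤ x) (hk : k ≤ x) (he : e ≤ x)
    (hc : c ≤ x) (hm : m < 2 ^ (x + 1)) (ha : a ≤ 2 ^ x) (hb : b ≤ 2 ^ x) :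
    IsLarge n m k c a b e (2 ^ registerLength x) := by
  have hB : (2 ^ x) ^ 12 ≤ 2 ^ registerLength x := by
    rw [← pow_mul]
    exact Nat.pow_le_pow_right (by norm_num) (by unfold registerLength; omega)
  have hcy : 2 ^ c ≤ 2 ^ x := Nat.pow_le_pow_right (by norm_num) hc
  have hxy := (Nat.lt_two_pow_self (n := x)).le
  have h2 : 2 ≤ 2 ^ x := by
    calc 2 = 2 ^ 1 := rfl
      _ ≤ 2 ^ x := Nat.pow_le_pow_right (by norm_num) hx
  rw [pow_succ] at hm
  set y := 2 ^ x
  have hny := hn.trans hxy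
  have hky := hk.trans hxy
  have hey := he.trans hxy
  have hy4 : 16 ≤ y ^ 4 := Nat.pow_le_pow_left h2 4
  have hle : ∀ p ≤ 8, 16 * y ^ p ≤ 2 ^ registerLength x := fun p hp => by
    refine le_trans ?_ hB
    calc 16 * y ^ p ≤ y ^ 4 * y ^ 8 := Nat.mul_le_mul hy4 (Nat.pow_le_pow_right (by omega) hp)
      _ = y ^ 12 := by ring
  have h1 := hle 1 (by norm_num)
  rw [pow_one] at h1
  have hsq := hle 2 (by norm_num)
  have h8 := hle 8 le_rfl
  constructor
  · have : a * 2 ^ c ≤ y * y := by gcongr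
    nlinarith
  · calc b * 2 ^ c * (3 * n ^ 2 * k ^ 2) * (4 * k * n)
        ≤ y * y * (3 * y ^ 2 * y ^ 2) * (4 * y * y) := by gcongr
      _ = 12 * y ^ 8 := by ring
      _ ≤ _ := by omega
  · have h48 : y ^ 4 ≤ y ^ 8 := Nat.pow_le_pow_right (by omega) (by norm_num)
    calc n * unitsBound n k e + 1 ≤ y * (12 * y ^ 3 * y ^ 3 * y + 2 * y ^ 2 * y) + 1 := by
          unfold unitsBound; gcongr
      _ = 12 * y ^ 8 + 2 * y ^ 4 + 1 := by ring
      _ ≤ _ := by omega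
  · omega
  · have : 2 * k * n ≤ 2 * y * y := by gcongr
    nlinarith
  · omega
  · omega

theorem bounded_inputMemory {n m : ℕ} {K : Fin n → Finset ℕ} {ε : ℚ} {t : Fin n → ℕ} {B : ℕ}
    (hn : n ≤ B) (hm : m ≤ B) (hk : maxSteps K ≤ B) (hnum : ε.num.natAbs ≤ B) (hden : ε.den ≤ B)
    (ht : ∀ i, t i ≤ B) (hK : ∀ i, ∀ s ∈ K i, s ≤ B) : (inputMemory m K ε t).Bounded B := by
  intro a j
  match a with
  | 0 =>
    match j with
    | 0 | 1 | 2 | 3 | 4 => simpa [inputMemory]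
    | j + 5 => simp [inputMemory]
  | 1 =>
    by_cases h : j < n
    · simpa [inputMemory, h] using ht _
    · simp [inputMemory, h]
  | 2 =>
    by_cases h : j < n
    · simpa [inputMemory, h] using (card_le_maxSteps K _).trans hk
    · simp [inputMemory, h]
  | 3 =>
    by_cases h : j / maxSteps K < n
    · simp only [inputMemory, h, dif_pos, Int.natAbs_natCast]
      rw [List.getD_eq_getElem?_getD]
      rcases lt_or_ge (j % maxSteps K) ((K ⟨_, h⟩).sort (· ≤ ·)).length with h1 | h1
      · rw [List.getElem?_eq_getElem h1]
        exact hK _ _ ((Finset.mem_sort _).1 (List.getElem_mem h1))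
      · rw [List.getElem?_eq_none h1]; simp
    · simp [inputMemory, h]
  | a + 4 => simp [inputMemory]

theorem hasInput_inputMemory {n m : ℕ} {K : Fin n → Finset ℕ} {ε : ℚ} {t : Fin n → ℕ}
    (hε : 0 < ε) : HasInput m K ε.num.toNat ε.den (inputMemory m K ε t) where
  players := rfl
  items := rfl
  steps := rfl
  num := (Int.toNat_of_nonneg (Rat.num_pos.2 hε).le).symm
  den := rfl
  card i := by simp [inputMemory]
  size i r hr := by
    have hrk := hr.trans_le (card_le_maxSteps K i)
    have h1 : ((i : ℕ) * maxSteps K + r) / maxSteps K = i := by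
      rw [Nat.mul_comm, Nat.mul_add_div (by omega), Nat.div_eq_of_lt hrk, Nat.add_zero]
    have h2 : ((i : ℕ) * maxSteps K + r) % maxSteps K = r := by
      rw [Nat.mul_comm, Nat.mul_add_mod, Nat.mod_eq_of_lt hrk]
    simp only [inputMemory, h1, h2, i.2, dif_pos, Fin.eta]
    rw [optionSize_succ hr]

/-- Single crossing from the quantity `0`. It lets the assumption on representations carry the bit
bound `c` down to all indices below the reported one. -/
theorem oracleDomain_mono {q : ValueOracle} {i m : ℕ} {K : Finset ℕ} {N : ℕ∞}
    (hV : IsMindedSingleCrossing m K (oracleDomain q i N)) {x y : DomainIndex N} (hxy : x ≤ y)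
    {s : ℕ} (hs : s ≤ m) : oracleDomain q i N x s ≤ oracleDomain q i N y s := by
  rcases Nat.eq_zero_or_pos s with rfl | hpos
  · rw [(hV.1 x).1, (hV.1 y).1]
  · have := marginal_mono hV.2.2 hxy hpos hs
    rwa [(hV.1 x).1, (hV.1 y).1, sub_zero, sub_zero] at this

theorem natAbs_le_two_pow_of_bits_le {z : ℤ} {x : ℕ} (h : bits z ≤ x) : z.natAbs ≤ 2 ^ x :=
  (Nat.size_le.1 ((Nat.le_succ _).trans h)).le

theorem mainTheorem3 :
    -- implementability, incentive compatibility of the associated payments, and approximation,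
    -- for all single-crossing k-minded domains
    (∀ (n m : ℕ) (K : Fin n → Finset ℕ) (ε : ℝ) (T : Fin n → Type u)
      [∀ i, LinearOrder (T i)] (V : ∀ i, T i → ℕ → ℝ),
      0 < ε → 1 ≤ maxSteps K → (∀ i, IsMindedSingleCrossing m (K i) (V i)) →
      let f : (∀ i, T i) → Fin n → ℕ := fun t => allocRule m K ε fun i => V i (t i)
      Implementable V f ∧
      IncentiveCompatible V f (payment V f) ∧
      ∀ t : ∀ i, T i, IsAllocation m (f t) ∧ ∀ o : Fin n → ℕ, IsAllocation m o →
        (1 - ε) * welfare (fun i => V i (t i)) o ≤ welfare (fun i => V i (t i)) (f t)) ∧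
    -- one program computes the allocation and the payments in polynomial time
    ∃ (prog : Program) (C d : ℕ),
      ∀ (n m : ℕ) (K : Fin n → Finset ℕ) (ε : ℚ) (N : Fin n → ℕ∞) (q : ValueOracle),
      0 < ε → 1 ≤ maxSteps K →
      -- the oracle describes single-crossing k-minded domains
      (∀ (i : Fin n) (t s : ℕ), (t : ℕ∞) < N i → s ≤ m → (q i t s).2 ≠ 0) →
      (∀ i, IsMindedSingleCrossing m (K i) (oracleDomain q i (N i))) →
      -- smaller numbers do not have longer representations
      (∀ (i i' : Fin n) (t t' s s' : ℕ), (t : ℕ∞) < N i → (t' : ℕ∞) < N i' → s ≤ m → s' ≤ m →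
        answerValue (q i t s) ≤ answerValue (q i' t' s') →
        answerBits (q i t s) ≤ answerBits (q i' t' s')) →
      ∀ (t : ∀ i, DomainIndex (N i)) (c : ℕ),
      (∀ (i : Fin n) (s : ℕ), s ≤ m → answerBits (q i (t i) s) ≤ c) →
      let V : ∀ i : Fin n, DomainIndex (N i) → ℕ → ℝ := fun i => oracleDomain q i (N i)
      let f : (∀ i, DomainIndex (N i)) → Fin n → ℕ := fun x => allocRule m K ε fun i => V i (x i)
      let B : ℕ := C * (maxSteps K + n + ⌈1 / ε⌉₊ + Nat.log 2 m + c
        + Nat.log 2 (Finset.univ.sup fun i => (t i : ℕ)) + bits ε.num + bits ε.den) ^ d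
      ∃ (σ : Memory) (time queries : ℕ),
        Exec q prog (inputMemory m K ε fun i => t i) σ time queries ∧
        IsOutput σ (f t) (payment V f t) ∧ time ≤ B ∧ queries ≤ B := by
  refine ⟨fun n m K ε T _ V hε hk hV => ?_, ?_⟩
  · have hic := incentiveCompatible_allocRule hε hk hV
    exact ⟨implementable_of_incentiveCompatible hic, hic, fun t =>
      ⟨(isSelected_allocRule m K ε _).1, fun o ho =>
        allocRule_approx hε hk (fun j => ⟨(hV j).1 _, (hV j).2.1 _⟩) ho⟩⟩
  obtain ⟨C, d, hCd⟩ := polyBounded_time mechanismProg.costFactor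
  refine ⟨mechanismProg, C, d, fun n m K ε N q hε hk hden hV hbits t c hc => ?_⟩
  intro V f B
  -- One number dominates all parameters, so the time becomes a polynomial in one variable. It is at
  -- least `1`, as `PolyBounded` requires.
  set x := maxSteps K + n + ⌈1 / ε⌉₊ + Nat.log 2 m + c
    + Nat.log 2 (Finset.univ.sup fun i => (t i : ℕ)) + bits ε.num + bits ε.den with hx
  have hx1 : 1 ≤ x := by omega
  have hceil : ⌈1 / (ε : ℝ)⌉₊ = ⌈1 / ε⌉₊ := by
    rw [← Int.ceil_toNat, ← Int.ceil_toNat, ← Rat.ceil_cast (α := ℝ) (1 / ε)]; push_cast; rfl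
  have hlog : ∀ y, Nat.log 2 y ≤ x → y < 2 ^ (x + 1) := fun y hy =>
    (Nat.lt_pow_succ_log_self (by norm_num) y).trans_le
      (Nat.pow_le_pow_right (by norm_num) (Nat.succ_le_succ hy))
  have hm := hlog m (by omega)
  have hnum : ε.num.natAbs ≤ 2 ^ x := natAbs_le_two_pow_of_bits_le (by omega)
  have hdenx : ε.den ≤ 2 ^ x := by
    have := natAbs_le_two_pow_of_bits_le (z := ε.den) (x := x) (by omega)
    simpa using this
  have hBx : 2 ^ (x + 1) ≤ 2 ^ registerLength x :=
    Nat.pow_le_pow_right (by norm_num) (by unfold registerLength; omega)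
  have hBx' : 2 ^ x ≤ 2 ^ registerLength x := le_trans
    (Nat.pow_le_pow_right (by norm_num) (Nat.le_succ x)) hBx
  have hxB : x ≤ 2 ^ registerLength x := (Nat.lt_two_pow_self (n := x)).le.trans hBx'
  have ht : ∀ i, (t i : ℕ) ≤ 2 ^ registerLength x := fun i =>
    (Finset.le_sup (f := fun i => (t i : ℕ)) (Finset.mem_univ i)).trans
      ((hlog _ (by omega)).le.trans hBx)
  have hinst : IsInstance q (2 ^ registerLength x) m c K (ε : ℝ) ε.num.toNat ε.den N t := by
    refine ⟨hk, ?_, ?_, ε.den_pos, hV, ?_, ?_, ?_, ht⟩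
    · rw [← Int.cast_natCast, Int.toNat_of_nonneg (Rat.num_pos.2 hε).le]
      exact Rat.cast_def ε
    · have := Rat.num_pos.2 hε; omega
    · intro i y hy j s hs
      by_cases hj : j = i
      · subst hj
        rw [Function.update_self]
        exact ⟨hden j y s y.2 hs, (hbits j j y (t j) s s y.2 (t j).2 hs hs
          (oracleDomain_mono (hV j) hy hs)).trans (hc j s hs)⟩
      · rw [Function.update_of_ne hj]
        exact ⟨hden j _ s (t j).2 hs, hc j s hs⟩
    · rw [hceil]
      refine isLarge_of_le hx1 (by omega) (by omega) (by omega) (by omega) hm ?_ hdenx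
      omega
    · rw [← pow_mul]
      refine Nat.pow_le_pow_right (by norm_num) ?_
      -- The first summand of `registerLength` makes room for the unreduced payment fractions.
      have : c * (2 * maxSteps K + 1) ≤ x * (2 * x + 1) := by gcongr <;> omega
      unfold registerLength; omega
  obtain ⟨σ, time, queries, hexec, -, htime, hout⟩ :=
    hinst.run_mechanismProg (hasInput_inputMemory hε) (fun i => by simp [inputMemory])
      (bounded_inputMemory (t := fun i => (t i : ℕ)) (by omega) (by omega) (by omega) (by omega)
        (by omega) ht fun i s hs => by
          have hsm := (Finset.mem_Icc.1 (((hV i).2.1 (t i)).1 hs)).2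
          omega)
  have hB : time ≤ B := by
    refine htime.trans (le_trans ?_ (hCd x hx1))
    rw [Nat.size_pow, hceil]
    exact Nat.mul_le_mul_right _ (mechanismTime_mono (by omega) (by omega) (by omega) le_rfl)
  exact ⟨σ, time, queries, hexec, hout, hB, hexec.queries_le.trans hB⟩
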